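/- For a real number $y>0$ let $\zeta(s;y)=\prod_{p\le y}(1-p^{-s})^{-1}$ (product over primes). For real $z$ let $d_z(n)$ be the $n$-th Dirichlet coefficient of $\zeta(s)^z$, i.e. the multiplicative function with $d_z(p^a)=z(z+1)\cdots(z+a-1)/a!$. Let $I_0(t)=\sum_{n\ge 0}(t/2)^{2n}/n!^2$ and $$C=\int_0^2\log I_0(t)\,\frac{dt}{t^2}+\int_2^\infty(\log I_0(t)-t)\,\frac{dt}{t^2},$$ where both integrals converge absolutely. Write $\log_2 T=\log\log T$. **Theorem 4.1.** Let $T>1$ and $y$ be real numbers with $e^2\log T\le y\le \log T(\log_2T)^4$. Let $z=\delta k$, where $\delta=\pm1$ and $k$ is an integer with $2\le k\le \log T/(e^{10}\log(y/\log T))$. Then the series below converges, and $$\frac1T\int_T^{2T}|\zeta(1+it;y)|^{2z}\,dt=\Bigg(\sum_{\substack{n\ge1\\ p\mid n\Rightarrow p\le y}}\frac{d_z(n)^2}{n^2}\Bigg)\Big(1+O\Big(\exp\Big(-\frac{\log T}{2(\log_2T)^4}\Big)\Big)\Big).$$ Moreover, both the left-hand side and the sum $\sum_{n\ge 1,\ p\mid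 n\Rightarrow p\le y}d_z(n)^2/n^2$ itself are of the form $$\prod_{p\le k}\Big(1-\frac{\delta}{p}\Big)^{-2k\delta}\exp\Big(\frac{2k}{\log k}\Big(C+O\Big(\frac ky+\frac1{\log k}\Big)\Big)\Big).$$ All implied constants are absolute. -/

import Mathlib

noncomputable section

/-- The truncated Euler product `ζ(s; y) = ∏_{p ≤ y} (1 - p^{-s})⁻¹` over the primes `p ≤ y`
(for real `y ≥ 0`). -/
def truncatedZeta (s : ℂ) (y : ℝ) : ℂ :=
  ∏ p ∈ Nat.primesBelow (⌊y⌋₊ + 1), (1 - (p : ℂ) ^ (-s))⁻¹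

/-- The generalized divisor function `d_z(n)`, the `n`-th Dirichlet coefficient of `ζ(s)^z`:
it is multiplicative, and `d_z(p^a) = z (z + 1) ⋯ (z + a - 1) / a!` at prime powers. -/
def genDivisor (z : ℝ) (n : ℕ) : ℝ :=
  n.factorization.prod fun _ a => (ascPochhammer ℝ a).eval z / (a.factorial : ℝ)

/-- The Dirichlet series `∑ d_z(n)² / n²` over the positive integers `n` all of whose prime factors
are at most `y`. -/
def smoothDivisorSum (z y : ℝ) : ℝ :=
  ∑' n : Nat.smoothNumbers (⌊y⌋₊ + 1), genDivisor z n ^ 2 / ((n : ℕ) : ℝ) ^ 2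

/-- The moment `(1/T) ∫_T^{2T} |ζ(1 + it; y)|^m dt`, for an integer `m` of either sign. -/
def truncatedZetaMoment (T y : ℝ) (m : ℤ) : ℝ :=
  (1 / T) * ∫ t in T..(2 * T), ‖truncatedZeta (1 + (t : ℂ) * Complex.I) y‖ ^ m

/-- The modified Bessel function `I₀(t) = ∑_{n ≥ 0} (t/2)^{2n} / n!²`. -/
def besselIZero (t : ℝ) : ℝ :=
  ∑' n : ℕ, (t / 2) ^ (2 * n) / (n.factorial : ℝ) ^ 2

/-- The constant `C = ∫_0^2 log I₀(t) dt/t² + ∫_2^∞ (log I₀(t) - t) dt/t²`. -/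
def momentConstant : ℝ :=
  (∫ t in Set.Ioc (0 : ℝ) 2, Real.log (besselIZero t) / t ^ 2) +
    ∫ t in Set.Ioi (2 : ℝ), (Real.log (besselIZero t) - t) / t ^ 2

end

/-! ### Growth of the zeta function near the line Re s = 1. -/

section ZetaBound

open Complex Filter Topology

/-! The integrand |ζ(1+it;y)|^{2δk} is the product over p ≤ y of |1 - p^{-1-it}|^{-2δk}. By Parseval
the mean of |1 - e^{iφ}/p|^{-2δk} over the circle is Σ_a d_z(p^a)² p^{-2a} (`localSum`), so if the
phases t log p were independent and uniform, the moment would be exactly the Dirichlet sum. Two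
things are needed: independence up to a tiny error, and an evaluation of the product of the local
means.

Independence. Each local factor, divided by its mean, is an absolutely convergent series of terms c
(m/n)^{it} with constant term 1. Over disjoint sets of primes the fractions stay reduced on
multiplication, so constant terms multiply (`TrigSeries.mul`), and a series of height mn ≤ Y has
mean value over [T,2T] equal to its constant term up to 2YS/T, where S bounds the sum of the |c|
(`TrigSeries.norm_integral_sub_le`). The primes are grouped into blocks according to log(k/p), and
each block is cut at a height e^{H_j} by Rankin's trick, at relative cost e^{-α_j H_j}
Σ|c|(mn)^{α_j}. The total height is at most T^{1/3}. Since the blocks are nonnegative, their product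
can be compared with the product of the truncated blocks raised by ε, which are majorants, and a
telescoping estimate keeps all error terms of small height (`abs_mean_prod_sub_one_le`). What makes
the truncation affordable is the size of the weighted coefficient sums. For p not much smaller than
k the bound exp(14k/p) is good enough. For much smaller p it is not, but there the weight p^{α|a-b|}
is at most ρ^a ρ^{-b} + ρ^{-a} ρ^b with ρ = p^α, and in the resulting product the terms linear in α
log p cancel, leaving exp(O(log(2+k/p) + (k/p)(α log p)²)) (`two_mul_localSeries_le`). With α_j ~
8^{-j}/log y and H_j ~ 2^{-j} log T both the gain α_j H_j and the loss are of size 16^{-j}, and the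
hypothesis on k makes the gain win (`abs_mean_sub_one_le_of_large`).

Evaluation. Put x = 1/p. Then log `localSum` = log I₀(2kx) + O(kx²), while the maximum of the
integrand over the circle, which produces the product over p ≤ k, has logarithm 2kx + O(kx²). Primes
below √k are negligible because the mean and the maximum differ by a power of k. The remaining
primes give sums of log I₀(2k/p) - 2k/p for √k < p ≤ k and of log I₀(2k/p) for k < p ≤ y. The prime
number theorem turns these into k/log k times integrals against dt/t², which together make 2C
(`exists_abs_log_smoothDivisorSum_sub_le`).

The prime number theorem is needed with error O(x/log² x). It comes from a power-saving analysis on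
Re s = 1: the 3-4-1 inequality bounds ζ below slightly to the left of that line, so the second
derivative of the transform of ψ(e^u)e^{-u} - 1 is square integrable, and Plancherel together with
the monotonicity of ψ bounds the error pointwise (`exists_abs_psiError_le`). -/

/-- The `n`-th term of an expansion of `(s - 1) ζ(s)` that converges for `0 < re s`. -/
noncomputable def zetaTerm (n : ℕ) (s : ℂ) : ℂ :=
  (s - 1) * (n : ℂ) ^ (-s) - (n : ℂ) ^ (1 - s) + ((n + 1 : ℕ) : ℂ) ^ (1 - s)

/-- The triangle inequality and the mean value inequality. The first bound is free of ‖s‖ but decays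
slowly in n, the second is the reverse; interpolating between them gives an arbitrarily small power
of ‖s‖. -/
lemma norm_cpow_neg_sub_le {n : ℕ} (hn : 1 ≤ n) {s : ℂ} (hs : 0 < s.re) {u : ℝ}
    (hu : u ∈ Set.Icc (n : ℝ) (n + 1)) :
    ‖((n : ℝ) : ℂ) ^ (-s) - (u : ℂ) ^ (-s)‖ ≤ 2 * (n : ℝ) ^ (-s.re) ∧
    ‖((n : ℝ) : ℂ) ^ (-s) - (u : ℂ) ^ (-s)‖ ≤ ‖s‖ * (n : ℝ) ^ (-s.re - 1) := by
  have hn0 : (0 : ℝ) < n := by exact_mod_cast hn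
  constructor
  · refine (norm_sub_le _ _).trans ?_
    rw [norm_cpow_eq_rpow_re_of_pos hn0, norm_cpow_eq_rpow_re_of_pos (hn0.trans_le hu.1), neg_re]
    have : u ^ (-s.re) ≤ (n : ℝ) ^ (-s.re) :=
      Real.rpow_le_rpow_of_nonpos hn0 hu.1 (by linarith)
    linarith
  · rw [norm_sub_rev]
    have key := norm_image_sub_le_of_norm_deriv_le_segment' (f := fun v : ℝ => (v : ℂ) ^ (-s))
      (f' := fun v : ℝ => -s * (v : ℂ) ^ (-s - 1)) (a := (n : ℝ)) (b := n + 1)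
      (C := ‖s‖ * (n : ℝ) ^ (-s.re - 1)) ?_ ?_ u hu
    · refine key.trans (mul_le_of_le_one_right (by positivity) (by linarith [hu.2]))
    · intro v hv
      have hv0 : v ≠ 0 := (hn0.trans_le hv.1).ne'
      exact (hasDerivAt_ofReal_cpow_const hv0 (by
        intro h; have := congrArg re h; simp at this; linarith)).hasDerivWithinAt
    · intro v hv
      rw [norm_mul, norm_neg, norm_cpow_eq_rpow_re_of_pos (hn0.trans_le hv.1)]
      gcongr
      simp only [sub_re, neg_re, one_re]
      exact Real.rpow_le_rpow_of_nonpos hn0 hv.1 (by linarith)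

/-- The term is the integral of (s - 1)(n^{-s} - v^{-s}) over v in [n, n+1]. The difference is split
as x^{1-θ} x^θ, with the trivial bound on the first factor and the mean value bound on the second.
-/
lemma norm_zetaTerm_le {θ : ℝ} (hθ0 : 0 < θ) (hθ1 : θ ≤ 1) {n : ℕ} (hn : 1 ≤ n) {s : ℂ}
    (hs : 0 < s.re) :
    ‖zetaTerm n s‖ ≤ ‖s - 1‖ * (2 * ‖s‖ ^ θ * (n : ℝ) ^ (-s.re - θ)) := by
  have hn0 : (0 : ℝ) < n := by exact_mod_cast hn
  have key := norm_image_sub_le_of_norm_deriv_le_segment'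
    (f := fun v : ℝ => (s - 1) * (v : ℂ) * ((n : ℝ) : ℂ) ^ (-s) + (v : ℂ) ^ (1 - s))
    (f' := fun v : ℝ => (s - 1) * (((n : ℝ) : ℂ) ^ (-s) - (v : ℂ) ^ (-s)))
    (a := (n : ℝ)) (b := n + 1)
    (C := ‖s - 1‖ * (2 * ‖s‖ ^ θ * (n : ℝ) ^ (-s.re - θ))) ?_ ?_ (n + 1) (by simp)
  · rw [zetaTerm]
    have h2 : (s - 1) * (n : ℂ) ^ (-s) - (n : ℂ) ^ (1 - s) + ((n + 1 : ℕ) : ℂ) ^ (1 - s) =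
      (s - 1) * (((n : ℝ) + 1 : ℝ) : ℂ) * ((n : ℝ) : ℂ) ^ (-s) + (((n : ℝ) + 1 : ℝ) : ℂ) ^ (1 - s) -
      ((s - 1) * ((n : ℝ) : ℂ) * ((n : ℝ) : ℂ) ^ (-s) + ((n : ℝ) : ℂ) ^ (1 - s)) := by
      push_cast; ring
    rw [h2]
    simpa using key
  · intro v hv
    have hv0 : v ≠ 0 := (hn0.trans_le hv.1).ne'
    refine HasDerivAt.hasDerivWithinAt ?_
    by_cases h1 : s = 1
    · subst h1
      simpa using hasDerivAt_const v (1 : ℂ)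
    have e1 : HasDerivAt (fun v : ℝ => (v : ℂ) ^ (1 - s)) ((1 - s) * (v : ℂ) ^ (1 - s - 1)) v :=
      hasDerivAt_ofReal_cpow_const hv0 (sub_ne_zero.mpr (Ne.symm h1))
    have e2 : HasDerivAt (fun v : ℝ => (s - 1) * (v : ℂ) * ((n : ℝ) : ℂ) ^ (-s))
        ((s - 1) * 1 * ((n : ℝ) : ℂ) ^ (-s)) v :=
      ((hasDerivAt_id v).ofReal_comp.const_mul (s - 1)).mul_const _
    refine (e2.add e1).congr_deriv ?_
    rw [show (1 - s - 1) = -s by ring]; ring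
  · intro v hv
    rw [norm_mul]
    gcongr
    obtain ⟨h1, h2⟩ := norm_cpow_neg_sub_le hn hs ⟨hv.1, hv.2.le⟩
    set x := ‖((n : ℝ) : ℂ) ^ (-s) - (v : ℂ) ^ (-s)‖ with hx
    have hx0 : 0 ≤ x := norm_nonneg _
    have h3 : x = x ^ (1 - θ) * x ^ θ := by
      rw [← Real.rpow_add_of_nonneg hx0 (by linarith) hθ0.le]; simp
    rw [h3]
    calc x ^ (1 - θ) * x ^ θ
        ≤ (2 * (n : ℝ) ^ (-s.re)) ^ (1 - θ) * (‖s‖ * (n : ℝ) ^ (-s.re - 1)) ^ θ := by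
          gcongr
      _ = 2 ^ (1 - θ) * ‖s‖ ^ θ * ((n : ℝ) ^ (-s.re * (1 - θ)) * (n : ℝ) ^ ((-s.re - 1) * θ)) := by
          rw [Real.mul_rpow (by positivity) (by positivity),
            Real.mul_rpow (by positivity) (by positivity), ← Real.rpow_mul hn0.le,
            ← Real.rpow_mul hn0.le]; ring
      _ = 2 ^ (1 - θ) * ‖s‖ ^ θ * (n : ℝ) ^ (-s.re - θ) := by
          rw [← Real.rpow_add hn0]; congr 2; ring
      _ ≤ 2 * ‖s‖ ^ θ * (n : ℝ) ^ (-s.re - θ) := by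
          gcongr
          calc (2 : ℝ) ^ (1 - θ) ≤ 2 ^ (1 : ℝ) := by gcongr <;> linarith
            _ = 2 := by norm_num

/-- The powers with exponent 1 - s telescope to -1 and the rest is (s - 1) times the Dirichlet
series. -/
lemma hasSum_zetaTerm {s : ℂ} (hs : 1 < s.re) :
    HasSum (fun n : ℕ => zetaTerm (n + 1) s) ((s - 1) * riemannZeta s - 1) := by
  have h1 : HasSum (fun n : ℕ => (s - 1) * ((n + 1 : ℕ) : ℂ) ^ (-s)) ((s - 1) * riemannZeta s) := by
    have hsum : Summable fun n : ℕ => 1 / (n : ℂ) ^ s := summable_one_div_nat_cpow.mpr hs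
    have h := ((summable_nat_add_iff 1).mpr hsum).hasSum
    rw [zeta_eq_tsum_one_div_nat_add_one_cpow hs]
    refine HasSum.mul_left _ ?_
    simpa [cpow_neg] using h
  have hne : s - 1 ≠ 0 := by
    intro h; have := congrArg re h; simp at this; linarith
  have h2 : HasSum (fun n : ℕ => ((n + 1 + 1 : ℕ) : ℂ) ^ (1 - s) - ((n + 1 : ℕ) : ℂ) ^ (1 - s))
      (-1) := by
    have hsum : Summable (fun n : ℕ =>
        ((n + 1 + 1 : ℕ) : ℂ) ^ (1 - s) - ((n + 1 : ℕ) : ℂ) ^ (1 - s)) := by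
      have hb : Summable fun n : ℕ => zetaTerm (n + 1) s := by
        refine Summable.of_norm_bounded (g := fun n : ℕ =>
          ‖s - 1‖ * (2 * ‖s‖ ^ (1 : ℝ) * ((n + 1 : ℕ) : ℝ) ^ (-s.re - 1))) ?_
          (fun n => norm_zetaTerm_le one_pos le_rfl (by omega) (by linarith))
        refine ((summable_nat_add_iff (f := fun n : ℕ => (n : ℝ) ^ (-s.re - 1)) 1).mpr
          (Real.summable_nat_rpow.mpr (by linarith))).mul_left _ |>.mul_left _
      refine (hb.sub h1.summable).congr fun n => ?_
      simp only [zetaTerm]; ring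
    refine (hsum.hasSum_iff_tendsto_nat).mpr ?_
    have : ∀ N : ℕ, ∑ n ∈ Finset.range N,
        (((n + 1 + 1 : ℕ) : ℂ) ^ (1 - s) - ((n + 1 : ℕ) : ℂ) ^ (1 - s)) =
        ((N + 1 : ℕ) : ℂ) ^ (1 - s) - 1 := by
      intro N
      rw [Finset.sum_range_sub (fun n : ℕ => ((n + 1 : ℕ) : ℂ) ^ (1 - s))]
      simp
    simp_rw [this]
    have hz : Tendsto (fun N : ℕ => ((N + 1 : ℕ) : ℂ) ^ (1 - s)) atTop (𝓝 0) := by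
      rw [tendsto_zero_iff_norm_tendsto_zero]
      have : ∀ N : ℕ, ‖((N + 1 : ℕ) : ℂ) ^ (1 - s)‖ = ((N + 1 : ℕ) : ℝ) ^ (-(s.re - 1)) := by
        intro N
        rw [norm_natCast_cpow_of_pos (by omega)]
        congr 1; simp
      simp_rw [this]
      exact ((tendsto_rpow_neg_atTop (by linarith)).comp tendsto_natCast_atTop_atTop).comp
        (tendsto_add_atTop_nat 1)
    simpa using hz.sub_const 1
  rw [sub_eq_add_neg]
  refine (h1.add h2).congr_fun fun n => ?_
  simp only [zetaTerm]; ring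

lemma differentiable_zetaTerm {n : ℕ} (hn : 1 ≤ n) : Differentiable ℂ (zetaTerm n) := by
  have h0 : (n : ℂ) ≠ 0 := by exact_mod_cast (by omega : n ≠ 0)
  have h1 : ((n + 1 : ℕ) : ℂ) ≠ 0 := by exact_mod_cast (by omega : n + 1 ≠ 0)
  intro s
  unfold zetaTerm
  refine ((((differentiableAt_id.sub_const 1).mul ?_).sub ?_).add ?_)
  · exact differentiableAt_id.neg.const_cpow (Or.inl h0)
  · exact (differentiableAt_id.const_sub 1).const_cpow (Or.inl h0)
  · exact (differentiableAt_id.const_sub 1).const_cpow (Or.inl h1)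

lemma summable_rpow_one_add (θ : ℝ) (hθ0 : 0 < θ) :
    Summable fun n : ℕ => ((n + 1 : ℕ) : ℝ) ^ (-1 - θ / 2) :=
  (summable_nat_add_iff (f := fun n : ℕ => (n : ℝ) ^ (-1 - θ / 2)) 1).mpr
          (Real.summable_nat_rpow.mpr (by linarith))

lemma norm_zetaTerm_le_of_re {θ : ℝ} (hθ0 : 0 < θ) (hθ1 : θ ≤ 1) (n : ℕ) {s : ℂ}
    (hs : 1 - θ / 2 < s.re) :
    ‖zetaTerm (n + 1) s‖ ≤ ‖s - 1‖ * (2 * ‖s‖ ^ θ * ((n + 1 : ℕ) : ℝ) ^ (-1 - θ / 2)) := by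
  refine (norm_zetaTerm_le hθ0 hθ1 (by omega) (by linarith)).trans ?_
  have : ((n + 1 : ℕ) : ℝ) ^ (-s.re - θ) ≤ ((n + 1 : ℕ) : ℝ) ^ (-1 - θ / 2) :=
    Real.rpow_le_rpow_of_exponent_le (by exact_mod_cast (by omega : 1 ≤ n + 1)) (by linarith)
  gcongr

/-- Both sides are analytic in the half-plane and agree near s = 2, where the Dirichlet series
converges; the identity theorem does the rest. -/
lemma riemannZeta₁_eq_tsum {θ : ℝ} (hθ0 : 0 < θ) (hθ1 : θ ≤ 1) {s : ℂ} (hs : 1 - θ / 2 < s.re) :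
    riemannZeta₁ s = 1 + ∑' n : ℕ, zetaTerm (n + 1) s := by
  have hU : IsOpen {s : ℂ | 1 - θ / 2 < s.re} := isOpen_lt continuous_const continuous_re
  have hdiff : DifferentiableOn ℂ (fun s => ∑' n : ℕ, zetaTerm (n + 1) s)
      {s : ℂ | 1 - θ / 2 < s.re} := by
    intro s hs
    -- The majorant of the terms grows with ‖s‖, so uniform convergence is only available on bounded
    -- pieces.
    set R := ‖s‖ + 1
    have hR : IsOpen ({s : ℂ | 1 - θ / 2 < s.re} ∩ Metric.ball 0 R) := hU.inter Metric.isOpen_ball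
    have hd := differentiableOn_tsum_of_summable_norm
      (u := fun n : ℕ => (R + 1) * (2 * R ^ θ * ((n + 1 : ℕ) : ℝ) ^ (-1 - θ / 2)))
      (((summable_rpow_one_add θ hθ0).mul_left _).mul_left _)
      (fun n => (differentiable_zetaTerm (n := n + 1) (by omega)).differentiableOn) hR
      (fun n w hw => by
        refine (norm_zetaTerm_le_of_re hθ0 hθ1 n hw.1).trans ?_
        have hw2 : ‖w‖ ≤ R := by simpa using (Metric.mem_ball.mp hw.2).le
        have : ‖w - 1‖ ≤ R + 1 := (norm_sub_le _ _).trans (by simpa using hw2)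
        gcongr)
    exact ((hd s ⟨hs, by simp [R]⟩).differentiableAt
      (hR.mem_nhds ⟨hs, by simp [R]⟩)).differentiableWithinAt
  have hA : AnalyticOnNhd ℂ riemannZeta₁ {s : ℂ | 1 - θ / 2 < s.re} :=
    differentiable_riemannZeta₁.differentiableOn.analyticOnNhd hU
  have hB : AnalyticOnNhd ℂ (fun s => 1 + ∑' n : ℕ, zetaTerm (n + 1) s)
      {s : ℂ | 1 - θ / 2 < s.re} := (hdiff.const_add 1).analyticOnNhd hU
  have hpre : IsPreconnected {s : ℂ | 1 - θ / 2 < s.re} :=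
    (convex_halfSpace_re_gt _).isPreconnected
  refine hA.eqOn_of_preconnected_of_eventuallyEq hB hpre (z₀ := 2) ?_ ?_ hs
  · simp; linarith
  · filter_upwards [(isOpen_lt continuous_const continuous_re).mem_nhds
      (show (1 : ℝ) < (2 : ℂ).re by simp)] with w hw
    have hw1 : w ≠ 1 := by rintro rfl; simp at hw
    rw [(hasSum_zetaTerm hw).tsum_eq, riemannZeta_eq_inv_sub_mul hw1]
    field_simp [sub_ne_zero.mpr hw1]
    ring

lemma exists_norm_riemannZeta₁_le {θ : ℝ} (hθ0 : 0 < θ) (hθ1 : θ ≤ 1) :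
    ∃ C : ℝ, 0 < C ∧ ∀ s : ℂ, 1 - θ / 2 < s.re →
      ‖riemannZeta₁ s‖ ≤ 1 + C * ‖s - 1‖ * ‖s‖ ^ θ := by
  refine ⟨2 * ∑' n : ℕ, ((n + 1 : ℕ) : ℝ) ^ (-1 - θ / 2) + 1, ?_, fun s hs => ?_⟩
  · have : 0 ≤ ∑' n : ℕ, ((n + 1 : ℕ) : ℝ) ^ (-1 - θ / 2) := tsum_nonneg fun n => by positivity
    linarith
  rw [riemannZeta₁_eq_tsum hθ0 hθ1 hs]
  refine (norm_add_le _ _).trans ?_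
  rw [norm_one]
  gcongr
  have hb := tsum_of_norm_bounded (f := fun n : ℕ => zetaTerm (n + 1) s)
    (((summable_rpow_one_add θ hθ0).hasSum.mul_left (2 * ‖s‖ ^ θ)).mul_left ‖s - 1‖)
    (fun n => by simpa [mul_assoc] using norm_zetaTerm_le_of_re hθ0 hθ1 n hs)
  refine hb.trans ?_
  have : 0 ≤ ‖s - 1‖ * ‖s‖ ^ θ := by positivity
  nlinarith

end ZetaBound

/-! ### Lower bounds for zeta slightly to the left of Re s = 1. -/

section ZetaLower

open Complex Filter Topology

/-- The expansion with θ = 1/60. The exponent only has to be small enough that, after the losses in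
the 3-4-1 inequality and in Cauchy's estimates, a square integrable power remains. -/
lemma exists_norm_riemannZeta_le :
    ∃ C : ℝ, 0 < C ∧ ∀ s : ℂ, 1 - 1 / 120 < s.re → s.re ≤ 4 → 1 ≤ |s.im| →
      ‖riemannZeta s‖ ≤ C * |s.im| ^ (1 / 60 : ℝ) := by
  obtain ⟨C, hC, h⟩ := exists_norm_riemannZeta₁_le (θ := 1 / 60) (by norm_num) (by norm_num)
  refine ⟨1 + C * 5, by linarith, fun s h1 h2 h3 => ?_⟩
  have hs1 : s ≠ 1 := by rintro rfl; norm_num at h3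
  have ha : 1 ≤ ‖s - 1‖ := h3.trans (by simpa using abs_im_le_norm (s - 1))
  have hb : ‖s‖ ≤ 5 * |s.im| := by
    refine (norm_le_abs_re_add_abs_im s).trans ?_
    rw [abs_of_pos (by linarith : 0 < s.re)]; linarith
  have hp : (1 : ℝ) ≤ |s.im| ^ (1 / 60 : ℝ) := Real.one_le_rpow h3 (by norm_num)
  have hc : ‖s‖ ^ (1 / 60 : ℝ) ≤ 5 * |s.im| ^ (1 / 60 : ℝ) := by
    calc ‖s‖ ^ (1 / 60 : ℝ) ≤ (5 * |s.im|) ^ (1 / 60 : ℝ) := by gcongr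
      _ = 5 ^ (1 / 60 : ℝ) * |s.im| ^ (1 / 60 : ℝ) := Real.mul_rpow (by norm_num) (abs_nonneg _)
      _ ≤ 5 * |s.im| ^ (1 / 60 : ℝ) := by
          gcongr
          exact (Real.rpow_le_rpow_of_exponent_le (by norm_num) (by norm_num : (1 / 60 : ℝ) ≤ 1)).trans
            (by norm_num)
  rw [riemannZeta_eq_inv_sub_mul hs1, norm_mul, norm_inv]
  rw [inv_mul_le_iff₀ (by linarith)]
  calc ‖riemannZeta₁ s‖ ≤ 1 + C * ‖s - 1‖ * ‖s‖ ^ (1 / 60 : ℝ) := h s (by norm_num at h1 ⊢; linarith)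
    _ ≤ ‖s - 1‖ * |s.im| ^ (1 / 60 : ℝ) + C * ‖s - 1‖ * (5 * |s.im| ^ (1 / 60 : ℝ)) := by
        gcongr; nlinarith
    _ = _ := by ring

/-- Cauchy's estimate on a circle of radius 1/480, which stays inside the half-plane of the
preceding bound. -/
lemma exists_norm_deriv_riemannZeta_le :
    ∃ C : ℝ, 0 < C ∧ ∀ s : ℂ, 1 - 1 / 240 ≤ s.re → s.re ≤ 3 → 2 ≤ |s.im| →
      ‖deriv riemannZeta s‖ ≤ C * |s.im| ^ (1 / 60 : ℝ) := by
  obtain ⟨C, hC, h⟩ := exists_norm_riemannZeta_le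
  refine ⟨C * 2 * 480, by positivity, fun s h1 h2 h3 => ?_⟩
  have hz : ∀ z ∈ Metric.closedBall s (1 / 480), |z.re - s.re| ≤ 1 / 480 ∧ |z.im - s.im| ≤ 1 / 480 := by
    intro z hz
    rw [Metric.mem_closedBall, dist_eq_norm] at hz
    exact ⟨(by simpa using abs_re_le_norm (z - s) : |z.re - s.re| ≤ ‖z - s‖).trans hz,
      (by simpa using abs_im_le_norm (z - s) : |z.im - s.im| ≤ ‖z - s‖).trans hz⟩
  have him : ∀ z ∈ Metric.closedBall s (1 / 480), 1 ≤ |z.im| ∧ |z.im| ≤ 2 * |s.im| := by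
    intro z hzz
    have := (hz z hzz).2
    have h4 := abs_sub_abs_le_abs_sub s.im z.im
    have h5 := abs_sub_abs_le_abs_sub z.im s.im
    rw [abs_sub_comm] at h4
    constructor <;> linarith
  have := norm_deriv_le_of_forall_mem_sphere_norm_le (f := riemannZeta) (c := s) (R := 1 / 480)
    (C := C * (2 * |s.im| ^ (1 / 60 : ℝ))) (by norm_num) ?_ ?_
  · refine this.trans (le_of_eq ?_); ring
  · refine DifferentiableOn.diffContOnCl fun z hzz => ?_
    rw [closure_ball _ (by norm_num)] at hzz
    refine (differentiableAt_riemannZeta ?_).differentiableWithinAt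
    rintro rfl
    have := (him 1 hzz).1; norm_num at this
  · intro z hzz
    have hzc := Metric.sphere_subset_closedBall hzz
    have h4 := abs_le.mp (hz z hzc).1
    refine (h z (by linarith) (by linarith) (him z hzc).1).trans ?_
    gcongr
    calc |z.im| ^ (1 / 60 : ℝ) ≤ (2 * |s.im|) ^ (1 / 60 : ℝ) := by gcongr; exact (him z hzc).2
      _ = 2 ^ (1 / 60 : ℝ) * |s.im| ^ (1 / 60 : ℝ) := Real.mul_rpow (by norm_num) (abs_nonneg _)
      _ ≤ 2 * |s.im| ^ (1 / 60 : ℝ) := by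
          gcongr
          exact (Real.rpow_le_rpow_of_exponent_le (by norm_num) (by norm_num : (1 / 60 : ℝ) ≤ 1)).trans
            (by norm_num)

lemma riemannZeta_product_ge_one {x : ℝ} (hx : 0 < x) (t : ℝ) :
    1 ≤ ‖riemannZeta (1 + x)‖ ^ 3 * ‖riemannZeta (1 + x + I * t)‖ ^ 4 *
      ‖riemannZeta (1 + x + 2 * I * t)‖ := by
  have := DirichletCharacter.norm_LFunction_product_ge_one (N := 1) 1 hx t
  simpa [DirichletCharacter.LFunctionTrivChar, DirichletCharacter.LFunction_modOne_eq] using this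

lemma exists_norm_riemannZeta_real_le :
    ∃ C : ℝ, 0 < C ∧ ∀ x : ℝ, 0 < x → x ≤ 2 → ‖riemannZeta (1 + x)‖ ≤ C / x := by
  obtain ⟨C, hC⟩ := (isCompact_closedBall (1 : ℂ) 2).exists_bound_of_continuousOn
    differentiable_riemannZeta₁.continuous.continuousOn
  refine ⟨max C 1, by positivity, fun x h0 h1 => ?_⟩
  have hne : (1 + x : ℂ) ≠ 1 := by simpa using h0.ne'
  rw [riemannZeta_eq_inv_sub_mul hne, norm_mul, norm_inv, div_eq_inv_mul]
  have : ‖(1 + x : ℂ) - 1‖ = x := by simp [abs_of_pos h0]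
  rw [this]
  gcongr
  refine (hC _ ?_).trans (le_max_left _ _)
  simp [abs_of_pos h0, h1]

/-- The 3-4-1 inequality solved for its middle factor: the pole contributes x^{-3}, the value at
height 2t contributes |t|^{1/60}, and fourth roots are taken. -/
lemma exists_le_norm_riemannZeta_of_one_lt :
    ∃ c : ℝ, 0 < c ∧ ∀ x t : ℝ, 0 < x → x ≤ 2 → 2 ≤ |t| →
      c * x ^ (3 / 4 : ℝ) * |t| ^ (-(1 / 240) : ℝ) ≤ ‖riemannZeta (1 + x + I * t)‖ := by
  obtain ⟨C₁, hC₁, h₁⟩ := exists_norm_riemannZeta_real_le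
  obtain ⟨C₂, hC₂, h₂⟩ := exists_norm_riemannZeta_le
  refine ⟨(C₁ ^ 3 * (C₂ * 2)) ^ (-(1 / 4) : ℝ), by positivity, fun x t h0 h1 ht => ?_⟩
  set Z := ‖riemannZeta (1 + x + I * t)‖ with hZ
  have ht0 : 0 < |t| := by linarith
  have hprod := riemannZeta_product_ge_one h0 t
  have ha := h₁ x h0 h1
  have hb := h₂ (1 + x + 2 * I * t) (by simp; linarith) (by simp; linarith)
    (by simp [abs_mul]; linarith)
  have him : |(1 + x + 2 * I * t : ℂ).im| ^ (1 / 60 : ℝ) ≤ 2 * |t| ^ (1 / 60 : ℝ) := by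
    have : (1 + x + 2 * I * t : ℂ).im = 2 * t := by simp
    rw [this, abs_mul, Real.mul_rpow (by positivity) (abs_nonneg _), abs_two]
    gcongr
    exact (Real.rpow_le_rpow_of_exponent_le (by norm_num) (by norm_num : (1 / 60 : ℝ) ≤ 1)).trans
            (by norm_num)
  have hb' : ‖riemannZeta (1 + x + 2 * I * t)‖ ≤ C₂ * 2 * |t| ^ (1 / 60 : ℝ) := by
    exact hb.trans ((mul_le_mul_of_nonneg_left him hC₂.le).trans_eq (by ring))
  have hZ0 : 0 ≤ Z := norm_nonneg _
  have key : 1 ≤ (C₁ / x) ^ 3 * Z ^ 4 * (C₂ * 2 * |t| ^ (1 / 60 : ℝ)) :=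
    hprod.trans (by gcongr)
  have key2 : (C₁ ^ 3 * (C₂ * 2))⁻¹ * x ^ 3 * |t| ^ (-(1 / 60) : ℝ) ≤ Z ^ 4 := by
    rw [Real.rpow_neg ht0.le]
    have hp : 0 < |t| ^ (1 / 60 : ℝ) := by positivity
    have e : (C₁ / x) ^ 3 * Z ^ 4 * (C₂ * 2 * |t| ^ (1 / 60 : ℝ)) =
      Z ^ 4 * (C₁ ^ 3 * (C₂ * 2) * |t| ^ (1 / 60 : ℝ) / x ^ 3) := by field_simp
    rw [e] at key
    have e2 : (C₁ ^ 3 * (C₂ * 2))⁻¹ * x ^ 3 * (|t| ^ (1 / 60 : ℝ))⁻¹ =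
      1 / (C₁ ^ 3 * (C₂ * 2) * |t| ^ (1 / 60 : ℝ) / x ^ 3) := by field_simp
    rw [e2, div_le_iff₀ (by positivity)]
    exact key
  have e3 : ((C₁ ^ 3 * (C₂ * 2)) ^ (-(1 / 4) : ℝ) * x ^ (3 / 4 : ℝ) * |t| ^ (-(1 / 240) : ℝ)) ^ 4 =
      (C₁ ^ 3 * (C₂ * 2))⁻¹ * x ^ 3 * |t| ^ (-(1 / 60) : ℝ) := by
    rw [mul_pow, mul_pow, ← Real.rpow_mul_natCast (by positivity),
      ← Real.rpow_mul_natCast (by positivity), ← Real.rpow_mul_natCast (by positivity),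
      ← Real.rpow_neg_one, ← Real.rpow_natCast x 3]
    norm_num
  rw [← e3] at key2
  exact le_of_pow_le_pow_left₀ (by norm_num) hZ0 key2

/-- With x₀ = κ|t|^{-1/12}, the 3-4-1 bound at 1 + x₀ is of order |t|^{-1/15}. Moving left by at
most 2x₀ changes ζ by O(|t|^{1/60} x₀), which is the same power of |t|; this is why the width is
|t|^{-1/12}. -/
lemma exists_le_norm_riemannZeta :
    ∃ c κ : ℝ, 0 < c ∧ 0 < κ ∧ κ ≤ 1 / 240 ∧ ∀ s : ℂ, 2 ≤ |s.im| →
      1 - κ * |s.im| ^ (-(1 / 12) : ℝ) ≤ s.re → s.re ≤ 2 →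
      c * |s.im| ^ (-(1 / 15) : ℝ) ≤ ‖riemannZeta s‖ := by
  obtain ⟨c₁, hc₁, h₁⟩ := exists_le_norm_riemannZeta_of_one_lt
  obtain ⟨C, hC, hd⟩ := exists_norm_deriv_riemannZeta_le
  -- The loss from the derivative is linear in κ and the lower bound is of order κ^{3/4}, so a small
  -- κ leaves half of the lower bound.
  obtain ⟨κ, hκ0, hκ1, hκ2⟩ : ∃ κ : ℝ, 0 < κ ∧ κ ≤ 1 / 240 ∧
      2 * C * κ ≤ c₁ * κ ^ (3 / 4 : ℝ) / 2 := by
    refine ⟨min (1 / 240) ((c₁ / (4 * C)) ^ 4), by positivity, min_le_left _ _, ?_⟩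
    set κ := min (1 / 240) ((c₁ / (4 * C)) ^ 4)
    have hκ : 0 < κ := by positivity
    have h4 : κ ^ (1 / 4 : ℝ) ≤ c₁ / (4 * C) := by
      calc κ ^ (1 / 4 : ℝ) ≤ ((c₁ / (4 * C)) ^ 4) ^ (1 / 4 : ℝ) := by
            gcongr; exact min_le_right _ _
        _ = c₁ / (4 * C) := by
            rw [← Real.rpow_natCast, ← Real.rpow_mul (by positivity)]; norm_num
    have h5 : κ = κ ^ (3 / 4 : ℝ) * κ ^ (1 / 4 : ℝ) := by
      rw [← Real.rpow_add hκ]; norm_num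
    have h6 : 0 < κ ^ (3 / 4 : ℝ) := by positivity
    calc 2 * C * κ = 2 * C * (κ ^ (3 / 4 : ℝ) * κ ^ (1 / 4 : ℝ)) := by rw [← h5]
      _ ≤ 2 * C * (κ ^ (3 / 4 : ℝ) * (c₁ / (4 * C))) := by gcongr
      _ = _ := by field_simp; ring
  have hc0 : 0 < c₁ * κ ^ (3 / 4 : ℝ) := by positivity
  refine ⟨c₁ * κ ^ (3 / 4 : ℝ) / 2, κ, by positivity, hκ0, hκ1, fun s ht hre hre2 => ?_⟩
  have ht0 : 0 < |s.im| := by linarith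
  have hbase : ∀ x : ℝ, κ * |s.im| ^ (-(1 / 12) : ℝ) ≤ x → x ≤ 2 →
      c₁ * κ ^ (3 / 4 : ℝ) * |s.im| ^ (-(1 / 15) : ℝ) ≤ ‖riemannZeta (1 + x + I * s.im)‖ := by
    intro x hx hx2
    have hx0 : 0 < κ * |s.im| ^ (-(1 / 12) : ℝ) := by positivity
    refine le_trans ?_ (h₁ x s.im (hx0.trans_le hx) hx2 ht)
    calc c₁ * κ ^ (3 / 4 : ℝ) * |s.im| ^ (-(1 / 15) : ℝ)
        = c₁ * (κ * |s.im| ^ (-(1 / 12) : ℝ)) ^ (3 / 4 : ℝ) * |s.im| ^ (-(1 / 240) : ℝ) := by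
          rw [Real.mul_rpow hκ0.le (by positivity), ← Real.rpow_mul ht0.le, ← mul_assoc,
            mul_assoc _ (|s.im| ^ _), ← Real.rpow_add ht0]
          norm_num
      _ ≤ _ := by gcongr
  set x₀ := κ * |s.im| ^ (-(1 / 12) : ℝ) with hx₀
  have hx00 : 0 < x₀ := by positivity
  have hx01 : x₀ ≤ 1 / 240 := by
    have : |s.im| ^ (-(1 / 12) : ℝ) ≤ 1 :=
      Real.rpow_le_one_of_one_le_of_nonpos (by linarith) (by norm_num)
    calc x₀ ≤ κ * 1 := by rw [hx₀]; gcongr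
      _ ≤ 1 / 240 := by linarith
  have hpos : 0 < |s.im| ^ (-(1 / 15) : ℝ) := by positivity
  by_cases hcase : 1 + x₀ ≤ s.re
  · have hb := hbase (s.re - 1) (by linarith) (by linarith)
    have e : (1 + ((s.re - 1 : ℝ) : ℂ) + I * s.im) = s := by
      apply Complex.ext <;> simp
    rw [e] at hb
    refine le_trans ?_ hb
    nlinarith
  · push Not at hcase
    have hb := hbase x₀ le_rfl (by linarith)
    set w : ℂ := 1 + x₀ + I * s.im with hw
    have hconv : Convex ℝ {z : ℂ | z.im = s.im ∧ 1 - x₀ ≤ z.re ∧ z.re ≤ 1 + x₀} := by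
      intro a ha b hb' p q hp hq hpq
      have hp' : p = 1 - q := by linarith
      refine ⟨?_, ?_, ?_⟩
      · simp [ha.1, hb'.1, hp']; ring
      · simp only [add_re, smul_re, smul_eq_mul]; nlinarith [ha.2.1, hb'.2.1]
      · simp only [add_re, smul_re, smul_eq_mul]; nlinarith [ha.2.2, hb'.2.2]
    have hdiff := hconv.norm_image_sub_le_of_norm_deriv_le (f := riemannZeta)
      (C := C * |s.im| ^ (1 / 60 : ℝ)) (x := s) (y := w) (𝕜 := ℂ)
      (fun z hz => differentiableAt_riemannZeta (by
        rintro rfl; have := hz.1; simp at this; rw [← this] at ht; norm_num at ht))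
      (fun z hz => by
        have := hd z (by linarith [hz.2.1]) (by linarith [hz.2.2]) (by rw [hz.1]; exact ht)
        rwa [hz.1] at this)
      ⟨rfl, hre, hcase.le⟩ ⟨by simp [hw], by simp [hw]; linarith, by simp [hw]⟩
    have hws : ‖w - s‖ ≤ 2 * x₀ := by
      have : w - s = ((1 + x₀ - s.re : ℝ) : ℂ) := by
        apply Complex.ext <;> simp [hw]
      rw [this, norm_real, Real.norm_eq_abs, abs_of_nonneg (by linarith)]
      linarith
    have hd2 : ‖riemannZeta w - riemannZeta s‖ ≤
        c₁ * κ ^ (3 / 4 : ℝ) / 2 * |s.im| ^ (-(1 / 15) : ℝ) := by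
      calc ‖riemannZeta w - riemannZeta s‖
          ≤ C * |s.im| ^ (1 / 60 : ℝ) * (2 * x₀) := hdiff.trans (by gcongr)
        _ = 2 * C * κ * (|s.im| ^ (1 / 60 : ℝ) * |s.im| ^ (-(1 / 12) : ℝ)) := by rw [hx₀]; ring
        _ = 2 * C * κ * |s.im| ^ (-(1 / 15) : ℝ) := by rw [← Real.rpow_add ht0]; norm_num
        _ ≤ _ := by gcongr
    have := norm_sub_norm_le (riemannZeta w) (riemannZeta s)
    linarith

end ZetaLower

/-! ### The Mellin transform of the error term of ψ on and near Re s = 1. -/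

section PsiTransform

open Complex Filter Topology

/-- The function `-ζ'(s) / (s ζ(s)) - 1 / (s - 1)`, written so that it is regular at `s = 1`. -/
noncomputable def psiTransform (s : ℂ) : ℂ :=
  -(1 + deriv riemannZeta₁ s / riemannZeta₁ s) / s

lemma riemannZeta₁_ne_zero {s : ℂ} (h : riemannZeta s ≠ 0) : riemannZeta₁ s ≠ 0 := by
  by_cases hs : s = 1
  · simp [hs]
  · intro h0
    rw [riemannZeta_eq_inv_sub_mul hs, h0] at h
    simp at h

lemma psiTransform_eq {s : ℂ} (hs0 : s ≠ 0) (hs : s ≠ 1) (h : riemannZeta s ≠ 0) :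
    psiTransform s = -(deriv riemannZeta s / riemannZeta s) / s - 1 / (s - 1) := by
  have h1 := riemannZeta₁_ne_zero h
  have h2 := sub_ne_zero.mpr hs
  rw [psiTransform, deriv_riemannZeta_eq_neg_inv_sub_sq_mul_add hs, riemannZeta_eq_inv_sub_mul hs]
  field_simp
  ring

lemma differentiableAt_psiTransform {s : ℂ} (hs0 : s ≠ 0) (h : riemannZeta s ≠ 0) :
    DifferentiableAt ℂ psiTransform s := by
  have h1 := riemannZeta₁_ne_zero h
  have h2 : DifferentiableAt ℂ (deriv riemannZeta₁) s := differentiable_riemannZeta₁.deriv s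
  exact (((h2.div (differentiable_riemannZeta₁ s) h1).const_add 1).neg).div differentiableAt_id hs0

lemma analyticAt_psiTransform {s : ℂ} (hs : 1 ≤ s.re) : AnalyticAt ℂ psiTransform s := by
  have hs0 : s ≠ 0 := by rintro rfl; norm_num at hs
  have h1 := riemannZeta₁_ne_zero (riemannZeta_ne_zero_of_one_le_re hs)
  have ha : AnalyticAt ℂ riemannZeta₁ s := differentiable_riemannZeta₁.analyticAt s
  exact ((analyticAt_const.add (ha.deriv.div ha h1)).neg).div analyticAt_id hs0

/-- Upper bound for ζ' over lower bound for ζ costs |t|^{1/60 + 1/15} = |t|^{1/12}; the division by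
s then leaves |t|^{-11/12}. -/
lemma exists_norm_psiTransform_le :
    ∃ C κ : ℝ, 0 < C ∧ 0 < κ ∧ κ ≤ 1 / 240 ∧ ∀ s : ℂ, 2 ≤ |s.im| →
      1 - κ * |s.im| ^ (-(1 / 12) : ℝ) ≤ s.re → s.re ≤ 2 →
      riemannZeta s ≠ 0 ∧ ‖psiTransform s‖ ≤ C * |s.im| ^ (-(11 / 12) : ℝ) := by
  obtain ⟨c, κ, hc, hκ0, hκ1, hl⟩ := exists_le_norm_riemannZeta
  obtain ⟨C, hC, hd⟩ := exists_norm_deriv_riemannZeta_le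
  refine ⟨C / c + 1, κ, by positivity, hκ0, hκ1, fun s ht hre hre2 => ?_⟩
  have ht0 : 0 < |s.im| := by linarith
  have hlow := hl s ht hre hre2
  have hlow0 : 0 < c * |s.im| ^ (-(1 / 15) : ℝ) := by positivity
  have hz : riemannZeta s ≠ 0 := norm_pos_iff.mp (hlow0.trans_le hlow)
  have hs0 : s ≠ 0 := by rintro rfl; norm_num at ht
  have hs1 : s ≠ 1 := by rintro rfl; norm_num at ht
  refine ⟨hz, ?_⟩
  have hx1 : |s.im| ^ (-(1 / 12) : ℝ) ≤ 1 :=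
    Real.rpow_le_one_of_one_le_of_nonpos (by linarith) (by norm_num)
  have hre' : 1 - 1 / 240 ≤ s.re := by nlinarith
  have hup := hd s hre' (by linarith) ht
  rw [psiTransform_eq hs0 hs1 hz]
  have hsn : |s.im| ≤ ‖s‖ := abs_im_le_norm s
  have hsn1 : |s.im| ≤ ‖s - 1‖ := by simpa using abs_im_le_norm (s - 1)
  calc ‖-(deriv riemannZeta s / riemannZeta s) / s - 1 / (s - 1)‖
      ≤ ‖deriv riemannZeta s‖ / ‖riemannZeta s‖ / ‖s‖ + 1 / ‖s - 1‖ := by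
        refine (norm_sub_le _ _).trans (le_of_eq ?_)
        simp
    _ ≤ C * |s.im| ^ (1 / 60 : ℝ) / (c * |s.im| ^ (-(1 / 15) : ℝ)) / |s.im| + 1 / |s.im| := by
        gcongr
    _ = C / c * |s.im| ^ (-(11 / 12) : ℝ) + |s.im| ^ (-1 : ℝ) := by
        rw [Real.rpow_neg_one, ← one_div |s.im|]
        congr 1
        have e : |s.im| ^ (-(11 / 12) : ℝ) =
            |s.im| ^ (1 / 60 : ℝ) / |s.im| ^ (-(1 / 15) : ℝ) / |s.im| := by
          rw [← Real.rpow_sub ht0]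
          nth_rw 3 [← Real.rpow_one |s.im|]
          rw [← Real.rpow_sub ht0]; norm_num
        rw [e]; field_simp
    _ ≤ C / c * |s.im| ^ (-(11 / 12) : ℝ) + 1 * |s.im| ^ (-(11 / 12) : ℝ) := by
        rw [one_mul]
        gcongr
        · linarith
        · norm_num
    _ = _ := by ring

/-- Cauchy's estimate with radius half the width κ|t|^{-1/12} of the region. Two derivatives cost
|t|^{1/6}, and the exponent -3/4 that remains is below -1/2, hence square integrable. -/
lemma exists_norm_iteratedDeriv_psiTransform_le_of_im :
    ∃ B : ℝ, 0 < B ∧ ∀ s : ℂ, 1 ≤ s.re → s.re ≤ 3 / 2 → 3 ≤ |s.im| →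
      ‖iteratedDeriv 2 psiTransform s‖ ≤ B * |s.im| ^ (-(3 / 4) : ℝ) := by
  obtain ⟨C, κ, hC, hκ0, hκ1, h⟩ := exists_norm_psiTransform_le
  refine ⟨16 * C / κ ^ 2, by positivity, fun s h1 h2 h3 => ?_⟩
  have ht0 : 0 < |s.im| := by linarith
  have hx1 : |s.im| ^ (-(1 / 12) : ℝ) ≤ 1 :=
    Real.rpow_le_one_of_one_le_of_nonpos (by linarith) (by norm_num)
  have hx0 : 0 < |s.im| ^ (-(1 / 12) : ℝ) := by positivity
  set r := κ * |s.im| ^ (-(1 / 12) : ℝ) / 2 with hr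
  have hr0 : 0 < r := by positivity
  have hr1 : r ≤ 1 / 480 := by rw [hr]; nlinarith
  have hmem : ∀ z ∈ Metric.closedBall s r, riemannZeta z ≠ 0 ∧ z ≠ 0 ∧
      ‖psiTransform z‖ ≤ 2 * C * |s.im| ^ (-(11 / 12) : ℝ) := by
    intro z hz
    rw [Metric.mem_closedBall, dist_eq_norm] at hz
    have hzre := abs_le.mp ((by simpa using abs_re_le_norm (z - s) : |z.re - s.re| ≤ ‖z - s‖).trans hz)
    have hzim := ((by simpa using abs_im_le_norm (z - s) : |z.im - s.im| ≤ ‖z - s‖).trans hz)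
    have h4 := abs_sub_abs_le_abs_sub s.im z.im
    have h5 := abs_sub_abs_le_abs_sub z.im s.im
    rw [abs_sub_comm] at h4
    have hz2 : 2 ≤ |z.im| := by linarith
    have hzu : |z.im| ≤ 2 * |s.im| := by linarith
    have hzl : |s.im| / 2 ≤ |z.im| := by linarith
    have hp : |s.im| ^ (-(1 / 12) : ℝ) / 2 ≤ |z.im| ^ (-(1 / 12) : ℝ) := by
      calc |s.im| ^ (-(1 / 12) : ℝ) / 2 = 2 ^ (-1 : ℝ) * |s.im| ^ (-(1 / 12) : ℝ) := by
            rw [Real.rpow_neg_one]; ring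
        _ ≤ 2 ^ (-(1 / 12) : ℝ) * |s.im| ^ (-(1 / 12) : ℝ) := by
            gcongr <;> norm_num
        _ = (2 * |s.im|) ^ (-(1 / 12) : ℝ) := by
            rw [Real.mul_rpow (by norm_num) ht0.le]
        _ ≤ _ := Real.rpow_le_rpow_of_nonpos (by linarith) hzu (by norm_num)
    obtain ⟨hne, hb⟩ := h z hz2 (by
      have : κ * (|s.im| ^ (-(1 / 12) : ℝ) / 2) ≤ κ * |z.im| ^ (-(1 / 12) : ℝ) := by gcongr
      rw [hr] at hzre
      linarith [hzre.1]) (by linarith)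
    refine ⟨hne, by rintro rfl; norm_num at hz2, hb.trans ?_⟩
    rw [mul_comm 2 C, mul_assoc]
    gcongr
    calc |z.im| ^ (-(11 / 12) : ℝ) ≤ (|s.im| / 2) ^ (-(11 / 12) : ℝ) :=
          Real.rpow_le_rpow_of_nonpos (by linarith) hzl (by norm_num)
      _ = 2 ^ (11 / 12 : ℝ) * |s.im| ^ (-(11 / 12) : ℝ) := by
          rw [Real.div_rpow ht0.le (by norm_num), Real.rpow_neg (by norm_num : (0 : ℝ) ≤ 2)]
          field_simp
      _ ≤ 2 * |s.im| ^ (-(11 / 12) : ℝ) := by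
          gcongr
          exact (Real.rpow_le_rpow_of_exponent_le (by norm_num) (by norm_num : (11 / 12 : ℝ) ≤ 1)).trans
            (by norm_num)
  have key := norm_iteratedDeriv_le_of_forall_mem_sphere_norm_le (f := psiTransform) (c := s) 2 hr0
    (C := 2 * C * |s.im| ^ (-(11 / 12) : ℝ)) ?_ ?_
  · refine key.trans (le_of_eq ?_)
    have e : |s.im| ^ (-(3 / 4) : ℝ) =
        |s.im| ^ (-(11 / 12) : ℝ) / (|s.im| ^ (-(1 / 12) : ℝ)) ^ 2 := by
      rw [← Real.rpow_mul_natCast ht0.le, ← Real.rpow_sub ht0]; norm_num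
    rw [e, hr]
    simp [Nat.factorial]
    field_simp
    norm_num
  · refine DifferentiableOn.diffContOnCl fun z hz => ?_
    rw [closure_ball _ hr0.ne'] at hz
    exact (differentiableAt_psiTransform (hmem z hz).2.1 (hmem z hz).1).differentiableWithinAt
  · exact fun z hz => (hmem z (Metric.sphere_subset_closedBall hz)).2.2

lemma exists_norm_iteratedDeriv_psiTransform_le :
    ∃ B : ℝ, 0 < B ∧ ∀ s : ℂ, 1 ≤ s.re → s.re ≤ 3 / 2 →
      ‖iteratedDeriv 2 psiTransform s‖ ≤ B * (1 + s.im ^ 2) ^ (-(3 / 8) : ℝ) := by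
  obtain ⟨B₁, hB₁, h₁⟩ := exists_norm_iteratedDeriv_psiTransform_le_of_im
  obtain ⟨B₂, hB₂⟩ := ((isCompact_Icc (a := (1 : ℝ)) (b := 3 / 2)).reProdIm
    (isCompact_Icc (a := (-3 : ℝ)) (b := 3))).exists_bound_of_continuousOn
    (f := iteratedDeriv 2 psiTransform) (fun z hz => by
      have hz1 : 1 ≤ z.re := hz.1.1
      rw [iteratedDeriv_succ, iteratedDeriv_one]
      exact (analyticAt_psiTransform hz1).deriv.deriv.continuousAt.continuousWithinAt)
  refine ⟨2 * B₁ + 10 * |B₂|, by positivity, fun s hs1 hs2 => ?_⟩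
  have hpos : 0 < (1 + s.im ^ 2) ^ (-(3 / 8) : ℝ) := by positivity
  by_cases h3 : 3 ≤ |s.im|
  · refine (h₁ s hs1 hs2 h3).trans ?_
    have hsq : s.im ^ 2 = |s.im| ^ (2 : ℝ) := by
      rw [show (2 : ℝ) = (2 : ℕ) by norm_num, Real.rpow_natCast, sq_abs]
    have : |s.im| ^ (-(3 / 4) : ℝ) ≤ 2 * (1 + s.im ^ 2) ^ (-(3 / 8) : ℝ) := by
      have h9 : 1 ≤ s.im ^ 2 := by
        rw [← sq_abs]; nlinarith
      calc |s.im| ^ (-(3 / 4) : ℝ) = (s.im ^ 2) ^ (-(3 / 8) : ℝ) := by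
            rw [hsq, ← Real.rpow_mul (abs_nonneg _)]; norm_num
        _ ≤ ((1 + s.im ^ 2) / 2) ^ (-(3 / 8) : ℝ) :=
            Real.rpow_le_rpow_of_nonpos (by positivity) (by linarith) (by norm_num)
        _ = 2 ^ (3 / 8 : ℝ) * (1 + s.im ^ 2) ^ (-(3 / 8) : ℝ) := by
            rw [Real.div_rpow (by positivity) (by norm_num),
              Real.rpow_neg (by norm_num : (0 : ℝ) ≤ 2)]
            field_simp
        _ ≤ _ := by
            gcongr
            exact (Real.rpow_le_rpow_of_exponent_le (by norm_num)
              (by norm_num : (3 / 8 : ℝ) ≤ 1)).trans (by norm_num)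
    have h0 : 0 ≤ 10 * |B₂| * (1 + s.im ^ 2) ^ (-(3 / 8) : ℝ) := by positivity
    calc B₁ * |s.im| ^ (-(3 / 4) : ℝ) ≤ B₁ * (2 * (1 + s.im ^ 2) ^ (-(3 / 8) : ℝ)) := by gcongr
      _ ≤ _ := by linarith
  · push Not at h3
    have h3' := abs_le.mp h3.le
    refine (hB₂ s ⟨⟨hs1, hs2⟩, ⟨h3'.1, h3'.2⟩⟩).trans ?_
    have : 1 / 10 ≤ (1 + s.im ^ 2) ^ (-(3 / 8) : ℝ) := by
      have h10 : 1 + s.im ^ 2 ≤ 10 := by nlinarith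
      calc (1 / 10 : ℝ) = 10 ^ (-1 : ℝ) := by rw [Real.rpow_neg_one]; norm_num
        _ ≤ 10 ^ (-(3 / 8) : ℝ) := Real.rpow_le_rpow_of_exponent_le (by norm_num) (by norm_num)
        _ ≤ _ := Real.rpow_le_rpow_of_nonpos (by positivity) h10 (by norm_num)
    have h0 : 0 ≤ 2 * B₁ * (1 + s.im ^ 2) ^ (-(3 / 8) : ℝ) := by positivity
    have : |B₂| ≤ 10 * |B₂| * (1 + s.im ^ 2) ^ (-(3 / 8) : ℝ) := by
      nlinarith [abs_nonneg B₂]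
    linarith [le_abs_self B₂]

end PsiTransform

/-! ### Plancherel against Schwartz functions, and the Fourier transform of the damped error. -/

section PrimeNumberTheorem

open Complex Filter Topology MeasureTheory FourierTransform SchwartzMap

/-- Cauchy-Schwarz and Plancherel: a function whose Fourier transform is square integrable can be
tested against Schwartz functions in `L²` norm. -/
lemma norm_integral_mul_schwartz_le {f : ℝ → ℂ} (hf : Integrable f) {g : ℝ → ℝ}
    (hfg : ∀ ξ, ‖𝓕 f ξ‖ ≤ g ξ) (hg : MemLp g 2) (φ : 𝓢(ℝ, ℂ)) :
    ‖∫ u, f u * φ u‖ ^ 2 ≤ (∫ ξ, g ξ ^ 2) * ∫ u, ‖φ u‖ ^ 2 := by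
  set χ : 𝓢(ℝ, ℂ) := 𝓕⁻ φ with hχ
  have hχφ : 𝓕 χ = φ := by simp [hχ]
  have hχφ' : 𝓕 (χ : ℝ → ℂ) = φ := by rw [← fourier_coe, hχφ]
  -- The multiplication formula ∫ f · 𝓕χ = ∫ 𝓕f · χ, applied with φ = 𝓕χ.
  have h1 : ∫ u, f u * φ u = ∫ ξ, 𝓕 f ξ * χ ξ := by
    have := VectorFourier.integral_fourierIntegral_smul_eq_flip (L := innerₗ ℝ)
      (f := f) (g := (χ : ℝ → ℂ)) (μ := volume) (ν := volume)
      Real.continuous_fourierChar continuous_inner hf χ.integrable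
    simp only [smul_eq_mul] at this
    rw [flip_innerₗ] at this
    rw [← hχφ']
    exact this.symm
  have hg0 : ∀ ξ, 0 ≤ g ξ := fun ξ => (norm_nonneg _).trans (hfg ξ)
  have hχ2 : MemLp (χ : ℝ → ℂ) 2 := χ.memLp 2
  have h2 : ‖∫ u, f u * φ u‖ ≤ ∫ ξ, ‖g ξ‖ * ‖χ ξ‖ := by
    rw [h1]
    refine norm_integral_le_of_norm_le (hg.norm.integrable_mul hχ2.norm) ?_
    refine Eventually.of_forall fun ξ => ?_
    rw [norm_mul, Real.norm_of_nonneg (hg0 ξ)]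
    gcongr
    exact hfg ξ
  have h3 : ∫ ξ, ‖g ξ‖ * ‖χ ξ‖ ≤ (∫ ξ, ‖g ξ‖ ^ (2 : ℝ)) ^ (1 / 2 : ℝ) *
      (∫ ξ, ‖χ ξ‖ ^ (2 : ℝ)) ^ (1 / 2 : ℝ) := by
    have hh := integral_mul_norm_le_Lp_mul_Lq (μ := volume) (f := g) (g := fun ξ => ‖χ ξ‖)
      (p := 2) (q := 2) (by constructor <;> norm_num) (by simpa using hg) (by simpa using hχ2.norm)
    simpa using hh
  have h4 : ∫ ξ, ‖χ ξ‖ ^ 2 = ∫ u, ‖φ u‖ ^ 2 := by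
    rw [← integral_norm_sq_fourier χ, hχφ]
  have h5 := h2.trans h3
  have e1 : (∫ ξ, ‖g ξ‖ ^ (2 : ℝ)) = ∫ ξ, g ξ ^ 2 := by simp
  have e2 : (∫ ξ, ‖χ ξ‖ ^ (2 : ℝ)) = ∫ u, ‖φ u‖ ^ 2 := by rw [← h4]; simp
  rw [e1, e2, ← Real.sqrt_eq_rpow, ← Real.sqrt_eq_rpow] at h5
  calc ‖∫ u, f u * φ u‖ ^ 2 ≤ (√(∫ ξ, g ξ ^ 2) * √(∫ u, ‖φ u‖ ^ 2)) ^ 2 := by gcongr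
    _ = _ := by
      rw [mul_pow, Real.sq_sqrt (integral_nonneg fun _ => sq_nonneg _),
        Real.sq_sqrt (integral_nonneg fun _ => sq_nonneg _)]

/-- The normalized error term `ψ(eᵘ) e⁻ᵘ - 1`. -/
noncomputable def psiError (u : ℝ) : ℝ := Chebyshev.psi (Real.exp u) * Real.exp (-u) - 1

lemma measurable_psiError : Measurable psiError :=
  ((Chebyshev.psi_mono.measurable.comp Real.measurable_exp).mul
    (Real.measurable_exp.comp measurable_neg)).sub_const 1

lemma psiError_ge (u : ℝ) : -1 ≤ psiError u := by
  have := mul_nonneg (Chebyshev.psi_nonneg (Real.exp u)) (Real.exp_nonneg (-u))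
  rw [psiError]; linarith

lemma psiError_le (u : ℝ) : psiError u ≤ 6 := by
  have h := Chebyshev.psi_le_const_mul_self (Real.exp_nonneg u)
  have h4 : Real.log 4 ≤ 3 := by
    rw [Real.log_le_iff_le_exp (by norm_num)]
    have := Real.add_one_le_exp (3 : ℝ); linarith
  have : Chebyshev.psi (Real.exp u) * Real.exp (-u) ≤ 7 := by
    rw [Real.exp_neg, mul_inv_le_iff₀ (Real.exp_pos u)]
    nlinarith [Real.exp_pos u]
  rw [psiError]; linarith

lemma abs_psiError_le (u : ℝ) : |psiError u| ≤ 6 :=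
  abs_le.mpr ⟨by linarith [psiError_ge u], psiError_le u⟩

lemma one_add_psiError_mul_exp_mono {u v : ℝ} (h : u ≤ v) :
    (1 + psiError u) * Real.exp u ≤ (1 + psiError v) * Real.exp v := by
  have e : ∀ u, (1 + psiError u) * Real.exp u = Chebyshev.psi (Real.exp u) := by
    intro u
    rw [psiError, Real.exp_neg]; field_simp; ring
  rw [e, e]
  exact Chebyshev.psi_mono (Real.exp_le_exp.mpr h)

lemma integrable_pow_mul_exp_neg (n : ℕ) {ε : ℝ} (hε : 0 < ε) :
    IntegrableOn (fun u : ℝ => u ^ n * Real.exp (-(ε * u))) (Set.Ioi 0) := by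
  have := integrableOn_rpow_mul_exp_neg_mul_rpow (p := 1) (s := n) (b := ε)
    (by have : (0 : ℝ) ≤ n := n.cast_nonneg
        linarith) (by norm_num) hε
  simpa using this

/-- The exponentially damped error term. -/
noncomputable def dampedPsiError (ε u : ℝ) : ℂ :=
  Set.indicator (Set.Ioi 0) (fun u => ((psiError u * Real.exp (-(ε * u)) : ℝ) : ℂ)) u

lemma integrable_pow_smul_dampedPsiError (n : ℕ) {ε : ℝ} (hε : 0 < ε) :
    Integrable (fun u : ℝ => u ^ n • dampedPsiError ε u) := by
  have h : Integrable (Set.indicator (Set.Ioi (0 : ℝ))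
      (fun u => 6 * (u ^ n * Real.exp (-(ε * u))))) :=
    (integrable_indicator_iff measurableSet_Ioi).mpr ((integrable_pow_mul_exp_neg n hε).const_mul 6)
  refine h.mono' ?_ ?_
  · have hm : Measurable fun u : ℝ => u ^ n := by fun_prop
    refine AEStronglyMeasurable.smul hm.aestronglyMeasurable (Measurable.aestronglyMeasurable ?_)
    refine Measurable.indicator ?_ measurableSet_Ioi
    have := measurable_psiError
    fun_prop
  · refine Eventually.of_forall fun u => ?_
    by_cases hu : u ∈ Set.Ioi (0 : ℝ)
    · have hu0 : (0 : ℝ) < u := hu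
      simp only [dampedPsiError, Set.indicator_of_mem hu, norm_smul, norm_pow, norm_real,
        Real.norm_eq_abs, abs_mul, Real.abs_exp, abs_of_pos hu0]
      have := abs_psiError_le u
      calc u ^ n * (|psiError u| * Real.exp (-(ε * u)))
          ≤ u ^ n * (6 * Real.exp (-(ε * u))) := by gcongr
        _ = _ := by ring
    · simp [dampedPsiError, Set.indicator_of_notMem hu]

lemma sum_vonMangoldt_isBigO :
    (fun n : ℕ => ∑ k ∈ Finset.Icc 1 n, ArithmeticFunction.vonMangoldt k) =O[atTop]
      fun n : ℕ => (n : ℝ) ^ (1 : ℝ) := by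
  refine Asymptotics.IsBigO.of_bound (Real.log 4 + 4) (Eventually.of_forall fun n => ?_)
  have h := Chebyshev.psi_le_const_mul_self (x := n) n.cast_nonneg
  have e : Chebyshev.psi n = ∑ k ∈ Finset.Icc 1 n, ArithmeticFunction.vonMangoldt k := by
    rw [Chebyshev.psi, Nat.floor_natCast]; rfl
  rw [← e, Real.rpow_one, Real.norm_of_nonneg (Chebyshev.psi_nonneg _),
    Real.norm_of_nonneg n.cast_nonneg]
  exact h

lemma psi_eq_sum_Icc_one (t : ℝ) :
    Chebyshev.psi t = ∑ k ∈ Finset.Icc 1 ⌊t⌋₊, ArithmeticFunction.vonMangoldt k := rfl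

lemma integrableOn_psi_mul_cpow {s : ℂ} (hs : 1 < s.re) :
    IntegrableOn (fun t : ℝ => (Chebyshev.psi t : ℂ) * (t : ℂ) ^ (-(s + 1))) (Set.Ioi 1) := by
  have h : IntegrableOn (fun t : ℝ => (Real.log 4 + 4) * t ^ (-s.re)) (Set.Ioi 1) :=
    (integrableOn_Ioi_rpow_of_lt (by linarith) one_pos).const_mul _
  refine h.mono' ?_ ?_
  · refine AEStronglyMeasurable.mul ?_ ?_
    · have := Chebyshev.psi_mono.measurable
      exact (measurable_ofReal.comp this).aestronglyMeasurable
    · refine ContinuousOn.aestronglyMeasurable (fun t ht => ?_) measurableSet_Ioi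
      exact (continuousAt_ofReal_cpow_const _ _
        (Or.inr (by simp only [Set.mem_Ioi] at ht; linarith))).continuousWithinAt
  · filter_upwards [ae_restrict_mem measurableSet_Ioi] with t ht
    have ht0 : (0 : ℝ) < t := one_pos.trans ht
    rw [norm_mul, norm_cpow_eq_rpow_re_of_pos ht0, norm_real,
      Real.norm_of_nonneg (Chebyshev.psi_nonneg _)]
    calc Chebyshev.psi t * t ^ (-(s + 1)).re ≤ (Real.log 4 + 4) * t * t ^ (-(s + 1)).re := by
          gcongr; exact Chebyshev.psi_le_const_mul_self ht0.le
      _ = (Real.log 4 + 4) * t ^ (-s.re) := by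
          rw [mul_assoc, ← Real.rpow_one_add' ht0.le]
          · congr 2; simp
          · simp; linarith

/-- Partial summation represents -ζ'/ζ as s ∫ ψ(t) t^{-s-1} dt, and ∫ t^{-s} dt = 1/(s - 1) removes
the pole. -/
lemma integral_psiError_cpow {s : ℂ} (hs : 1 < s.re) :
    ∫ t in Set.Ioi (1 : ℝ), ((Chebyshev.psi t / t - 1 : ℝ) : ℂ) * (t : ℂ) ^ (-s) =
      psiTransform s := by
  have hs0 : s ≠ 0 := by rintro rfl; norm_num at hs
  have hs1 : s ≠ 1 := by rintro rfl; norm_num at hs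
  have h1 := LSeries_eq_mul_integral_of_nonneg (fun n => ArithmeticFunction.vonMangoldt n)
    zero_le_one hs sum_vonMangoldt_isBigO (fun n => ArithmeticFunction.vonMangoldt_nonneg)
  have h2 := ArithmeticFunction.LSeries_vonMangoldt_eq_deriv_riemannZeta_div hs
  have h3 : ∫ t in Set.Ioi (1 : ℝ), (Chebyshev.psi t : ℂ) * (t : ℂ) ^ (-(s + 1)) =
      -(deriv riemannZeta s / riemannZeta s) / s := by
    rw [eq_div_iff hs0, mul_comm, neg_div'] 
    rw [← h2, h1]
    simp [psi_eq_sum_Icc_one]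
  have h4 : ∫ t in Set.Ioi (1 : ℝ), (t : ℂ) ^ (-s) = 1 / (s - 1) := by
    rw [integral_Ioi_cpow_of_lt (by simpa using hs) one_pos]
    rw [ofReal_one, one_cpow, neg_div, ← div_neg]
    congr 1; ring
  rw [psiTransform_eq hs0 hs1 (riemannZeta_ne_zero_of_one_le_re hs.le), ← h3, ← h4,
    ← integral_sub (integrableOn_psi_mul_cpow hs)
      (integrableOn_Ioi_cpow_of_lt (by simpa using hs) one_pos)]
  refine setIntegral_congr_fun measurableSet_Ioi fun t ht => ?_
  have ht0 : (t : ℂ) ≠ 0 := by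
    simp only [Set.mem_Ioi] at ht; exact_mod_cast (by linarith : t ≠ 0)
  rw [show -(s + 1) = -s - 1 by ring, cpow_sub _ _ ht0, cpow_one]
  push_cast
  field_simp

/-- Under t = e^u the Mellin transform becomes a Fourier transform, and the damping e^{-εu} places
it on the line Re s = 1 + ε, where the integral converges. -/
lemma fourier_dampedPsiError {ε : ℝ} (hε : 0 < ε) (ξ : ℝ) :
    𝓕 (dampedPsiError ε) ξ = psiTransform (1 + ε + 2 * Real.pi * ξ * I) := by
  set s : ℂ := ε + 2 * Real.pi * ξ * I with hs
  have hs1 : (1 + ε + 2 * Real.pi * ξ * I : ℂ) = s + 1 := by rw [hs]; ring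
  have hre : s.re = ε := by simp [hs]
  have him : s.im = 2 * Real.pi * ξ := by simp [hs]
  set F : ℝ → ℂ := Set.indicator (Set.Ioi 1) (fun t : ℝ => ((Chebyshev.psi t / t - 1 : ℝ) : ℂ))
  have h1 := mellin_comp_inv F s
  have h2 := mellin_eq_fourier (fun t => F t⁻¹) (s := s)
  rw [hre, him, h1] at h2
  have e1 : 2 * Real.pi * ξ / (2 * Real.pi) = ξ := by field_simp
  rw [e1] at h2
  have e2 : (fun u : ℝ => Real.exp (-ε * u) • F (Real.exp (-u))⁻¹) = dampedPsiError ε := by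
    funext u
    rw [← Real.exp_neg, neg_neg]
    by_cases hu : u ∈ Set.Ioi (0 : ℝ)
    · have : Real.exp u ∈ Set.Ioi (1 : ℝ) := Real.one_lt_exp_iff.mpr hu
      simp only [F, dampedPsiError, Set.indicator_of_mem hu, Set.indicator_of_mem this, psiError]
      rw [real_smul, ← ofReal_mul]
      congr 1
      rw [Real.exp_neg, neg_mul, div_eq_mul_inv]; ring
    · have : Real.exp u ∉ Set.Ioi (1 : ℝ) := fun h => hu (Real.one_lt_exp_iff.mp h)
      simp [F, dampedPsiError, Set.indicator_of_notMem hu, Set.indicator_of_notMem this]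
  rw [e2] at h2
  rw [← h2, hs1, ← integral_psiError_cpow (by simp [hre, hε]), mellin]
  have : ∀ t : ℝ, (t : ℂ) ^ (-s - 1) • F t = Set.indicator (Set.Ioi 1) (fun t : ℝ =>
      ((Chebyshev.psi t / t - 1 : ℝ) : ℂ) * (t : ℂ) ^ (-(s + 1))) t := by
    intro t
    by_cases ht : t ∈ Set.Ioi (1 : ℝ)
    · simp only [F, Set.indicator_of_mem ht, smul_eq_mul]
      rw [mul_comm]; congr 2; ring
    · simp [F, Set.indicator_of_notMem ht]
  simp_rw [this]
  rw [setIntegral_indicator measurableSet_Ioi]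
  congr 2
  ext t; simp

end PrimeNumberTheorem

/-! ### From Plancherel to a pointwise bound for the error of ψ. -/

section PrimeNumberTheorem

open Complex Filter Topology MeasureTheory FourierTransform SchwartzMap

lemma iteratedDeriv_two_comp_line {g : ℂ → ℂ} {a b : ℂ}
    (hg : ∀ ξ : ℝ, AnalyticAt ℂ g (a + b * ξ)) (ξ : ℝ) :
    iteratedDeriv 2 (fun ξ : ℝ => g (a + b * ξ)) ξ = b ^ 2 * iteratedDeriv 2 g (a + b * ξ) := by
  have hl : ∀ ξ : ℝ, HasDerivAt (fun ξ : ℝ => a + b * (ξ : ℂ)) b ξ := by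
    intro ξ
    have := ((hasDerivAt_id ξ).ofReal_comp.const_mul b).const_add a
    simpa using this
  have hd : ∀ (G : ℂ → ℂ), (∀ ξ : ℝ, AnalyticAt ℂ G (a + b * ξ)) →
      deriv (fun ξ : ℝ => G (a + b * ξ)) = fun ξ : ℝ => b * deriv G (a + b * ξ) := by
    intro G hG
    funext ξ
    have := (hG ξ).differentiableAt.hasDerivAt.comp_of_eq ξ (hl ξ) rfl
    rw [mul_comm]
    exact this.deriv
  rw [iteratedDeriv_succ, iteratedDeriv_one, hd g hg, iteratedDeriv_succ, iteratedDeriv_one]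
  have h2 := hd (deriv g) (fun ξ => (hg ξ).deriv)
  rw [deriv_const_mul_field', h2]
  ring

/-- Multiplication by u² is, up to a constant, two derivatives on the Fourier side, where the bound
is square integrable uniformly in ε. That K does not depend on ε lets later uses fit the damping to
the window under consideration. -/
lemma exists_norm_integral_dampedPsiError_le :
    ∃ K : ℝ, 0 < K ∧ ∀ ε : ℝ, 0 < ε → ε ≤ 1 / 2 → ∀ φ : 𝓢(ℝ, ℂ),
      ‖∫ u : ℝ, ((u ^ 2 : ℝ) : ℂ) * dampedPsiError ε u * φ u‖ ^ 2 ≤ K * ∫ u, ‖φ u‖ ^ 2 := by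
  obtain ⟨B, hB, h⟩ := exists_norm_iteratedDeriv_psiTransform_le
  set g : ℝ → ℝ := fun ξ => B * (1 + ‖ξ‖ ^ 2) ^ (-(3 / 4) / 2 : ℝ) with hg
  have hint : Integrable fun ξ : ℝ => (1 + ‖ξ‖ ^ 2) ^ (-(3 / 2) / 2 : ℝ) :=
    integrable_rpow_neg_one_add_norm_sq (by simp; norm_num)
  have hsq : ∀ ξ, g ξ ^ 2 = B ^ 2 * (1 + ‖ξ‖ ^ 2) ^ (-(3 / 2) / 2 : ℝ) := by
    intro ξ
    rw [hg, mul_pow, ← Real.rpow_mul_natCast (by positivity)]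
    norm_num
  have hcont : Continuous g := by
    rw [hg]
    refine continuous_const.mul (Continuous.rpow_const (by fun_prop) fun x => Or.inl ?_)
    positivity
  have hmem : MemLp g 2 := by
    rw [memLp_two_iff_integrable_sq hcont.aestronglyMeasurable]
    simp_rw [hsq]
    exact hint.const_mul _
  refine ⟨(∫ ξ, g ξ ^ 2) + 1, by positivity, fun ε hε hε2 φ => ?_⟩
  have hint2 : ∀ n : ℕ, (n : ℕ∞) ≤ 2 → Integrable (fun u : ℝ => u ^ n • dampedPsiError ε u) :=
    fun n _ => integrable_pow_smul_dampedPsiError n hε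
  have hF := Real.iteratedDeriv_fourier (n := 2) hint2 le_rfl
  have hpi : (2 * Real.pi : ℂ) ≠ 0 := by simp [Real.pi_ne_zero]
  have hline : 𝓕 (dampedPsiError ε) =
      fun ξ : ℝ => psiTransform ((1 + ε) + (2 * Real.pi * I) * ξ) := by
    funext ξ
    rw [fourier_dampedPsiError hε]
    congr 1; ring
  set f : ℝ → ℂ := fun u => ((u ^ 2 : ℝ) : ℂ) * dampedPsiError ε u with hf
  have hfint : Integrable f := by
    have := integrable_pow_smul_dampedPsiError 2 hε
    simpa [hf] using this
  have hf2 : (fun u : ℝ => (-2 * Real.pi * I * u) ^ 2 • dampedPsiError ε u) =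
      (2 * Real.pi * I : ℂ) ^ 2 • f := by
    funext u
    simp only [hf, Pi.smul_apply, smul_eq_mul]
    push_cast; ring
  have hFf : ∀ ξ, 𝓕 f ξ =
      iteratedDeriv 2 psiTransform ((1 + ε) + (2 * Real.pi * I) * ξ) := by
    intro ξ
    have h1 := congrFun hF ξ
    rw [hf2, hline, iteratedDeriv_two_comp_line (fun ξ => analyticAt_psiTransform (by
      simp; exact hε.le))] at h1
    have h3 : 𝓕 ((2 * Real.pi * I : ℂ) ^ 2 • f) ξ = (2 * Real.pi * I : ℂ) ^ 2 * 𝓕 f ξ := by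
      rw [Real.fourier_eq, Real.fourier_eq, ← integral_const_mul]
      congr 1; funext v
      simp only [Pi.smul_apply, smul_eq_mul, Circle.smul_def]
      ring
    rw [h3] at h1
    have hne : (2 * Real.pi * I : ℂ) ^ 2 ≠ 0 := pow_ne_zero _ (mul_ne_zero hpi I_ne_zero)
    exact (mul_left_cancel₀ hne h1).symm
  have hfg : ∀ ξ, ‖𝓕 f ξ‖ ≤ g ξ := by
    intro ξ
    rw [hFf]
    refine (h _ (by simp; exact hε.le) (by simp; linarith)).trans ?_
    rw [hg]
    have him : ((1 + ε : ℂ) + (2 * Real.pi * I) * ξ).im = 2 * Real.pi * ξ := by simp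
    rw [him]
    have h1 : (1 + ‖ξ‖ ^ 2) ≤ 1 + (2 * Real.pi * ξ) ^ 2 := by
      rw [Real.norm_eq_abs, sq_abs]
      have := Real.pi_gt_three
      have h2 : 1 ≤ (2 * Real.pi) ^ 2 := by nlinarith
      nlinarith [sq_nonneg ξ]
    have : (1 + (2 * Real.pi * ξ) ^ 2) ^ (-(3 / 8) : ℝ) ≤ (1 + ‖ξ‖ ^ 2) ^ (-(3 / 4) / 2 : ℝ) := by
      rw [show (-(3 / 4) / 2 : ℝ) = -(3 / 8) by norm_num]
      exact Real.rpow_le_rpow_of_nonpos (by positivity) h1 (by norm_num)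
    exact mul_le_mul_of_nonneg_left this hB.le
  refine (norm_integral_mul_schwartz_le hfint hfg hmem φ).trans ?_
  have : 0 ≤ ∫ u, ‖φ u‖ ^ 2 := integral_nonneg fun _ => by positivity
  nlinarith

/-- An error of constant sign and size at least m on [a, b] is tested against a bump equal to 1 on
the middle half. The integral is at least a constant times a² m (b - a), while Plancherel bounds its
square by K(b - a). -/
lemma exists_window_bound :
    ∃ K : ℝ, 0 < K ∧ ∀ a b m σ : ℝ, 0 < a → a < b → b ≤ a + 1 → 1 ≤ b → 0 ≤ m → |σ| = 1 →
      (∀ u ∈ Set.Icc a b, m ≤ σ * psiError u) → a ^ 4 * m ^ 2 * (b - a) ≤ K := by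
  obtain ⟨K, hK, h⟩ := exists_norm_integral_dampedPsiError_le
  refine ⟨36 * K, by positivity, fun a b m σ ha hab hab1 hb1 hm hσ hmu => ?_⟩
  have hw : 0 < b - a := by linarith
  let β : ContDiffBump ((a + b) / 2) := ⟨(b - a) / 4, (b - a) / 2, by linarith, by linarith⟩
  have hβin : ∀ u, u ∈ Set.Icc ((a + b) / 2 - (b - a) / 4) ((a + b) / 2 + (b - a) / 4) → β u = 1 := by
    intro u hu
    refine β.one_of_mem_closedBall ?_
    rw [Real.closedBall_eq_Icc]; exact hu
  have hβout : ∀ u, u ∉ Set.Icc a b → β u = 0 := by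
    intro u hu
    refine β.zero_of_le_dist ?_
    rw [Real.dist_eq]
    by_contra hc
    have := abs_lt.mp (not_le.mp hc)
    have hr : β.rOut = (b - a) / 2 := rfl
    rw [hr] at this
    exact hu ⟨by linarith, by linarith⟩
  have hcs : HasCompactSupport (fun u : ℝ => ((β u : ℝ) : ℂ)) := by
    refine HasCompactSupport.intro isCompact_Icc (K := Set.Icc a b) fun u hu => ?_
    simp [hβout u hu]
  have hsm : ContDiff ℝ ((⊤ : ℕ∞) : WithTop ℕ∞) (fun u : ℝ => ((β u : ℝ) : ℂ)) :=
    ofRealCLM.contDiff.comp β.contDiff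
  set φ : 𝓢(ℝ, ℂ) := hcs.toSchwartzMap hsm with hφ
  have hφu : ∀ u, φ u = ((β u : ℝ) : ℂ) := fun u => rfl
  -- The damping then costs at most the factor 3 on [a, b], and 1 ≤ b keeps ε ≤ 1/2.
  set ε := 1 / (2 * b) with hε
  have hε0 : 0 < ε := by positivity
  have hε2 : ε ≤ 1 / 2 := by
    rw [hε, div_le_div_iff₀ (by linarith) (by norm_num)]; linarith
  have key := h ε hε0 hε2 φ
  set r : ℝ → ℝ := fun u => Set.indicator (Set.Ioi 0)
    (fun u => psiError u * Real.exp (-(ε * u))) u * u ^ 2 * β u with hr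
  have e1 : ∀ u : ℝ, ((u ^ 2 : ℝ) : ℂ) * dampedPsiError ε u * φ u = ((r u : ℝ) : ℂ) := by
    intro u
    rw [hφu, hr, dampedPsiError]
    by_cases hu : u ∈ Set.Ioi (0 : ℝ)
    · simp only [Set.indicator_of_mem hu]; push_cast; ring
    · simp [Set.indicator_of_notMem hu]
  simp_rw [e1] at key
  rw [integral_complex_ofReal, norm_real, Real.norm_eq_abs, sq_abs] at key
  have hrint : Integrable r := by
    have h1 : Integrable fun u : ℝ => ((u ^ 2 : ℝ) : ℂ) * dampedPsiError ε u * φ u := by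
      refine Integrable.mul_of_top_left (by
        simpa using integrable_pow_smul_dampedPsiError 2 hε0) ?_
      exact φ.memLp ⊤
    simp_rw [e1] at h1
    simpa using h1.re
  have hrlow : ∀ u ∈ Set.Icc ((a + b) / 2 - (b - a) / 4) ((a + b) / 2 + (b - a) / 4),
      a ^ 2 * m / 3 ≤ σ * r u := by
    intro u hu
    have hu1 : u ∈ Set.Icc a b := ⟨by linarith [hu.1], by linarith [hu.2]⟩
    have hu0 : u ∈ Set.Ioi (0 : ℝ) := ha.trans_le hu1.1
    simp only [hr, Set.indicator_of_mem hu0, hβin u hu, mul_one]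
    have hexp : 1 / 3 ≤ Real.exp (-(ε * u)) := by
      have h1 : ε * u ≤ 1 / 2 := by
        rw [hε, div_mul_eq_mul_div, one_mul, div_le_iff₀ (by linarith)]; linarith [hu1.2]
      have := Real.add_one_le_exp (-(ε * u)); linarith
    have hmm := hmu u hu1
    have hau : a ^ 2 ≤ u ^ 2 := by have := hu1.1; gcongr
    calc a ^ 2 * m / 3 = m * (1 / 3) * a ^ 2 := by ring
      _ ≤ (σ * psiError u) * Real.exp (-(ε * u)) * u ^ 2 := by
          have := hm.trans hmm
          gcongr
      _ = _ := by ring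
  have hrnn : ∀ u, 0 ≤ σ * r u := by
    intro u
    by_cases hu1 : u ∈ Set.Icc a b
    · have hu0 : u ∈ Set.Ioi (0 : ℝ) := ha.trans_le hu1.1
      simp only [hr, Set.indicator_of_mem hu0]
      have h1 : 0 ≤ σ * psiError u := hm.trans (hmu u hu1)
      have h2 : 0 ≤ β u := β.nonneg
      calc 0 ≤ (σ * psiError u) * Real.exp (-(ε * u)) * u ^ 2 * β u := by positivity
        _ = _ := by ring
    · simp [hr, hβout u hu1]
  have hlow : a ^ 2 * m / 3 * ((b - a) / 2) ≤ σ * ∫ u, r u := by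
    rw [← integral_const_mul]
    calc a ^ 2 * m / 3 * ((b - a) / 2)
        = ∫ u in Set.Icc ((a + b) / 2 - (b - a) / 4) ((a + b) / 2 + (b - a) / 4), a ^ 2 * m / 3 := by
          rw [setIntegral_const, Measure.real, Real.volume_Icc, ENNReal.toReal_ofReal (by linarith),
            smul_eq_mul]
          ring
      _ ≤ ∫ u in Set.Icc ((a + b) / 2 - (b - a) / 4) ((a + b) / 2 + (b - a) / 4), σ * r u :=
          setIntegral_mono_on (by simp) (hrint.const_mul σ).integrableOn measurableSet_Icc hrlow
      _ ≤ ∫ u, σ * r u :=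
          setIntegral_le_integral (hrint.const_mul σ) (Eventually.of_forall hrnn)
  have hup : ∫ u, ‖φ u‖ ^ 2 ≤ b - a := by
    calc ∫ u, ‖φ u‖ ^ 2 ≤ ∫ u, Set.indicator (Set.Icc a b) (fun _ => (1 : ℝ)) u := by
          refine integral_mono_of_nonneg (Eventually.of_forall fun _ => by positivity) ?_ ?_
          · exact (integrable_indicator_iff measurableSet_Icc).mpr (by simp)
          · refine Eventually.of_forall fun u => ?_
            simp only [hφu, norm_real, Real.norm_eq_abs, sq_abs]
            by_cases hu : u ∈ Set.Icc a b
            · rw [Set.indicator_of_mem hu]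
              have h1 : 0 ≤ β u := β.nonneg
              have h2 : β u ≤ 1 := β.le_one
              nlinarith
            · simp [hβout u hu, Set.indicator_of_notMem hu]
      _ = b - a := by
          rw [integral_indicator measurableSet_Icc, setIntegral_const, Measure.real,
            Real.volume_Icc, ENNReal.toReal_ofReal hw.le]; simp
  have hσ2 : σ ^ 2 = 1 := by rw [← sq_abs, hσ]; norm_num
  have h1 : (a ^ 2 * m / 3 * ((b - a) / 2)) ^ 2 ≤ K * (b - a) := by
    calc (a ^ 2 * m / 3 * ((b - a) / 2)) ^ 2 ≤ (σ * ∫ u, r u) ^ 2 := by gcongr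
      _ = (∫ u, r u) ^ 2 := by rw [mul_pow, hσ2, one_mul]
      _ ≤ K * ∫ u, ‖φ u‖ ^ 2 := key
      _ ≤ K * (b - a) := by gcongr
  have h2 : (b - a) * (a ^ 4 * m ^ 2 * (b - a)) ≤ (b - a) * (36 * K) := by nlinarith
  exact le_of_mul_le_mul_left h2 hw

/-- The prime number theorem with error term `O(1 / log x)`, in logarithmic coordinates. -/
lemma exists_abs_psiError_le :
    ∃ C : ℝ, 0 < C ∧ ∀ U : ℝ, 1 ≤ U → |psiError U| ≤ C / U := by
  obtain ⟨K, hK, h⟩ := exists_window_bound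
  refine ⟨max 1 (64 * 14 * K), by positivity, fun U hU => ?_⟩
  -- The window argument gives |error| ≪ U^{-4/3}, more than the stated rate.
  suffices hsuff : U ^ 4 * |psiError U| ^ 3 ≤ 64 * 14 * K by
    set η := |psiError U|
    rw [le_div_iff₀ (by linarith)]
    by_contra hc
    push Not at hc
    have h1 : 1 < η * U := (le_max_left _ _).trans_lt hc
    have h2 : 64 * 14 * K < η * U := (le_max_right _ _).trans_lt hc
    have h3 : U ^ 4 * η ^ 3 = U * (η * U) ^ 3 := by ring
    have h4 : η * U ≤ (η * U) ^ 3 := by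
      calc η * U = η * U * 1 := by ring
        _ ≤ η * U * (η * U) ^ 2 := by
            have : 1 ≤ (η * U) ^ 2 := one_le_pow₀ h1.le
            gcongr
        _ = _ := by ring
    have h5 : (η * U) ^ 3 ≤ U * (η * U) ^ 3 := le_mul_of_one_le_left (by positivity) hU
    linarith
  set η := |psiError U| with hη
  have hη0 : 0 ≤ η := abs_nonneg _
  have hη6 : η ≤ 6 := abs_psiError_le U
  rcases hη0.eq_or_lt with h0 | h0
  · rw [← h0]; simp; positivity
  have hw1 : η / 14 ≤ 1 / 2 := by linarith
  have hfin : ∀ a : ℝ, U / 2 ≤ a → a ^ 4 * (η / 2) ^ 2 * (η / 14) ≤ K →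
      U ^ 4 * η ^ 3 ≤ 64 * 14 * K := by
    intro a ha hk
    have : (U / 2) ^ 4 * (η / 2) ^ 2 * (η / 14) ≤ K := by
      refine le_trans ?_ hk
      gcongr
    nlinarith
  rcases le_or_gt 0 (psiError U) with hpos | hneg
  · have hηe : psiError U = η := by rw [hη, abs_of_nonneg hpos]
    -- As ψ increases, a positive error persists to the right. Since η ≤ 6, (1 + η)(1 - η/14) ≥ 1 +
    -- η/2, which fixes the window length η/14.
    have := h U (U + η / 14) (η / 2) 1 (by linarith) (by linarith) (by linarith) (by linarith)
      (by linarith) (by simp) (fun u hu => by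
        have hmono := one_add_psiError_mul_exp_mono hu.1
        rw [hηe] at hmono
        have h1 : (1 + η) * Real.exp (U - u) ≤ 1 + psiError u := by
          rw [Real.exp_sub, mul_div_assoc', div_le_iff₀ (Real.exp_pos _)]; exact hmono
        have h2 : 1 - (u - U) ≤ Real.exp (U - u) := by
          have := Real.add_one_le_exp (U - u); linarith
        have h3 : u - U ≤ η / 14 := by linarith [hu.2]
        have h4 : (1 + η) * (1 - η / 14) ≤ (1 + η) * Real.exp (U - u) := by
          gcongr; linarith
        nlinarith)
    refine hfin U (by linarith) ?_
    simpa using this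
  · have hηe : psiError U = -η := by rw [hη, abs_of_neg hneg]; ring
    have hη1 : η ≤ 1 := by have := psiError_ge U; linarith
    -- A negative error persists to the left; here η ≤ 1 and (1 - η)(1 + η/7) ≤ 1 - η/2.
    have := h (U - η / 14) U (η / 2) (-1) (by linarith) (by linarith) (by linarith) hU
      (by linarith) (by simp) (fun u hu => by
        have hmono := one_add_psiError_mul_exp_mono hu.2
        rw [hηe] at hmono
        have h1 : 1 + psiError u ≤ (1 - η) * Real.exp (U - u) := by
          rw [Real.exp_sub, mul_div_assoc', le_div_iff₀ (Real.exp_pos _)]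
          linarith
        have h3 : U - u ≤ η / 14 := by linarith [hu.1]
        have h0' : 0 ≤ U - u := by linarith [hu.2]
        have h2 : Real.exp (U - u) ≤ 1 + 2 * (U - u) := by
          have := Real.abs_exp_sub_one_le (x := U - u) (by rw [abs_of_nonneg h0']; linarith)
          rw [abs_of_nonneg h0'] at this
          linarith [le_abs_self (Real.exp (U - u) - 1)]
        have h4 : (1 - η) * Real.exp (U - u) ≤ (1 - η) * (1 + 2 * (η / 14)) := by
          have : 0 ≤ 1 - η := by linarith
          gcongr; linarith
        nlinarith)
    refine hfin (U - η / 14) (by linarith) ?_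
    simpa using this

end PrimeNumberTheorem

/-! ### From ψ to the prime counting function. -/

section PrimeCounting

open Filter Topology Asymptotics

lemma abs_psi_sub_le_of_abs_psiError_le {C x : ℝ} (hx : 0 < x)
    (h : |psiError (Real.log x)| ≤ C / Real.log x) :
    |Chebyshev.psi x - x| ≤ C * (x / Real.log x) := by
  have e : Chebyshev.psi x - x = x * psiError (Real.log x) := by
    rw [psiError, Real.exp_neg, Real.exp_log hx]; field_simp
  rw [e, abs_mul, abs_of_pos hx]
  calc x * |psiError (Real.log x)| ≤ x * (C / Real.log x) := by gcongr
    _ = _ := by ring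

/-- The prime number theorem with error term `O(x / log² x)`. -/
theorem exists_abs_primeCounting_sub_le :
    ∃ C : ℝ, 0 < C ∧ ∀ x : ℝ, √2 ≤ x →
      |(Nat.primeCounting ⌊x⌋₊ : ℝ) - x / Real.log x| ≤ C * (x / Real.log x ^ 2) := by
  obtain ⟨C₁, hC₁, h₁⟩ := exists_abs_psiError_le
  obtain ⟨C₂, h₂⟩ := Chebyshev.psi_sub_theta_le_mul_sqrt
  obtain ⟨C₃, h₃⟩ := Chebyshev.primeCounting_sub_theta_div_log_isBigO.bound
  obtain ⟨X, hX⟩ := eventually_atTop.mp h₃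
  set X₀ := max X (Real.exp 1) with hX₀
  have hX₀e : Real.exp 1 ≤ X₀ := le_max_right _ _
  have hsq : 1 < √2 := by
    rw [Real.lt_sqrt (by norm_num)]; norm_num
  have hlsq : 0 < Real.log √2 := Real.log_pos hsq
  -- Absorbs the bounded range √2 ≤ x < X₀, where both terms are estimated trivially.
  set D := (X₀ + X₀ / Real.log √2) * Real.log X₀ ^ 2 with hD
  have hX₀p : 0 < X₀ := (Real.exp_pos 1).trans_le hX₀e
  have hD0 : 0 ≤ D := by positivity
  refine ⟨|C₃| + 2 * |C₂| + C₁ + D, by positivity, fun x hx => ?_⟩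
  have hx1 : 1 < x := hsq.trans_le hx
  have hx0 : 0 < x := by linarith
  have hlog : 0 < Real.log x := Real.log_pos hx1
  have hratio : 0 ≤ x / Real.log x ^ 2 := by positivity
  by_cases hxX : X₀ ≤ x
  · have hxe : 1 ≤ Real.log x := by
      rw [Real.le_log_iff_exp_le hx0]; exact hX₀e.trans hxX
    have a₁ : |Chebyshev.psi x - x| ≤ C₁ * (x / Real.log x) :=
      abs_psi_sub_le_of_abs_psiError_le hx0 (h₁ _ hxe)
    have a₂ : |Chebyshev.theta x - Chebyshev.psi x| ≤ 2 * |C₂| * (x / Real.log x) := by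
      have h := h₂ x
      have h' := Chebyshev.theta_le_psi x
      have hs : √x ≤ 2 * (x / Real.log x) := by
        have hl := Real.log_le_rpow_div hx0.le (show (0 : ℝ) < 1 / 2 by norm_num)
        rw [← Real.sqrt_eq_rpow] at hl
        rw [mul_div_assoc', le_div_iff₀ hlog]
        nlinarith [Real.sq_sqrt hx0.le, Real.sqrt_nonneg x]
      rw [abs_sub_comm, abs_of_nonneg (by linarith)]
      calc Chebyshev.psi x - Chebyshev.theta x ≤ C₂ * √x := h
        _ ≤ |C₂| * √x := by gcongr; exact le_abs_self _
        _ ≤ |C₂| * (2 * (x / Real.log x)) := by gcongr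
        _ = _ := by ring
    have a₃ := hX x ((le_max_left _ _).trans hxX)
    rw [Real.norm_eq_abs, Real.norm_of_nonneg hratio] at a₃
    have a₄ : |Chebyshev.theta x / Real.log x - x / Real.log x| ≤
        (2 * |C₂| + C₁) * (x / Real.log x ^ 2) := by
      rw [← sub_div, abs_div, abs_of_pos hlog, div_le_iff₀ hlog]
      have e : (2 * |C₂| + C₁) * (x / Real.log x ^ 2) * Real.log x =
        2 * |C₂| * (x / Real.log x) + C₁ * (x / Real.log x) := by field_simp
      rw [e]
      have := abs_sub_le (Chebyshev.theta x) (Chebyshev.psi x) x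
      linarith
    have a₅ := abs_sub_le (Nat.primeCounting ⌊x⌋₊ : ℝ) (Chebyshev.theta x / Real.log x) (x / Real.log x)
    have a₆ : C₃ * (x / Real.log x ^ 2) ≤ |C₃| * (x / Real.log x ^ 2) := by
      gcongr; exact le_abs_self _
    have a₇ : 0 ≤ D * (x / Real.log x ^ 2) := by positivity
    calc _ ≤ |C₃| * (x / Real.log x ^ 2) + (2 * |C₂| + C₁) * (x / Real.log x ^ 2) := by linarith
      _ ≤ _ := by linarith
  · push Not at hxX
    have hlX : Real.log x ≤ Real.log X₀ := Real.log_le_log hx0 hxX.le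
    have hπ : (Nat.primeCounting ⌊x⌋₊ : ℝ) ≤ x := by
      have h1 : Nat.primeCounting ⌊x⌋₊ ≤ ⌊x⌋₊ := by
        rw [← Nat.primesLE_card_eq_primeCounting]
        calc (Nat.primesLE ⌊x⌋₊).card ≤ (Finset.Icc 1 ⌊x⌋₊).card :=
              Finset.card_le_card fun p hp => by
                rw [Nat.mem_primesLE] at hp
                exact Finset.mem_Icc.mpr ⟨hp.2.one_le, hp.1⟩
          _ = ⌊x⌋₊ := by simp
      exact (Nat.cast_le.mpr h1).trans (Nat.floor_le hx0.le)
    have hq : x / Real.log x ≤ X₀ / Real.log √2 := by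
      gcongr
    have b₁ : |(Nat.primeCounting ⌊x⌋₊ : ℝ) - x / Real.log x| ≤ X₀ + X₀ / Real.log √2 := by
      have h0 : (0 : ℝ) ≤ Nat.primeCounting ⌊x⌋₊ := Nat.cast_nonneg _
      have h1 : 0 ≤ x / Real.log x := by positivity
      rw [abs_le]; constructor <;> linarith
    have b₂ : X₀ + X₀ / Real.log √2 ≤ D * (x / Real.log x ^ 2) := by
      rw [hD, mul_assoc]
      refine le_mul_of_one_le_right (by positivity) ?_
      rw [mul_div_assoc', le_div_iff₀ (by positivity), one_mul]
      calc Real.log x ^ 2 ≤ Real.log X₀ ^ 2 * 1 := by rw [mul_one]; gcongr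
        _ ≤ Real.log X₀ ^ 2 * x := by gcongr
    have b₃ : 0 ≤ (|C₃| + 2 * |C₂| + C₁) * (x / Real.log x ^ 2) := by positivity
    linarith

end PrimeCounting

/-! ### Parseval's identity on the circle. -/

section Parseval

open Complex MeasureTheory

/-- The squared modulus of an absolutely convergent Fourier series with real coefficients. -/
lemma hasSum_normSq_fourier {c : ℕ → ℝ} (hc : Summable fun a => |c a|) {φ : ℝ} {F : ℂ}
    (hF : HasSum (fun a : ℕ => (c a : ℂ) * exp (φ * I) ^ a) F) :
    HasSum (fun q : ℕ × ℕ => ((c q.1 * c q.2 : ℝ) : ℂ) * exp (((q.1 : ℝ) - (q.2 : ℝ)) * φ * I))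
      ((‖F‖ ^ 2 : ℝ) : ℂ) := by
  have hn : ∀ a : ℕ, ‖(c a : ℂ) * exp (φ * I) ^ a‖ = |c a| := by
    intro a; rw [norm_mul, norm_pow, norm_exp_ofReal_mul_I, one_pow, mul_one, norm_real]; rfl
  have hconj : HasSum (fun a : ℕ => (c a : ℂ) * exp (-(φ * I)) ^ a) (starRingEnd ℂ F) := by
    have := hasSum_conj'.mpr hF
    refine this.congr_fun fun a => ?_
    simp only [map_mul, map_pow, conj_ofReal, ← exp_conj, conj_I]
    ring_nf
  have hn' : ∀ a : ℕ, ‖(c a : ℂ) * exp (-(φ * I)) ^ a‖ = |c a| := by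
    intro a
    rw [norm_mul, norm_pow, show -(φ * I) = ((-φ : ℝ) : ℂ) * I by push_cast; ring,
      norm_exp_ofReal_mul_I, one_pow, mul_one, norm_real]; rfl
  have hs := summable_mul_of_summable_norm (f := fun a : ℕ => (c a : ℂ) * exp (φ * I) ^ a)
    (g := fun a : ℕ => (c a : ℂ) * exp (-(φ * I)) ^ a) (hc.congr fun a => (hn a).symm)
    (hc.congr fun a => (hn' a).symm)
  have hm := hF.mul hconj hs
  have e : ((‖F‖ ^ 2 : ℝ) : ℂ) = F * (starRingEnd ℂ) F := by
    rw [mul_conj, normSq_eq_norm_sq]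
  rw [e]
  refine hm.congr_fun fun q => ?_
  rw [← exp_nat_mul, ← exp_nat_mul]
  have : exp (((q.1 : ℝ) - (q.2 : ℝ)) * φ * I) =
      exp ((q.1 : ℂ) * (φ * I)) * exp ((q.2 : ℂ) * (-(φ * I))) := by
    rw [← exp_add]; congr 1; push_cast; ring
  rw [this]; push_cast; ring

lemma integral_exp_int_mul (n : ℤ) :
    ∫ φ in (0 : ℝ)..2 * Real.pi, exp ((n : ℂ) * φ * I) = if n = 0 then (2 * Real.pi : ℂ) else 0 := by
  split_ifs with h
  · simp [h]
  · have hc : (n : ℂ) * I ≠ 0 := mul_ne_zero (by exact_mod_cast h) I_ne_zero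
    have e : ∀ φ : ℝ, exp ((n : ℂ) * φ * I) = exp (((n : ℂ) * I) * φ) := by
      intro φ; congr 1; ring
    simp_rw [e]
    rw [integral_exp_mul_complex hc]
    have : exp ((n : ℂ) * I * ((2 * Real.pi : ℝ) : ℂ)) = 1 := by
      have := exp_int_mul_two_pi_mul_I n
      rw [← this]; congr 1; push_cast; ring
    rw [this]; simp

/-- Parseval's identity for absolutely convergent power series on the unit circle. -/
lemma hasSum_sq_parseval {c : ℕ → ℝ} (hc : Summable fun a => |c a|) {F : ℝ → ℂ}
    (hF : ∀ φ : ℝ, HasSum (fun a : ℕ => (c a : ℂ) * exp (φ * I) ^ a) (F φ)) :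
    HasSum (fun a => c a ^ 2) ((1 / (2 * Real.pi)) * ∫ φ in (0 : ℝ)..2 * Real.pi, ‖F φ‖ ^ 2) := by
  have hcc : Summable fun q : ℕ × ℕ => |c q.1| * |c q.2| :=
    hc.mul_of_nonneg hc (fun _ => abs_nonneg _) (fun _ => abs_nonneg _)
  set G : ℕ × ℕ → C(ℝ, ℂ) := fun q =>
    ⟨fun φ => ((c q.1 * c q.2 : ℝ) : ℂ) * exp (((q.1 : ℝ) - (q.2 : ℝ)) * φ * I), by fun_prop⟩
  have hbound : ∀ (q : ℕ × ℕ) (φ : ℝ), ‖G q φ‖ = |c q.1| * |c q.2| := by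
    intro q φ
    change ‖((c q.1 * c q.2 : ℝ) : ℂ) * exp (((q.1 : ℝ) - (q.2 : ℝ)) * φ * I)‖ = _
    rw [norm_mul, show (((q.1 : ℝ) : ℂ) - ((q.2 : ℝ) : ℂ)) * φ * I =
      ((((q.1 : ℝ) - q.2) * φ : ℝ) : ℂ) * I by push_cast; ring, norm_exp_ofReal_mul_I, mul_one,
      norm_real, Real.norm_eq_abs, abs_mul]
  have key := intervalIntegral.hasSum_intervalIntegral_of_summable_norm (f := G)
    (a := 0) (b := 2 * Real.pi) (by
      refine hcc.of_nonneg_of_le (fun _ => norm_nonneg _) fun q => ?_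
      refine (ContinuousMap.norm_le _ (by positivity)).mpr fun φ => ?_
      rw [ContinuousMap.restrict_apply, hbound])
  have e1 : ∀ φ : ℝ, ∑' q, G q φ = ((‖F φ‖ ^ 2 : ℝ) : ℂ) := fun φ =>
    (hasSum_normSq_fourier hc (hF φ)).tsum_eq
  simp_rw [e1] at key
  rw [intervalIntegral.integral_ofReal] at key
  have e2 : ∀ q : ℕ × ℕ, ∫ φ in (0 : ℝ)..2 * Real.pi, G q φ =
      if q.1 = q.2 then ((2 * Real.pi * c q.1 ^ 2 : ℝ) : ℂ) else 0 := by
    intro q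
    change ∫ φ in (0 : ℝ)..2 * Real.pi,
      ((c q.1 * c q.2 : ℝ) : ℂ) * exp (((q.1 : ℝ) - (q.2 : ℝ)) * φ * I) = _
    rw [intervalIntegral.integral_const_mul]
    have := integral_exp_int_mul ((q.1 : ℤ) - q.2)
    push_cast at this ⊢
    rw [this]
    by_cases h : q.1 = q.2
    · simp [h]; ring
    · have : ¬ ((q.1 : ℤ) - q.2 = 0) := by omega
      simp [h, this]
  simp_rw [e2] at key
  have hinj : Function.Injective fun a : ℕ => (a, a) := fun a b h => (Prod.mk.inj h).1
  have key2 := (hinj.hasSum_iff (f := fun q : ℕ × ℕ =>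
    if q.1 = q.2 then ((2 * Real.pi * c q.1 ^ 2 : ℝ) : ℂ) else 0) (by
      intro q hq
      rw [if_neg]
      intro h
      exact hq ⟨q.1, by ext <;> simp [h]⟩)).mpr key
  simp only [Function.comp_def, if_true] at key2
  have key3 := (hasSum_ofReal.mp key2).mul_left (1 / (2 * Real.pi))
  refine key3.congr_fun fun a => ?_
  have := Real.pi_pos
  field_simp

end Parseval

/-! ### Binomial coefficients, local means and I₀ as circle averages. -/

section LocalFactor

open Complex MeasureTheory

/-- The coefficient of `wᵃ` in `(1 - w)⁻ᶻ`. -/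
noncomputable def binomCoeff (z : ℝ) (a : ℕ) : ℝ :=
  (ascPochhammer ℝ a).eval z / (a.factorial : ℝ)

lemma binomCoeff_succ (m a : ℕ) : binomCoeff ((m + 1 : ℕ) : ℝ) a = ((a + m).choose m : ℝ) := by
  rw [binomCoeff, ascPochhammer_nat_eq_natCast_ascFactorial, Nat.ascFactorial_eq_factorial_mul_choose,
    Nat.cast_mul, mul_div_cancel_left₀ _ (by exact_mod_cast a.factorial_ne_zero)]
  rw [add_comm a m, Nat.choose_symm_add]

lemma binomCoeff_neg (k a : ℕ) : binomCoeff (-(k : ℝ)) a = (-1) ^ a * (k.choose a : ℝ) := by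
  rw [binomCoeff, ascPochhammer_eval_neg_eq_descPochhammer, descPochhammer_eval_eq_descFactorial,
    Nat.descFactorial_eq_factorial_mul_choose, Nat.cast_mul]
  have : (a.factorial : ℝ) ≠ 0 := by exact_mod_cast a.factorial_ne_zero
  field_simp

/-- For δ = 1 the coefficients are nonnegative and for δ = -1 they alternate in sign, so removing
the signs amounts to evaluating the binomial series at δr. -/
lemma abs_binomCoeff {δ : ℤ} (hδ : δ = 1 ∨ δ = -1) (k a : ℕ) :
    |binomCoeff ((δ : ℝ) * k) a| = (δ : ℝ) ^ a * binomCoeff ((δ : ℝ) * k) a := by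
  rcases hδ with rfl | rfl
  · cases k with
    | zero =>
      have : binomCoeff (((1 : ℤ) : ℝ) * ((0 : ℕ) : ℝ)) a = (-1) ^ a * ((0 : ℕ).choose a : ℝ) := by
        rw [← binomCoeff_neg]; simp
      rw [this]
      cases a <;> simp
    | succ m =>
      rw [Int.cast_one, one_mul, binomCoeff_succ]; simp
  · have : (((-1 : ℤ) : ℝ) * (k : ℝ)) = -(k : ℝ) := by push_cast; ring
    rw [this, binomCoeff_neg, abs_mul, abs_pow, abs_neg, abs_one, one_pow, one_mul, Nat.abs_cast]
    push_cast
    rw [← mul_assoc, ← mul_pow]; simp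

lemma hasSum_binomCoeff {δ : ℤ} (hδ : δ = 1 ∨ δ = -1) (k : ℕ) {w : ℂ} (hw : ‖w‖ < 1) :
    HasSum (fun a : ℕ => (binomCoeff ((δ : ℝ) * k) a : ℂ) * w ^ a) ((1 - w) ^ (-(δ * k))) := by
  have hneg : ∀ k : ℕ, HasSum (fun a : ℕ => (((-1) ^ a * (k.choose a : ℝ) : ℝ) : ℂ) * w ^ a)
      ((1 - w) ^ k) := by
    intro k
    have e : (1 - w) ^ k = ∑ a ∈ Finset.range (k + 1),
        (((-1) ^ a * (k.choose a : ℝ) : ℝ) : ℂ) * w ^ a := by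
      rw [sub_eq_neg_add, add_pow]
      refine Finset.sum_congr rfl fun a _ => ?_
      rw [neg_pow]; push_cast; ring
    rw [e]
    refine hasSum_sum_of_ne_finset_zero fun a ha => ?_
    rw [Nat.choose_eq_zero_of_lt (by simpa using ha)]; simp
  rcases hδ with rfl | rfl
  · cases k with
    | zero =>
      have e : ∀ a, binomCoeff (((1 : ℤ) : ℝ) * ((0 : ℕ) : ℝ)) a =
          (-1) ^ a * ((0 : ℕ).choose a : ℝ) := by
        intro a; rw [← binomCoeff_neg]; simp
      simp_rw [e]
      simpa using hneg 0
    | succ m =>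
      simp only [Int.cast_one, one_mul, binomCoeff_succ]
      have := hasSum_choose_mul_geometric_of_norm_lt_one m hw
      rw [one_div] at this
      rw [zpow_neg, zpow_natCast]
      simpa using this
  · have : (((-1 : ℤ) : ℝ) * (k : ℝ)) = -(k : ℝ) := by push_cast; ring
    simp_rw [this, binomCoeff_neg]
    simpa using hneg k

lemma hasSum_abs_binomCoeff {δ : ℤ} (hδ : δ = 1 ∨ δ = -1) (k : ℕ) {r : ℝ} (hr0 : 0 ≤ r)
    (hr : r < 1) :
    HasSum (fun a : ℕ => |binomCoeff ((δ : ℝ) * k) a| * r ^ a) ((1 - δ * r) ^ (-(δ * k))) := by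
  have hδ1 : |(δ : ℝ)| = 1 := by rcases hδ with rfl | rfl <;> simp
  have h := hasSum_binomCoeff hδ k (w := ((δ * r : ℝ) : ℂ)) (by
    rw [norm_real, Real.norm_eq_abs, abs_mul, hδ1, one_mul, abs_of_nonneg hr0]; exact hr)
  have e : ((1 - ((δ * r : ℝ) : ℂ)) ^ (-(δ * (k : ℤ))) : ℂ) =
      (((1 - δ * r : ℝ) ^ (-(δ * (k : ℤ))) : ℝ) : ℂ) := by push_cast; rfl
  rw [e] at h
  rw [← hasSum_ofReal]
  refine h.congr_fun fun a => ?_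
  rw [abs_binomCoeff hδ]
  push_cast
  ring

/-- The local factor `∑ₐ d_z(pᵃ)² p⁻²ᵃ` with `x = 1/p`. -/
noncomputable def localSum (z x : ℝ) : ℝ := ∑' a : ℕ, (binomCoeff z a * x ^ a) ^ 2

/-- `|1 - x e^{iφ}|²`. -/
noncomputable def circleNormSq (x φ : ℝ) : ℝ := 1 - 2 * x * Real.cos φ + x ^ 2

lemma normSq_one_sub_mul_exp (x φ : ℝ) :
    ‖1 - (x : ℂ) * exp (φ * I)‖ ^ 2 = circleNormSq x φ := by
  rw [← normSq_eq_norm_sq, normSq_apply, circleNormSq]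
  simp [exp_ofReal_mul_I_re, exp_ofReal_mul_I_im]
  nlinarith [Real.sin_sq_add_cos_sq φ]

lemma norm_zpow_sq_eq (x φ : ℝ) (n : ℤ) :
    ‖(1 - (x : ℂ) * exp (φ * I)) ^ n‖ ^ 2 = circleNormSq x φ ^ n := by
  rw [norm_zpow, ← normSq_one_sub_mul_exp, ← zpow_natCast, ← zpow_natCast, ← zpow_mul, ← zpow_mul,
    mul_comm n]

lemma summable_abs_binomCoeff {δ : ℤ} (hδ : δ = 1 ∨ δ = -1) (k : ℕ) {r : ℝ} (hr0 : 0 ≤ r)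
    (hr : r < 1) : Summable fun a : ℕ => |binomCoeff ((δ : ℝ) * k) a * r ^ a| := by
  refine (hasSum_abs_binomCoeff hδ k hr0 hr).summable.congr fun a => ?_
  rw [abs_mul, abs_of_nonneg (pow_nonneg hr0 a)]

lemma hasSum_binomCoeff_exp {δ : ℤ} (hδ : δ = 1 ∨ δ = -1) (k : ℕ) {x : ℝ} (hx0 : 0 ≤ x)
    (hx : x < 1) (φ : ℝ) :
    HasSum (fun a : ℕ => ((binomCoeff ((δ : ℝ) * k) a * x ^ a : ℝ) : ℂ) * exp (φ * I) ^ a)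
      ((1 - x * exp (φ * I)) ^ (-(δ * k))) := by
  have := hasSum_binomCoeff hδ k (w := x * exp (φ * I)) (by
    rw [norm_mul, norm_exp_ofReal_mul_I, mul_one, norm_real, Real.norm_of_nonneg hx0]; exact hx)
  refine this.congr_fun fun a => ?_
  push_cast
  rw [mul_pow]; ring

/-- Parseval: the numbers d_z(p^a) p^{-a} are the Fourier coefficients of (1 - x e^{iφ})^{-δk} at x
= 1/p. -/
lemma hasSum_localSum {δ : ℤ} (hδ : δ = 1 ∨ δ = -1) (k : ℕ) {x : ℝ} (hx0 : 0 ≤ x) (hx : x < 1) :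
    HasSum (fun a : ℕ => (binomCoeff ((δ : ℝ) * k) a * x ^ a) ^ 2)
      ((1 / (2 * Real.pi)) * ∫ φ in (0 : ℝ)..2 * Real.pi, circleNormSq x φ ^ (-(δ * (k : ℤ)))) := by
  have := hasSum_sq_parseval (summable_abs_binomCoeff hδ k hx0 hx)
    (fun φ => hasSum_binomCoeff_exp hδ k hx0 hx φ)
  simp_rw [norm_zpow_sq_eq] at this
  exact this

lemma localSum_eq_integral {δ : ℤ} (hδ : δ = 1 ∨ δ = -1) (k : ℕ) {x : ℝ} (hx0 : 0 ≤ x)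
    (hx : x < 1) :
    localSum ((δ : ℝ) * k) x =
      (1 / (2 * Real.pi)) * ∫ φ in (0 : ℝ)..2 * Real.pi, circleNormSq x φ ^ (-(δ * (k : ℤ))) :=
  (hasSum_localSum hδ k hx0 hx).tsum_eq

/-- Parseval for exp((t/2) e^{iφ}), whose squared modulus is exp(t cos φ). -/
lemma besselIZero_hasSum (t : ℝ) :
    HasSum (fun n : ℕ => (t / 2) ^ (2 * n) / (n.factorial : ℝ) ^ 2)
      ((1 / (2 * Real.pi)) * ∫ φ in (0 : ℝ)..2 * Real.pi, Real.exp (t * Real.cos φ)) := by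
  have hc : Summable fun a : ℕ => |(t / 2) ^ a / (a.factorial : ℝ)| := by
    exact (Real.summable_pow_div_factorial (t / 2)).abs
  have := hasSum_sq_parseval hc (F := fun φ => exp ((t / 2 : ℝ) * exp (φ * I))) (fun φ => by
    have := NormedSpace.expSeries_div_hasSum_exp (((t / 2 : ℝ) : ℂ) * exp (φ * I))
    rw [← exp_eq_exp_ℂ] at this
    refine this.congr_fun fun a => ?_
    push_cast; rw [mul_pow]; ring)
  have e : ∀ φ : ℝ, ‖exp ((t / 2 : ℝ) * exp (φ * I))‖ ^ 2 = Real.exp (t * Real.cos φ) := by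
    intro φ
    rw [norm_exp, ← Real.exp_nat_mul]
    congr 1
    rw [re_ofReal_mul, exp_ofReal_mul_I_re]; push_cast; ring
  simp_rw [e] at this
  refine this.congr_fun fun a => ?_
  rw [div_pow _ (a.factorial : ℝ), ← pow_mul, mul_comm a 2]

lemma besselIZero_eq_integral (t : ℝ) :
    besselIZero t = (1 / (2 * Real.pi)) * ∫ φ in (0 : ℝ)..2 * Real.pi, Real.exp (t * Real.cos φ) :=
  (besselIZero_hasSum t).tsum_eq

end LocalFactor

/-! ### The Dirichlet sum as a product of local sums. -/

section EulerProduct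

lemma genDivisor_one (z : ℝ) : genDivisor z 1 = 1 := by simp [genDivisor]

lemma genDivisor_mul_of_coprime (z : ℝ) {m n : ℕ} (h : m.Coprime n) :
    genDivisor z (m * n) = genDivisor z m * genDivisor z n := by
  rw [genDivisor, Nat.factorization_mul_of_coprime h,
    Finsupp.prod_add_index_of_disjoint h.disjoint_primeFactors]
  rfl

lemma genDivisor_prime_pow (z : ℝ) {p : ℕ} (hp : p.Prime) (a : ℕ) :
    genDivisor z (p ^ a) = binomCoeff z a := by
  rw [genDivisor, hp.factorization_pow, Finsupp.prod_single_index]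
  · rfl
  · simp

lemma summable_and_smoothDivisorSum_eq_prod {δ : ℤ} (hδ : δ = 1 ∨ δ = -1) (k : ℕ) (y : ℝ) :
    Summable (fun n : Nat.smoothNumbers (⌊y⌋₊ + 1) =>
      genDivisor ((δ : ℝ) * k) n ^ 2 / ((n : ℕ) : ℝ) ^ 2) ∧
    smoothDivisorSum ((δ : ℝ) * k) y =
      ∏ p ∈ Nat.primesBelow (⌊y⌋₊ + 1), localSum ((δ : ℝ) * k) (1 / p) := by
  set f : ℕ → ℝ := fun n => genDivisor ((δ : ℝ) * k) n ^ 2 / (n : ℝ) ^ 2 with hf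
  have hpow : ∀ {p : ℕ}, p.Prime → ∀ a : ℕ,
      f (p ^ a) = (binomCoeff ((δ : ℝ) * k) a * (1 / (p : ℝ)) ^ a) ^ 2 := by
    intro p hp a
    rw [hf]
    simp only [genDivisor_prime_pow _ hp, Nat.cast_pow]
    rw [mul_pow, one_div, inv_pow, inv_pow, div_eq_mul_inv]
  have hx : ∀ {p : ℕ}, p.Prime → 0 ≤ 1 / (p : ℝ) ∧ 1 / (p : ℝ) < 1 := by
    intro p hp
    have : (1 : ℝ) < p := by exact_mod_cast hp.one_lt
    exact ⟨by positivity, by rw [div_lt_one (by linarith)]; exact this⟩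
  have key := EulerProduct.summable_and_hasSum_smoothNumbers_prod_primesBelow_tsum (f := f)
    (by simp [hf, genDivisor_one])
    (by
      intro m n h
      simp only [hf]
      rw [genDivisor_mul_of_coprime _ h, Nat.cast_mul, mul_pow, mul_pow, mul_div_mul_comm])
    (by
      intro p hp
      refine (hasSum_localSum hδ k (hx hp).1 (hx hp).2).summable.congr fun a => ?_
      rw [hpow hp, Real.norm_of_nonneg (sq_nonneg _)]) (⌊y⌋₊ + 1)
  refine ⟨key.2.summable, ?_⟩
  rw [smoothDivisorSum]
  refine key.2.tsum_eq.trans (Finset.prod_congr rfl fun p hp => ?_)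
  rw [localSum]
  exact tsum_congr fun a => hpow (Nat.prime_of_mem_primesBelow hp) a

end EulerProduct

/-! ### Elementary bounds for I₀. -/

section BesselBounds

open Real MeasureTheory intervalIntegral

lemma one_sub_cos_le (φ : ℝ) : 1 - cos φ ≤ φ ^ 2 / 2 := by
  linarith [one_sub_sq_div_two_le_cos (x := φ)]

/-- A lower bound for an average over the circle from a short window. -/
lemma le_circle_average {f : ℝ → ℝ} (hf : Continuous f) (h0 : ∀ φ, 0 ≤ f φ) {a w m : ℝ}
    (ha : 0 ≤ a) (hw : 0 ≤ w) (haw : a + w ≤ 2 * π) (hm : ∀ φ ∈ Set.Icc a (a + w), m ≤ f φ) :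
    w * m / (2 * π) ≤ (1 / (2 * π)) * ∫ φ in (0 : ℝ)..2 * π, f φ := by
  have h1 : w * m ≤ ∫ φ in a..a + w, f φ := by
    have := integral_mono_on (μ := volume) (a := a) (b := a + w) (f := fun _ => m) (g := f)
      (by linarith) (by simp) (hf.intervalIntegrable _ _) hm
    simpa using this
  have h2 : ∫ φ in a..a + w, f φ ≤ ∫ φ in (0 : ℝ)..2 * π, f φ :=
    integral_mono_interval ha (by linarith) haw (Filter.Eventually.of_forall h0)
      (hf.intervalIntegrable _ _)
  rw [div_eq_inv_mul, one_div]
  exact mul_le_mul_of_nonneg_left (h1.trans h2) (by positivity)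

lemma circle_average_le {f : ℝ → ℝ} (hf : Continuous f) {M : ℝ} (hM : ∀ φ, f φ ≤ M) :
    (1 / (2 * π)) * ∫ φ in (0 : ℝ)..2 * π, f φ ≤ M := by
  have : ∫ φ in (0 : ℝ)..2 * π, f φ ≤ ∫ φ in (0 : ℝ)..2 * π, M :=
    integral_mono_on (by positivity) (hf.intervalIntegrable _ _) (by simp) fun φ _ => hM φ
  rw [intervalIntegral.integral_const, smul_eq_mul, sub_zero] at this
  calc _ ≤ (1 / (2 * π)) * (2 * π * M) := mul_le_mul_of_nonneg_left this (by positivity)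
    _ = M := by field_simp

lemma circle_average_mono {f g : ℝ → ℝ} (hf : Continuous f) (hg : Continuous g)
    (h : ∀ φ, f φ ≤ g φ) : (1 / (2 * π)) * ∫ φ in (0 : ℝ)..2 * π, f φ ≤
      (1 / (2 * π)) * ∫ φ in (0 : ℝ)..2 * π, g φ :=
  mul_le_mul_of_nonneg_left (integral_mono_on (by positivity) (hf.intervalIntegrable _ _)
    (hg.intervalIntegrable _ _) fun φ _ => h φ) (by positivity)

lemma besselIZero_neg (t : ℝ) : besselIZero (-t) = besselIZero t := by
  rw [besselIZero, besselIZero]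
  refine tsum_congr fun n => ?_
  rw [neg_div, pow_mul, pow_mul, neg_sq]

lemma one_le_besselIZero (t : ℝ) : 1 ≤ besselIZero t := by
  have h := (besselIZero_hasSum t).summable.le_tsum 0 (fun n _ => by
    have : 0 ≤ (t / 2) ^ (2 * n) := by rw [pow_mul]; positivity
    positivity)
  simpa [besselIZero] using h

lemma besselIZero_le_exp {t : ℝ} (ht : 0 ≤ t) : besselIZero t ≤ exp t := by
  rw [besselIZero_eq_integral]
  refine circle_average_le (by fun_prop) fun φ => exp_le_exp.mpr ?_
  nlinarith [cos_le_one φ]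

lemma besselIZero_le_exp_sq (t : ℝ) : besselIZero t ≤ exp (t ^ 2 / 4) := by
  have h2 : HasSum (fun n : ℕ => (t ^ 2 / 4) ^ n / (n.factorial : ℝ)) (exp (t ^ 2 / 4)) := by
    have := NormedSpace.expSeries_div_hasSum_exp (t ^ 2 / 4)
    rwa [← exp_eq_exp_ℝ] at this
  rw [besselIZero, ← h2.tsum_eq]
  refine (besselIZero_hasSum t).summable.tsum_le_tsum (fun n => ?_) h2.summable
  have h1 : (1 : ℝ) ≤ n.factorial := by exact_mod_cast n.factorial_pos
  rw [pow_mul, show (t / 2) ^ 2 = t ^ 2 / 4 by ring]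
  exact div_le_div_of_nonneg_left (by positivity) (by linarith) (by nlinarith)

/-- Laplace's method: for 0 ≤ φ ≤ 1/√(1+t) one has t(1 - cos φ) ≤ 1/2, so the integrand is at least
e^{t-1/2} there. -/
lemma exp_div_le_besselIZero {t : ℝ} (ht : 0 ≤ t) : exp t / (12 * √(1 + t)) ≤ besselIZero t := by
  rw [besselIZero_eq_integral]
  have hs : 1 ≤ √(1 + t) := by rw [one_le_sqrt]; linarith
  have hss : √(1 + t) ^ 2 = 1 + t := sq_sqrt (by linarith)
  have hpi := pi_gt_three
  have hw1 : 1 / √(1 + t) ≤ 1 := by rw [div_le_one (by linarith)]; exact hs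
  have := le_circle_average (f := fun φ => exp (t * cos φ)) (by fun_prop)
    (fun φ => (exp_pos _).le) (a := 0) (w := 1 / √(1 + t)) (m := exp t * exp (-(1 / 2))) le_rfl
    (by positivity) (by linarith) (fun φ hφ => by
      rw [← exp_add]
      refine exp_le_exp.mpr ?_
      have h1 := one_sub_cos_le φ
      rw [zero_add] at hφ
      have h2 : φ ^ 2 * (1 + t) ≤ 1 := by
        have : φ * √(1 + t) ≤ 1 := by rw [← le_div_iff₀ (by linarith)]; exact hφ.2
        rw [← hss, ← mul_pow]
        exact pow_le_one₀ (mul_nonneg hφ.1 (by linarith)) this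
      nlinarith [mul_le_mul_of_nonneg_left h1 ht, sq_nonneg φ])
  refine le_trans ?_ this
  have he : 2 * π ≤ 12 * exp (-(1 / 2)) := by
    have h3 : exp (1 / 2) ≤ 1.65 := by
      have h4 : exp (1 / 2) ^ 2 ≤ 1.65 ^ 2 := by
        rw [← exp_nat_mul]; norm_num
        linarith [exp_one_lt_d9]
      exact le_of_sq_le_sq h4 (by norm_num)
    have h5 : exp (-(1 / 2)) * exp (1 / 2) = 1 := by rw [← exp_add]; simp
    have h6 := pi_lt_d2
    have : 1 ≤ exp (-(1 / 2)) * 1.65 := by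
      nlinarith [mul_le_mul_of_nonneg_left h3 (exp_pos (-(1 / 2) : ℝ)).le]
    linarith
  rw [div_le_div_iff₀ (by positivity) (by positivity)]
  have hx : 1 / √(1 + t) * (exp t * exp (-(1 / 2))) * (12 * √(1 + t)) =
      exp t * (12 * exp (-(1 / 2))) := by field_simp
  rw [hx]
  exact mul_le_mul_of_nonneg_left he (exp_pos _).le

lemma log_besselIZero_nonneg (t : ℝ) : 0 ≤ log (besselIZero t) := log_nonneg (one_le_besselIZero t)

lemma log_besselIZero_le {t : ℝ} (ht : 0 ≤ t) : log (besselIZero t) ≤ t :=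
  (log_le_iff_le_exp (by linarith [one_le_besselIZero t])).mpr (besselIZero_le_exp ht)

lemma log_besselIZero_le_sq (t : ℝ) : log (besselIZero t) ≤ t ^ 2 / 4 :=
  (log_le_iff_le_exp (by linarith [one_le_besselIZero t])).mpr (besselIZero_le_exp_sq t)

lemma le_log_besselIZero {t : ℝ} (ht : 0 ≤ t) :
    t - log 12 - log (1 + t) / 2 ≤ log (besselIZero t) := by
  rw [le_log_iff_exp_le (by linarith [one_le_besselIZero t])]
  refine le_trans (le_of_eq ?_) (exp_div_le_besselIZero ht)
  rw [exp_sub, exp_sub, exp_log (by norm_num), ← log_sqrt (by linarith),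
    exp_log (sqrt_pos.mpr (by linarith)), div_div]

end BesselBounds

/-! ### Local means compared with their maximum and with I₀. -/

section LocalBounds

open Real MeasureTheory intervalIntegral

lemma circleNormSq_pos {x : ℝ} (hx0 : 0 ≤ x) (hx : x < 1) (φ : ℝ) : 0 < circleNormSq x φ := by
  rw [circleNormSq]
  nlinarith [cos_le_one φ, mul_le_mul_of_nonneg_left (cos_le_one φ) hx0,
    mul_pos (sub_pos.mpr hx) (sub_pos.mpr hx)]

lemma continuous_circleNormSq_zpow {x : ℝ} (hx0 : 0 ≤ x) (hx : x < 1) (n : ℤ) :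
    Continuous fun φ => circleNormSq x φ ^ n := by
  refine Continuous.zpow₀ ?_ n fun φ => Or.inl (circleNormSq_pos hx0 hx φ).ne'
  unfold circleNormSq; fun_prop

/-- The maximum of `|1 - x e^{iφ}|^{-2δk}` on the circle. -/
noncomputable def localMax (δ : ℤ) (k : ℕ) (x : ℝ) : ℝ := (1 - (δ : ℝ) * x) ^ (-(2 * (k : ℤ) * δ))

lemma one_sub_mul_pos {δ : ℤ} (hδ : δ = 1 ∨ δ = -1) {x : ℝ} (hx0 : 0 ≤ x) (hx : x < 1) :
    0 < 1 - (δ : ℝ) * x := by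
  rcases hδ with rfl | rfl <;> push_cast <;> linarith

lemma localMax_pos {δ : ℤ} (hδ : δ = 1 ∨ δ = -1) (k : ℕ) {x : ℝ} (hx0 : 0 ≤ x) (hx : x < 1) :
    0 < localMax δ k x := zpow_pos (one_sub_mul_pos hδ hx0 hx) _

lemma localMax_one (k : ℕ) (x : ℝ) : localMax 1 k x = (((1 - x) ^ 2) ^ k)⁻¹ := by
  rw [localMax, ← pow_mul, ← zpow_natCast, ← zpow_neg]; congr 1
  · push_cast; ring
  · push_cast; ring

lemma localMax_neg_one (k : ℕ) (x : ℝ) : localMax (-1) k x = ((1 + x) ^ 2) ^ k := by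
  rw [localMax, ← pow_mul, ← zpow_natCast]; congr 1
  · push_cast; ring
  · push_cast; ring

lemma circleNormSq_zpow_le_localMax {δ : ℤ} (hδ : δ = 1 ∨ δ = -1) (k : ℕ) {x : ℝ} (hx0 : 0 ≤ x)
    (hx : x < 1) (φ : ℝ) : circleNormSq x φ ^ (-(δ * (k : ℤ))) ≤ localMax δ k x := by
  have hN := circleNormSq_pos hx0 hx φ
  have h1x : 0 < 1 - x := by linarith
  rcases hδ with rfl | rfl
  · rw [localMax_one, one_mul, zpow_neg, zpow_natCast]
    refine inv_anti₀ (by positivity) (pow_le_pow_left₀ (by positivity) ?_ k)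
    rw [circleNormSq]
    nlinarith [mul_le_mul_of_nonneg_left (cos_le_one φ) hx0]
  · rw [localMax_neg_one, neg_one_mul, neg_neg, zpow_natCast]
    refine pow_le_pow_left₀ hN.le ?_ k
    rw [circleNormSq]
    nlinarith [mul_le_mul_of_nonneg_left (neg_one_le_cos φ) hx0]

lemma localSum_le_localMax {δ : ℤ} (hδ : δ = 1 ∨ δ = -1) (k : ℕ) {x : ℝ} (hx0 : 0 ≤ x)
    (hx : x < 1) : localSum ((δ : ℝ) * k) x ≤ localMax δ k x := by
  rw [localSum_eq_integral hδ k hx0 hx]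
  exact circle_average_le (continuous_circleNormSq_zpow hx0 hx _)
    (circleNormSq_zpow_le_localMax hδ k hx0 hx)

/-- The integrand peaks at φ = 0 for δ = 1 and at φ = π for δ = -1, and stays above 1/e of its
maximum on a window of length 1/(2√(1+kx)) starting at the peak. -/
lemma localMax_div_le_localSum {δ : ℤ} (hδ : δ = 1 ∨ δ = -1) (k : ℕ) {x : ℝ} (hx0 : 0 ≤ x)
    (hx : x ≤ 1 / 2) :
    localMax δ k x / (36 * √(1 + k * x)) ≤ localSum ((δ : ℝ) * k) x := by
  have hx1 : x < 1 := by linarith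
  rw [localSum_eq_integral hδ k hx0 hx1]
  have hkx : 0 ≤ k * x := by positivity
  have hs : 1 ≤ √(1 + k * x) := by rw [one_le_sqrt]; linarith
  have hss : √(1 + k * x) ^ 2 = 1 + k * x := sq_sqrt (by linarith)
  have hpi := pi_gt_three
  have hw1 : 1 / (2 * √(1 + k * x)) ≤ 1 := by rw [div_le_one (by linarith)]; linarith
  have hu : ∀ u, 0 ≤ u → u ≤ 1 / (2 * √(1 + k * x)) → u ^ 2 * (1 + k * x) ≤ 1 / 4 := by
    intro u hu0 hu
    have : u * √(1 + k * x) ≤ 1 / 2 := by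
      rw [le_div_iff₀ (by positivity)] at hu; linarith
    rw [← hss, ← mul_pow]
    calc (u * √(1 + k * x)) ^ 2 ≤ (1 / 2) ^ 2 :=
          pow_le_pow_left₀ (mul_nonneg hu0 (by linarith)) this 2
      _ = 1 / 4 := by norm_num
  have hQ := localMax_pos hδ k hx0 hx1
  have key : ∃ a : ℝ, 0 ≤ a ∧ a + 1 / (2 * √(1 + k * x)) ≤ 2 * π ∧
      ∀ φ ∈ Set.Icc a (a + 1 / (2 * √(1 + k * x))),
        localMax δ k x * exp (-1) ≤ circleNormSq x φ ^ (-(δ * (k : ℤ))) := by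
    rcases hδ with rfl | rfl
    · refine ⟨0, le_rfl, by linarith, fun φ hφ => ?_⟩
      rw [zero_add] at hφ
      have hN := circleNormSq_pos hx0 hx1 φ
      have h2 := hu φ hφ.1 hφ.2
      rw [localMax_one, one_mul, zpow_neg, zpow_natCast, exp_neg, ← mul_inv]
      refine inv_anti₀ (pow_pos hN _) ?_
      have h3 : circleNormSq x φ ≤ (1 - x) ^ 2 * exp (4 * (x * φ ^ 2)) := by
        have h4 : circleNormSq x φ ≤ (1 - x) ^ 2 + x * φ ^ 2 := by
          rw [circleNormSq]
          nlinarith [mul_le_mul_of_nonneg_left (one_sub_cos_le φ) hx0]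
        have h5 : 1 + 4 * (x * φ ^ 2) ≤ exp (4 * (x * φ ^ 2)) := by
          linarith [add_one_le_exp (4 * (x * φ ^ 2))]
        have h6 : 1 / 4 ≤ (1 - x) ^ 2 := by nlinarith
        have h7 : 0 ≤ x * φ ^ 2 := by positivity
        nlinarith [mul_le_mul_of_nonneg_left h5 (sq_nonneg (1 - x)),
          mul_le_mul_of_nonneg_right h6 h7]
      calc circleNormSq x φ ^ k ≤ ((1 - x) ^ 2 * exp (4 * (x * φ ^ 2))) ^ k :=
            pow_le_pow_left₀ hN.le h3 k
        _ = ((1 - x) ^ 2) ^ k * exp (4 * (k * x * φ ^ 2)) := by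
            rw [mul_pow, ← exp_nat_mul]; ring_nf
        _ ≤ ((1 - x) ^ 2) ^ k * exp 1 := by
            refine mul_le_mul_of_nonneg_left (exp_le_exp.mpr ?_) (by positivity)
            nlinarith [sq_nonneg φ]
    · refine ⟨π, by linarith, by linarith, fun φ hφ => ?_⟩
      have hN := circleNormSq_pos hx0 hx1 φ
      have h2 := hu (φ - π) (by linarith [hφ.1]) (by linarith [hφ.2])
      have h1 := one_sub_cos_le (φ - π)
      rw [cos_sub_pi] at h1
      rw [localMax_neg_one, neg_one_mul, neg_neg, zpow_natCast]
      set u := φ - π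
      have h7 : 0 ≤ x * u ^ 2 := by positivity
      have h8 : x * u ^ 2 ≤ 1 / 8 := by nlinarith [sq_nonneg u]
      have h3 : (1 + x) ^ 2 * exp (-(2 * (x * u ^ 2))) ≤ circleNormSq x φ := by
        have h4 : (1 + x) ^ 2 - x * u ^ 2 ≤ circleNormSq x φ := by
          rw [circleNormSq]
          nlinarith [mul_le_mul_of_nonneg_left h1 hx0]
        have h5 : exp (-(2 * (x * u ^ 2))) ≤ 1 - x * u ^ 2 := by
          have h9 : 0 < 1 - x * u ^ 2 := by linarith
          rw [← le_log_iff_exp_le h9]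
          have := one_sub_inv_le_log_of_pos h9
          refine le_trans ?_ this
          rw [neg_le, neg_sub, sub_le_iff_le_add, inv_le_iff_one_le_mul₀ h9]
          nlinarith
        have h6 : 1 ≤ (1 + x) ^ 2 := by nlinarith
        nlinarith [mul_le_mul_of_nonneg_left h5 (sq_nonneg (1 + x)),
          mul_le_mul_of_nonneg_right h6 h7]
      calc ((1 + x) ^ 2) ^ k * exp (-1) ≤ ((1 + x) ^ 2) ^ k * exp (-(2 * (k * x * u ^ 2))) := by
            refine mul_le_mul_of_nonneg_left (exp_le_exp.mpr ?_) (by positivity)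
            nlinarith [sq_nonneg u]
        _ = ((1 + x) ^ 2 * exp (-(2 * (x * u ^ 2)))) ^ k := by
            rw [mul_pow, ← exp_nat_mul]; ring_nf
        _ ≤ circleNormSq x φ ^ k := pow_le_pow_left₀ (by positivity) h3 k
  obtain ⟨a, ha0, ha, hφ⟩ := key
  refine le_trans ?_ (le_circle_average (continuous_circleNormSq_zpow hx0 hx1 _)
    (fun φ => (zpow_pos (circleNormSq_pos hx0 hx1 φ) _).le) ha0 (by positivity) ha hφ)
  have h9 : 1 ≤ exp (-1) * 2.7182818286 := by
    rw [exp_neg, inv_mul_eq_div, one_le_div (exp_pos _)]; exact exp_one_lt_d9.le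
  have h10 : 2 * (2 * π) ≤ 36 * exp (-1) := by linarith [pi_lt_d2]
  rw [div_le_div_iff₀ (by positivity) (by positivity)]
  have : 1 / (2 * √(1 + k * x)) * (localMax δ k x * exp (-1)) * (36 * √(1 + k * x)) =
      localMax δ k x * (36 * exp (-1)) / 2 := by field_simp
  rw [this, le_div_iff₀ (by norm_num)]
  nlinarith

lemma localSum_pos {δ : ℤ} (hδ : δ = 1 ∨ δ = -1) (k : ℕ) {x : ℝ} (hx0 : 0 ≤ x) (hx : x < 1) :
    0 < localSum ((δ : ℝ) * k) x := by
  have h := (hasSum_localSum hδ k hx0 hx).summable.le_tsum 0 fun _ _ => sq_nonneg _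
  rw [localSum]
  refine lt_of_lt_of_le ?_ h
  simp [binomCoeff]

lemma one_le_localSum {δ : ℤ} (hδ : δ = 1 ∨ δ = -1) (k : ℕ) {x : ℝ} (hx0 : 0 ≤ x) (hx : x < 1) :
    1 ≤ localSum ((δ : ℝ) * k) x := by
  have h := (hasSum_localSum hδ k hx0 hx).summable.le_tsum 0 fun _ _ => sq_nonneg _
  rw [localSum]
  refine le_trans ?_ h
  simp [binomCoeff]

/-- Twice the real part of log(1 - w) = -w + O(|w|²) at w = x e^{iφ}. -/
lemma abs_log_circleNormSq_add_le {x : ℝ} (hx0 : 0 ≤ x) (hx : x ≤ 1 / 2) (φ : ℝ) :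
    |log (circleNormSq x φ) + 2 * x * cos φ| ≤ 2 * x ^ 2 := by
  have hz : ‖-((x : ℂ) * Complex.exp (φ * Complex.I))‖ = x := by
    rw [norm_neg, norm_mul, Complex.norm_exp_ofReal_mul_I, mul_one, Complex.norm_real,
      norm_of_nonneg hx0]
  have h1 := Complex.norm_log_one_add_sub_self_le (z := -((x : ℂ) * Complex.exp (φ * Complex.I)))
    (by rw [hz]; linarith)
  rw [hz] at h1
  have h2 := (Complex.abs_re_le_norm _).trans h1
  rw [Complex.sub_re, Complex.log_re, ← sub_eq_add_neg, Complex.neg_re, Complex.re_ofReal_mul,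
    Complex.exp_ofReal_mul_I_re] at h2
  have h3 : log (circleNormSq x φ) = 2 * log ‖1 - (x : ℂ) * Complex.exp (φ * Complex.I)‖ := by
    rw [← normSq_one_sub_mul_exp, log_pow]; norm_num
  have h4 : x ^ 2 * (1 - x)⁻¹ / 2 ≤ x ^ 2 := by
    have : (1 - x)⁻¹ ≤ 2 := by
      rw [inv_le_comm₀ (by linarith) (by norm_num)]; linarith
    nlinarith [mul_le_mul_of_nonneg_left this (sq_nonneg x)]
  rw [h3, show 2 * log ‖1 - (x : ℂ) * Complex.exp (φ * Complex.I)‖ + 2 * x * cos φ =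
    2 * (log ‖1 - (x : ℂ) * Complex.exp (φ * Complex.I)‖ - -(x * cos φ)) by ring, abs_mul, abs_two]
  linarith

lemma abs_log_circleNormSq_zpow_sub_le {δ : ℤ} (hδ : δ = 1 ∨ δ = -1) (k : ℕ) {x : ℝ} (hx0 : 0 ≤ x)
    (hx : x ≤ 1 / 2) (φ : ℝ) :
    |log (circleNormSq x φ ^ (-(δ * (k : ℤ)))) - δ * (2 * k * x) * cos φ| ≤ 2 * k * x ^ 2 := by
  have h := abs_log_circleNormSq_add_le hx0 hx φ
  have hδ1 : |(δ : ℝ)| = 1 := by rcases hδ with rfl | rfl <;> simp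
  rw [log_zpow]
  push_cast
  rw [show -((δ : ℝ) * k) * log (circleNormSq x φ) - δ * (2 * k * x) * cos φ =
    -(δ * (k * (log (circleNormSq x φ) + 2 * x * cos φ))) by ring, abs_neg, abs_mul, hδ1, one_mul,
    abs_mul, Nat.abs_cast]
  nlinarith [(Nat.cast_nonneg k : (0 : ℝ) ≤ k)]

lemma abs_log_localMax_sub_le {δ : ℤ} (hδ : δ = 1 ∨ δ = -1) (k : ℕ) {x : ℝ} (hx0 : 0 ≤ x)
    (hx : x ≤ 1 / 2) : |log (localMax δ k x) - 2 * k * x| ≤ 2 * k * x ^ 2 := by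
  rcases hδ with rfl | rfl
  · have := abs_log_circleNormSq_zpow_sub_le (Or.inl rfl) k hx0 hx 0
    rw [circleNormSq, cos_zero, show 1 - 2 * x * 1 + x ^ 2 = (1 - x) ^ 2 by ring, one_mul, zpow_neg,
      zpow_natCast, ← localMax_one] at this
    simpa using this
  · have := abs_log_circleNormSq_zpow_sub_le (Or.inr rfl) k hx0 hx π
    rw [circleNormSq, cos_pi, show 1 - 2 * x * -1 + x ^ 2 = (1 + x) ^ 2 by ring, neg_one_mul,
      neg_neg, zpow_natCast, ← localMax_neg_one] at this
    simpa using this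

/-- The integrands are compared pointwise: |1 - x e^{iφ}|^{-2δk} is exp(2δkx cos φ) up to a factor
exp(±2kx²). The sign δ disappears because I₀ is even. -/
lemma abs_log_localSum_sub_le {δ : ℤ} (hδ : δ = 1 ∨ δ = -1) (k : ℕ) {x : ℝ} (hx0 : 0 ≤ x)
    (hx : x ≤ 1 / 2) :
    |log (localSum ((δ : ℝ) * k) x) - log (besselIZero (2 * (k * x)))| ≤ 2 * k * x ^ 2 := by
  have hx1 : x < 1 := by linarith
  have hD := localSum_pos hδ k hx0 hx1
  have hI : besselIZero (2 * (k * x)) = besselIZero (δ * (2 * k * x)) := by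
    rcases hδ with rfl | rfl
    · push_cast; ring_nf
    · rw [← besselIZero_neg]; push_cast; ring_nf
  have hI1 := one_le_besselIZero (δ * (2 * k * x))
  rw [hI]
  have hc : Continuous fun φ => exp ((δ * (2 * k * x)) * cos φ) := by fun_prop
  have hN := fun φ => zpow_pos (circleNormSq_pos hx0 hx1 φ) (-(δ * (k : ℤ)))
  have hb := fun φ => abs_le.mp (abs_log_circleNormSq_zpow_sub_le hδ k hx0 hx φ)
  have h1 : localSum ((δ : ℝ) * k) x ≤ exp (2 * k * x ^ 2) * besselIZero (δ * (2 * k * x)) := by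
    rw [localSum_eq_integral hδ k hx0 hx1, besselIZero_eq_integral, mul_left_comm,
      ← intervalIntegral.integral_const_mul (_ : ℝ) (fun φ => exp _)]
    refine circle_average_mono (continuous_circleNormSq_zpow hx0 hx1 _) (hc.const_mul _) fun φ => ?_
    rw [← exp_add, ← log_le_iff_le_exp (hN φ)]
    linarith [(hb φ).2]
  have h2 : exp (-(2 * k * x ^ 2)) * besselIZero (δ * (2 * k * x)) ≤ localSum ((δ : ℝ) * k) x := by
    rw [localSum_eq_integral hδ k hx0 hx1, besselIZero_eq_integral, mul_left_comm,
      ← intervalIntegral.integral_const_mul (_ : ℝ) (fun φ => exp _)]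
    refine circle_average_mono (hc.const_mul _) (continuous_circleNormSq_zpow hx0 hx1 _) fun φ => ?_
    rw [← exp_add, ← le_log_iff_exp_le (hN φ)]
    linarith [(hb φ).1]
  have h3 := log_le_log hD h1
  have h4 := log_le_log (mul_pos (exp_pos _) (by linarith)) h2
  rw [log_mul (exp_pos _).ne' (by linarith), log_exp] at h3 h4
  rw [abs_le]
  constructor <;> linarith

end LocalBounds

/-! ### Convexity of log I₀ and bounds for its derivative. -/

section BesselConvexity

open Real MeasureTheory ProbabilityTheory

/-- The uniform probability measure on `(0, 2π]`. -/
noncomputable def circleMeasure : Measure ℝ :=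
  ENNReal.ofReal (1 / (2 * π)) • volume.restrict (Set.Ioc 0 (2 * π))

instance : IsFiniteMeasure circleMeasure := by
  unfold circleMeasure
  exact Measure.smul_finite _ ENNReal.ofReal_ne_top

/-- Makes log I₀ the cumulant generating function of cos φ for uniform φ, whence its analyticity
and, the second derivative being a variance, its convexity. -/
lemma mgf_cos_circleMeasure (t : ℝ) : mgf cos circleMeasure t = besselIZero t := by
  rw [mgf, circleMeasure, integral_smul_measure, besselIZero_eq_integral,
    intervalIntegral.integral_of_le (by positivity), ENNReal.toReal_ofReal (by positivity),
    smul_eq_mul]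

lemma cgf_cos_circleMeasure : cgf cos circleMeasure = fun t => log (besselIZero t) := by
  funext t; rw [cgf, mgf_cos_circleMeasure]

lemma mem_interior_integrableExpSet_cos (t : ℝ) :
    t ∈ interior (integrableExpSet cos circleMeasure) := by
  have : integrableExpSet cos circleMeasure = Set.univ := by
    refine Set.eq_univ_of_forall fun t => ?_
    refine Integrable.of_bound (C := exp |t|) (by fun_prop) (Filter.Eventually.of_forall fun φ => ?_)
    rw [norm_of_nonneg (exp_pos _).le]
    refine exp_le_exp.mpr ((le_abs_self _).trans ?_)
    rw [abs_mul]
    exact mul_le_of_le_one_right (abs_nonneg _) (abs_cos_le_one φ)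
  rw [this]; simp

/-- The derivative of `log I₀`. -/
noncomputable def logBesselDeriv : ℝ → ℝ := deriv fun t => log (besselIZero t)

lemma hasDerivAt_log_besselIZero (t : ℝ) :
    HasDerivAt (fun t => log (besselIZero t)) (logBesselDeriv t) t := by
  have := (analyticAt_cgf (mem_interior_integrableExpSet_cos t)).differentiableAt
  rw [cgf_cos_circleMeasure] at this
  exact this.hasDerivAt

lemma differentiable_logBesselDeriv : Differentiable ℝ logBesselDeriv := by
  intro t
  have := (analyticAt_cgf (mem_interior_integrableExpSet_cos t)).deriv.differentiableAt
  rwa [cgf_cos_circleMeasure] at this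

lemma continuous_log_besselIZero : Continuous fun t => log (besselIZero t) :=
  continuous_iff_continuousAt.mpr fun t => (hasDerivAt_log_besselIZero t).continuousAt

lemma convexOn_log_besselIZero : ConvexOn ℝ Set.univ fun t => log (besselIZero t) := by
  refine convexOn_univ_of_deriv2_nonneg
    (fun t => (hasDerivAt_log_besselIZero t).differentiableAt) differentiable_logBesselDeriv
    fun t => ?_
  rw [← iteratedDeriv_eq_iterate, ← cgf_cos_circleMeasure,
    iteratedDeriv_two_cgf_eq_integral (mem_interior_integrableExpSet_cos t)]
  exact div_nonneg (integral_nonneg fun φ => by positivity) mgf_nonneg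

lemma besselIZero_zero : besselIZero 0 = 1 :=
  le_antisymm (by simpa using besselIZero_le_exp le_rfl) (one_le_besselIZero 0)

/-- The tangent lies below the graph. The derivative bounds below insert a suitable s and the known
size of log I₀. -/
lemma logBesselDeriv_mul_le (t s : ℝ) :
    logBesselDeriv t * s ≤ log (besselIZero (t + s)) - log (besselIZero t) := by
  have hd := hasDerivAt_log_besselIZero t
  rcases lt_trichotomy s 0 with h | rfl | h
  · have := convexOn_log_besselIZero.slope_le_of_hasDerivAt (Set.mem_univ (t + s))
      (Set.mem_univ t) (by linarith) hd
    rw [slope_def_field, div_le_iff₀ (by linarith)] at this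
    linarith
  · simp
  · have := convexOn_log_besselIZero.le_slope_of_hasDerivAt (Set.mem_univ t)
      (Set.mem_univ (t + s)) (by linarith) hd
    rw [slope_def_field, le_div_iff₀ (by linarith)] at this
    linarith

lemma log_besselIZero_le_mul_logBesselDeriv (t : ℝ) :
    log (besselIZero t) ≤ t * logBesselDeriv t := by
  have := logBesselDeriv_mul_le t (-t)
  rw [add_neg_cancel, besselIZero_zero, log_one] at this
  linarith

lemma logBesselDeriv_le {t : ℝ} (ht : 0 ≤ t) : logBesselDeriv t ≤ t := by
  rcases ht.eq_or_lt with rfl | h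
  · have h1 := logBesselDeriv_mul_le 0
    simp only [zero_add, besselIZero_zero, log_one, sub_zero] at h1
    by_contra! hc
    have h2 := h1 (2 * logBesselDeriv 0)
    have h3 := log_besselIZero_le_sq (2 * logBesselDeriv 0)
    nlinarith
  · have h1 := logBesselDeriv_mul_le t t
    have h2 := log_besselIZero_le_sq (t + t)
    have h3 := log_besselIZero_nonneg t
    nlinarith

lemma logBesselDeriv_le_one {t : ℝ} (ht : 0 ≤ t) : logBesselDeriv t ≤ 1 := by
  by_contra! hc
  -- A slope above 1, followed along the tangent for this distance, would overtake the bound log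
  -- I₀(u) ≤ u.
  have h1 := logBesselDeriv_mul_le t ((t + 1) / (logBesselDeriv t - 1))
  have hs : 0 ≤ (t + 1) / (logBesselDeriv t - 1) := div_nonneg (by linarith) (by linarith)
  have h2 := log_besselIZero_le (t := t + (t + 1) / (logBesselDeriv t - 1)) (by linarith)
  have h3 := log_besselIZero_nonneg t
  have h4 : (t + 1) / (logBesselDeriv t - 1) * (logBesselDeriv t - 1) = t + 1 :=
    div_mul_cancel₀ _ (by linarith)
  nlinarith

/-- `log I₀` on `[0, 1)` and `t - log I₀` on `[1, ∞)`, rescaled, and their derivatives. -/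
lemma abs_sub_log_besselIZero_le {t : ℝ} (ht : 1 ≤ t) :
    |2 * t - log (besselIZero (2 * t))| ≤ 5 * √t ∧
    |2 - 2 * logBesselDeriv (2 * t)| * t ≤ 5 * √t := by
  have h1 := log_besselIZero_le (t := 2 * t) (by linarith)
  have h2 := le_log_besselIZero (t := 2 * t) (by linarith)
  have h3 : log 12 + log (1 + 2 * t) / 2 ≤ 5 * √t := by
    have hs : 1 ≤ √t := by rwa [one_le_sqrt]
    have hss : √t ^ 2 = t := sq_sqrt (by linarith)
    have h4 : log 12 < 2.6 := by
      have : (12 : ℝ) = 2 ^ 2 * 3 := by norm_num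
      rw [this, log_mul (by norm_num) (by norm_num), log_pow]
      have := log_two_lt_d9
      have h3 : log 3 < 1.2 := by
        rw [log_lt_iff_lt_exp (by norm_num)]
        have : (2.7182818283 : ℝ) ^ 6 < (exp (1.2 : ℝ)) ^ 5 := by
          rw [← exp_nat_mul, show ((5 : ℕ) : ℝ) * 1.2 = ((6 : ℕ) : ℝ) * 1 by norm_num, exp_nat_mul]
          exact pow_lt_pow_left₀ exp_one_gt_d9 (by norm_num) (by norm_num)
        exact lt_of_pow_lt_pow_left₀ 5 (exp_pos _).le (lt_trans (by norm_num) this)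
      push_cast
      linarith
    have h5 : log (1 + 2 * t) ≤ 4 * √t - 4 + log 4 + 2 := by
      have h6 : log (1 + 2 * t) ≤ log (4 * √t ^ 2) := by
        rw [hss]; exact log_le_log (by linarith) (by linarith)
      rw [log_mul (by norm_num) (by positivity), log_pow] at h6
      have := log_le_sub_one_of_pos (x := √t) (by linarith)
      push_cast at h6
      linarith
    have h7 : log 4 < 1.4 := by
      rw [show (4 : ℝ) = 2 ^ 2 by norm_num, log_pow]
      have := log_two_lt_d9
      push_cast; linarith
    linarith
  refine ⟨by rw [abs_of_nonneg (by linarith)]; linarith, ?_⟩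
  have h4 := log_besselIZero_le_mul_logBesselDeriv (2 * t)
  have h5 := logBesselDeriv_le_one (t := 2 * t) (by linarith)
  rw [abs_of_nonneg (by linarith)]
  linarith

lemma abs_log_besselIZero_two_mul_le {t : ℝ} (ht : 0 ≤ t) :
    |log (besselIZero (2 * t))| ≤ 4 * t ^ 2 ∧ |2 * logBesselDeriv (2 * t)| * t ≤ 4 * t ^ 2 := by
  have h1 := log_besselIZero_nonneg (2 * t)
  have h2 := log_besselIZero_le_sq (2 * t)
  refine ⟨by rw [abs_of_nonneg h1]; nlinarith, ?_⟩
  have h3 := logBesselDeriv_le (t := 2 * t) (by linarith)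
  have h4 : 0 ≤ logBesselDeriv (2 * t) * t := by
    have := log_besselIZero_le_mul_logBesselDeriv (2 * t)
    linarith
  rw [abs_mul, abs_two]
  rcases ht.eq_or_lt with rfl | h
  · simp
  · have : 0 ≤ logBesselDeriv (2 * t) := nonneg_of_mul_nonneg_left h4 h
    rw [abs_of_nonneg this]; nlinarith

end BesselConvexity

/-! ### Sums over primes of smooth functions. -/

section PrimeSums

open Real MeasureTheory intervalIntegral

lemma abs_intervalIntegral_le_of_le {f g : ℝ → ℝ} {a b : ℝ} (hab : a ≤ b)
    (h : ∀ u ∈ Set.Icc a b, |f u| ≤ g u) (hg : IntervalIntegrable g volume a b) :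
    |∫ u in a..b, f u| ≤ ∫ u in a..b, g u :=
  norm_integral_le_of_norm_le (f := f) hab
    (Filter.Eventually.of_forall fun u hu => h u (Set.Ioc_subset_Icc_self hu)) hg

lemma sum_primeIndicator (m : ℕ) :
    ∑ n ∈ Finset.Icc 0 m, (if n.Prime then (1 : ℝ) else 0) = Nat.primeCounting m := by
  rw [Finset.sum_boole, ← Nat.primesLE_card_eq_primeCounting]
  congr 2
  ext p
  simp [Nat.mem_primesLE]

/-- Sums over primes of a `C¹` function, from the prime number theorem. -/
lemma exists_abs_sum_primes_sub_integral_le :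
    ∃ C > 0, ∀ (F F' M : ℝ → ℝ) (a b : ℝ), √2 ≤ a → a ≤ b →
      (∀ u ∈ Set.Icc a b, HasDerivAt F (F' u) u) → ContinuousOn F' (Set.Icc a b) →
      ContinuousOn M (Set.Icc a b) → (∀ u ∈ Set.Icc a b, |F u| ≤ M u) →
      (∀ u ∈ Set.Icc a b, |F' u| * u ≤ M u) →
      |∑ p ∈ (Finset.Ioc ⌊a⌋₊ ⌊b⌋₊).filter Nat.Prime, F p - ∫ u in a..b, F u / log u| ≤
        C / log a ^ 2 * (a * M a + b * M b + ∫ u in a..b, M u) := by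
  obtain ⟨C, hC, hpi⟩ := exists_abs_primeCounting_sub_le
  refine ⟨C + 1, by linarith, fun F F' M a b ha hab hF hF' hM hFM hFM' => ?_⟩
  have h2 : (1 : ℝ) < √2 := by
    rw [lt_sqrt (by norm_num)]; norm_num
  have ha1 : 1 < a := by linarith
  have hb1 : 1 < b := by linarith
  have hla : 0 < log a := log_pos ha1
  have hu1 : ∀ u ∈ Set.Icc a b, 1 < u := fun u hu => lt_of_lt_of_le ha1 hu.1
  have hlu : ∀ u ∈ Set.Icc a b, 0 < log u := fun u hu => log_pos (hu1 u hu)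
  have hcF : ContinuousOn F (Set.Icc a b) := fun u hu => (hF u hu).continuousAt.continuousWithinAt
  have hclog : ContinuousOn (fun u => log u) (Set.Icc a b) :=
    continuousOn_log.mono fun u hu => by
      have := hu1 u hu
      simp only [Set.mem_compl_iff, Set.mem_singleton_iff]; linarith
  have hI : ∀ {G : ℝ → ℝ}, ContinuousOn G (Set.Icc a b) → IntervalIntegrable G volume a b :=
    fun hG => ContinuousOn.intervalIntegrable (by rwa [Set.uIcc_of_le hab])
  set N : ℝ → ℝ := fun u => (Nat.primeCounting ⌊u⌋₊ : ℝ) with hN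
  have hmono : Monotone N := fun u v huv => by
    simp only [hN]
    exact_mod_cast Nat.monotone_primeCounting (Nat.floor_mono huv)
  have hderiv : ∀ u ∈ Set.Icc a b, deriv F u = F' u := fun u hu => (hF u hu).deriv
  have habel := sum_mul_eq_sub_sub_integral_mul (f := F)
    (fun n => if n.Prime then (1 : ℝ) else 0) (a := a) (b := b) (by linarith) hab
    (fun u hu => (hF u hu).differentiableAt)
    ((hF'.congr hderiv).integrableOn_compact isCompact_Icc)
  simp only [sum_primeIndicator, mul_ite, mul_one, mul_zero] at habel
  rw [← Finset.sum_filter, ← integral_of_le hab] at habel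
  have e1 : ∫ u in a..b, deriv F u * (Nat.primeCounting ⌊u⌋₊ : ℝ) = ∫ u in a..b, F' u * N u :=
    integral_congr fun u hu => by
      rw [Set.uIcc_of_le hab] at hu
      simp only [hN, hderiv u hu]
  rw [e1] at habel
  have hI1 : IntervalIntegrable (fun u => F' u * N u) volume a b :=
    (hmono.intervalIntegrable).continuousOn_mul (by rwa [Set.uIcc_of_le hab])
  have hcl : ∀ u ∈ Set.Icc a b, log u ≠ 0 := fun u hu => (hlu u hu).ne'
  have hc2 : ContinuousOn (fun u => F' u * (u / log u)) (Set.Icc a b) :=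
    hF'.mul (continuousOn_id.div hclog hcl)
  have hc3 : ContinuousOn (fun u => F u / log u) (Set.Icc a b) := hcF.div hclog hcl
  have hc4 : ContinuousOn (fun u => F u / log u ^ 2) (Set.Icc a b) :=
    hcF.div (hclog.pow 2) fun u hu => pow_ne_zero 2 (hcl u hu)
  -- Integration by parts of the main term u / log u of the prime count. The extra F / log² u is of
  -- the size of the error.
  have hparts : ∫ u in a..b, (F' u * (u / log u) + (F u / log u - F u / log u ^ 2)) =
      F b * (b / log b) - F a * (a / log a) := by
    refine integral_eq_sub_of_hasDerivAt (f := fun u => F u * (u / log u)) (fun u hu => ?_)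
      (hI (hc2.add (hc3.sub hc4)))
    rw [Set.uIcc_of_le hab] at hu
    have hu0 : u ≠ 0 := by linarith [hu1 u hu]
    have := (hF u hu).mul ((hasDerivAt_id u).div (hasDerivAt_log hu0) (hcl u hu))
    refine this.congr_deriv ?_
    have := hcl u hu
    simp only [Pi.div_apply, id]
    field_simp
  rw [integral_add (hI hc2) ((hI hc3).sub (hI hc4)), integral_sub (hI hc3) (hI hc4)] at hparts
  have hsub : ∫ u in a..b, F' u * (N u - u / log u) =
      (∫ u in a..b, F' u * N u) - ∫ u in a..b, F' u * (u / log u) := by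
    rw [← integral_sub hI1 (hI hc2)]; congr 1; ext u; ring
  have hIM := hI hM
  have hlog2 : ∀ u ∈ Set.Icc a b, log a ^ 2 ≤ log u ^ 2 := fun u hu =>
    pow_le_pow_left₀ hla.le (log_le_log (by linarith) hu.1) 2
  have hR : ∀ u ∈ Set.Icc a b, |N u - u / log u| ≤ C * (u / log a ^ 2) := fun u hu => by
    refine (hpi u (ha.trans hu.1)).trans ?_
    have := hlog2 u hu
    have := hu1 u hu
    gcongr
  have hb1 : |∫ u in a..b, F' u * (N u - u / log u)| ≤ C / log a ^ 2 * ∫ u in a..b, M u := by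
    rw [← intervalIntegral.integral_const_mul]
    refine abs_intervalIntegral_le_of_le hab ?_ (hIM.const_mul _)
    intro u hu
    have h3 := hR u hu
    have h4 := hFM' u hu
    have h5 := hu1 u hu
    rw [abs_mul]
    calc |F' u| * |N u - u / log u| ≤ |F' u| * (C * (u / log a ^ 2)) := by gcongr
      _ = C / log a ^ 2 * (|F' u| * u) := by ring
      _ ≤ _ := by gcongr
  have hb2 : |∫ u in a..b, F u / log u ^ 2| ≤ 1 / log a ^ 2 * ∫ u in a..b, M u := by
    rw [← intervalIntegral.integral_const_mul]
    refine abs_intervalIntegral_le_of_le hab ?_ (hIM.const_mul _)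
    intro u hu
    have h3 := hFM u hu
    have h4 := hlog2 u hu
    have := hlu u hu
    have h0 : 0 ≤ M u := (abs_nonneg _).trans h3
    rw [abs_div, abs_of_nonneg (by positivity : 0 ≤ log u ^ 2), one_div_mul_eq_div]
    gcongr
  have hpt : ∀ u ∈ Set.Icc a b, |F u * (N u - u / log u)| ≤ C / log a ^ 2 * (u * M u) := by
    intro u hu
    rw [abs_mul]
    have h3 := hFM u hu
    have h4 := hR u hu
    have h5 := hu1 u hu
    have h0 : 0 ≤ M u := (abs_nonneg _).trans h3
    calc |F u| * |N u - u / log u| ≤ M u * (C * (u / log a ^ 2)) := by gcongr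
      _ = _ := by ring
  have hfinal : ∑ p ∈ (Finset.Ioc ⌊a⌋₊ ⌊b⌋₊).filter Nat.Prime, F p - ∫ u in a..b, F u / log u =
      F b * (N b - b / log b) - F a * (N a - a / log a) -
        (∫ u in a..b, F' u * (N u - u / log u)) - ∫ u in a..b, F u / log u ^ 2 := by
    rw [habel, hsub]
    simp only [hN]
    linarith
  rw [hfinal]
  have g1 := abs_le.mp (hpt b (Set.right_mem_Icc.mpr hab))
  have g2 := abs_le.mp (hpt a (Set.left_mem_Icc.mpr hab))
  have g3 := abs_le.mp hb1
  have g4 := abs_le.mp hb2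
  have hM0 : ∀ u ∈ Set.Icc a b, 0 ≤ M u := fun u hu => (abs_nonneg _).trans (hFM u hu)
  have g5 : 0 ≤ 1 / log a ^ 2 * (a * M a + b * M b) := by
    have := hM0 a (Set.left_mem_Icc.mpr hab)
    have := hM0 b (Set.right_mem_Icc.mpr hab)
    positivity
  have e2 : (C + 1) / log a ^ 2 * (a * M a + b * M b + ∫ u in a..b, M u) =
      C / log a ^ 2 * (a * M a) + C / log a ^ 2 * (b * M b) + (C / log a ^ 2 * ∫ u in a..b, M u) +
      (1 / log a ^ 2 * (a * M a + b * M b)) + 1 / log a ^ 2 * ∫ u in a..b, M u := by ring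
  rw [e2, abs_le]
  constructor <;> linarith [g1.1, g1.2, g2.1, g2.2, g3.1, g3.2, g4.1, g4.2]

end PrimeSums

/-! ### Sums of f(k/p) over primes. -/

section PrimeSumsOfRatio

open Real MeasureTheory intervalIntegral

lemma integral_ratio {f : ℝ → ℝ} {a b k : ℝ} (ha : 0 < a) (hab : a ≤ b) (hk : 0 < k)
    (hf : ContinuousOn f (Set.Icc (k / b) (k / a))) :
    ∫ u in a..b, f (k / u) = k * ∫ t in (k / b)..(k / a), f t / t ^ 2 := by
  have hb : 0 < b := by linarith
  have hpos : ∀ u ∈ Set.uIcc a b, 0 < u := fun u hu => by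
    rw [Set.uIcc_of_le hab] at hu; linarith [hu.1]
  have himg : (fun u => k / u) '' Set.uIcc a b ⊆ Set.Icc (k / b) (k / a) := by
    rintro _ ⟨u, hu, rfl⟩
    have := hpos u hu
    rw [Set.uIcc_of_le hab] at hu
    exact ⟨div_le_div_of_nonneg_left hk.le this hu.2, div_le_div_of_nonneg_left hk.le ha hu.1⟩
  have key := integral_comp_mul_deriv'' (a := a) (b := b) (f := fun u => k / u)
    (f' := fun u => -k / u ^ 2) (g := fun t => f t / t ^ 2)
    (continuousOn_const.div continuousOn_id fun u hu => (hpos u hu).ne')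
    (fun u hu => by
      have hu0 : u ≠ 0 := by
        rw [min_eq_left hab] at hu; linarith [hu.1]
      have := (hasDerivAt_inv hu0).const_mul k
      refine (this.congr_deriv ?_).hasDerivWithinAt
      ring)
    (continuousOn_const.div (continuousOn_pow 2) fun u hu => pow_ne_zero 2 (hpos u hu).ne')
    ((hf.div (continuousOn_pow 2) fun t ht => pow_ne_zero 2 (by
      have : 0 < k / b := by positivity
      linarith [ht.1])).mono himg)
  rw [integral_symm (k / a) (k / b), ← key, ← intervalIntegral.integral_neg,
    ← intervalIntegral.integral_const_mul]
  refine integral_congr fun u hu => ?_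
  have := hpos u hu
  simp only [Function.comp]
  field_simp

lemma integral_ratio_rpow_le {a k : ℝ} (ha : 0 < a) (hak : a ≤ k) :
    ∫ u in a..k, (k / u) ^ (3 / 4 : ℝ) ≤ 4 * k := by
  have hk : 0 < k := by linarith
  have e : ∫ u in a..k, (k / u) ^ (3 / 4 : ℝ) =
      ∫ u in a..k, k ^ (3 / 4 : ℝ) * u ^ (-(3 / 4) : ℝ) := by
    refine integral_congr fun u hu => ?_
    rw [Set.uIcc_of_le hak] at hu
    have : 0 < u := by linarith [hu.1]
    rw [div_rpow hk.le this.le, rpow_neg this.le, div_eq_mul_inv]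
  rw [e, intervalIntegral.integral_const_mul, integral_rpow (Or.inl (by norm_num))]
  have h1 : k ^ (3 / 4 : ℝ) * k ^ (-(3 / 4) + 1 : ℝ) = k := by
    rw [← rpow_add hk]; norm_num
  have h2 : 0 ≤ k ^ (3 / 4 : ℝ) * a ^ (-(3 / 4) + 1 : ℝ) := by positivity
  rw [mul_div_assoc', mul_sub, h1]
  norm_num at h2 ⊢
  linarith

lemma integral_ratio_rpow_le' {k y : ℝ} (hk : 0 < k) (hky : k ≤ y) :
    ∫ u in k..y, (k / u) ^ (3 / 2 : ℝ) ≤ 2 * k := by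
  have hy : 0 < y := by linarith
  have e : ∫ u in k..y, (k / u) ^ (3 / 2 : ℝ) =
      ∫ u in k..y, k ^ (3 / 2 : ℝ) * u ^ (-(3 / 2) : ℝ) := by
    refine integral_congr fun u hu => ?_
    rw [Set.uIcc_of_le hky] at hu
    have : 0 < u := by linarith [hu.1]
    rw [div_rpow hk.le this.le, rpow_neg this.le, div_eq_mul_inv]
  rw [e, intervalIntegral.integral_const_mul, integral_rpow (Or.inr ⟨by norm_num, by
    rw [Set.uIcc_of_le hky]; exact fun h => by linarith [h.1]⟩)]
  have h1 : k ^ (3 / 2 : ℝ) * k ^ (-(3 / 2) + 1 : ℝ) = k := by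
    rw [← rpow_add hk]; norm_num
  have h2 : 0 ≤ k ^ (3 / 2 : ℝ) * y ^ (-(3 / 2) + 1 : ℝ) := by positivity
  rw [mul_div_assoc', mul_sub, h1]
  norm_num at h2 ⊢
  linarith

/-- Sums of `f (k / p)` over primes, with the slowly varying weight `1 / log u` replaced by
`1 / log k`. -/
lemma exists_abs_sum_ratio_sub_le :
    ∃ C > 0, ∀ (f f' M : ℝ → ℝ) (a b k : ℝ), √2 ≤ a → a ≤ b → a ≤ k →
      (∀ t ∈ Set.Icc (k / b) (k / a), HasDerivAt f (f' t) t) →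
      ContinuousOn f' (Set.Icc (k / b) (k / a)) →
      ContinuousOn M (Set.Icc (k / b) (k / a)) →
      (∀ t ∈ Set.Icc (k / b) (k / a), |f t| ≤ M t) →
      (∀ t ∈ Set.Icc (k / b) (k / a), |f' t| * t ≤ M t) →
      (∀ t ∈ Set.Icc (k / b) (k / a), |f t| * |log t| ≤ M t) →
      |∑ p ∈ (Finset.Ioc ⌊a⌋₊ ⌊b⌋₊).filter Nat.Prime, f (k / p) -
          k / log k * ∫ t in (k / b)..(k / a), f t / t ^ 2| ≤
        C / log a ^ 2 * (a * M (k / a) + b * M (k / b) + ∫ u in a..b, M (k / u)) := by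
  obtain ⟨C, hC, h⟩ := exists_abs_sum_primes_sub_integral_le
  refine ⟨C + 1, by linarith, fun f f' M a b k ha hab hak hf hf' hM hfM hfM' hflog => ?_⟩
  have h2 : (1 : ℝ) < √2 := by
    rw [lt_sqrt (by norm_num)]; norm_num
  have ha1 : 1 < a := by linarith
  have hla : 0 < log a := log_pos ha1
  have hk0 : 0 < k := by linarith
  have hlak : log a ≤ log k := log_le_log (by linarith) hak
  have hlk : 0 < log k := by linarith
  have hu1 : ∀ u ∈ Set.Icc a b, 1 < u := fun u hu => lt_of_lt_of_le ha1 hu.1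
  have hlu : ∀ u ∈ Set.Icc a b, log a ≤ log u := fun u hu => log_le_log (by linarith) hu.1
  have hmem : ∀ u ∈ Set.Icc a b, k / u ∈ Set.Icc (k / b) (k / a) := fun u hu => by
    have := hu1 u hu
    exact ⟨div_le_div_of_nonneg_left hk0.le (by linarith) hu.2,
      div_le_div_of_nonneg_left hk0.le (by linarith) hu.1⟩
  have hcr : ContinuousOn (fun u => k / u) (Set.Icc a b) :=
    continuousOn_const.div continuousOn_id fun u hu => by
      have := hu1 u hu
      linarith
  have hcf : ContinuousOn f (Set.Icc (k / b) (k / a)) :=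
    fun t ht => (hf t ht).continuousAt.continuousWithinAt
  have hcF : ContinuousOn (fun u => f (k / u)) (Set.Icc a b) := hcf.comp hcr hmem
  have hcM : ContinuousOn (fun u => M (k / u)) (Set.Icc a b) := hM.comp hcr hmem
  have key := h (fun u => f (k / u)) (fun u => f' (k / u) * (-k / u ^ 2)) (fun u => M (k / u)) a b
    ha hab (fun u hu => by
      have hu0 : u ≠ 0 := by linarith [hu1 u hu]
      have h3 := (hasDerivAt_inv hu0).const_mul k
      have h4 : HasDerivAt (fun u => k / u) (-k / u ^ 2) u := h3.congr_deriv (by ring)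
      exact (hf _ (hmem u hu)).comp u h4)
    ((hf'.comp hcr hmem).mul (continuousOn_const.div (continuousOn_pow 2) fun u hu => by
      have := hu1 u hu
      exact pow_ne_zero 2 (by linarith)))
    hcM (fun u hu => hfM _ (hmem u hu)) (fun u hu => by
      have hu0 : 0 < u := by linarith [hu1 u hu]
      refine le_trans (le_of_eq ?_) (hfM' _ (hmem u hu))
      rw [abs_mul, abs_div, abs_neg, abs_of_pos hk0, abs_of_pos (by positivity : 0 < u ^ 2)]
      field_simp)
  have hI : ∀ {G : ℝ → ℝ}, ContinuousOn G (Set.Icc a b) → IntervalIntegrable G volume a b :=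
    fun hG => ContinuousOn.intervalIntegrable (by rwa [Set.uIcc_of_le hab])
  have hlne : ∀ u ∈ Set.Icc a b, log u ≠ 0 := fun u hu => by linarith [hlu u hu]
  have hclog : ContinuousOn (fun u => log u) (Set.Icc a b) :=
    continuousOn_log.mono fun u hu => by
      have := hu1 u hu
      simp only [Set.mem_compl_iff, Set.mem_singleton_iff]; linarith
  have hcq : ContinuousOn (fun u => f (k / u) / log u) (Set.Icc a b) := hcF.div hclog hlne
  have hdiff : |(∫ u in a..b, f (k / u) / log u) - k / log k * ∫ t in (k / b)..(k / a), f t / t ^ 2|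
      ≤ 1 / log a ^ 2 * ∫ u in a..b, M (k / u) := by
    have e : k / log k * ∫ t in (k / b)..(k / a), f t / t ^ 2 =
        ∫ u in a..b, 1 / log k * f (k / u) := by
      rw [intervalIntegral.integral_const_mul, integral_ratio (by linarith) hab hk0 hcf]
      ring
    rw [e, ← integral_sub (hI hcq) ((hI hcF).const_mul _), ← intervalIntegral.integral_const_mul]
    refine abs_intervalIntegral_le_of_le hab (fun u hu => ?_) ((hI hcM).const_mul _)
    have h3 := hflog _ (hmem u hu)
    have h4 := hlu u hu
    have h5 := hlne u hu
    have hu0 : 0 < u := by linarith [hu1 u hu]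
    -- Freezing the weight at 1 / log k costs log(k/u) / (log u log k); this is the reason for the
    -- hypothesis on |f t| |log t|.
    have e2 : f (k / u) / log u - 1 / log k * f (k / u) =
        f (k / u) * log (k / u) / (log u * log k) := by
      rw [log_div hk0.ne' hu0.ne']
      field_simp
    rw [e2, abs_div, abs_mul, abs_of_pos (by nlinarith : 0 < log u * log k), one_div_mul_eq_div]
    have h6 : log a ^ 2 ≤ log u * log k := by nlinarith
    have h7 : 0 ≤ M (k / u) := (abs_nonneg _).trans (hfM _ (hmem u hu))
    gcongr
  have hM0 : ∀ u ∈ Set.Icc a b, 0 ≤ M (k / u) := fun u hu =>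
    (abs_nonneg _).trans (hfM _ (hmem u hu))
  have g5 : 0 ≤ 1 / log a ^ 2 * (a * M (k / a) + b * M (k / b)) := by
    have := hM0 a (Set.left_mem_Icc.mpr hab)
    have := hM0 b (Set.right_mem_Icc.mpr hab)
    have : 0 < b := by linarith
    positivity
  have e2 : (C + 1) / log a ^ 2 * (a * M (k / a) + b * M (k / b) + ∫ u in a..b, M (k / u)) =
      C / log a ^ 2 * (a * M (k / a) + b * M (k / b) + ∫ u in a..b, M (k / u)) +
      1 / log a ^ 2 * (a * M (k / a) + b * M (k / b)) +
      1 / log a ^ 2 * ∫ u in a..b, M (k / u) := by ring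
  rw [e2]
  have g1 := abs_le.mp key
  have g2 := abs_le.mp hdiff
  rw [abs_le]
  constructor <;> linarith [g1.1, g1.2, g2.1, g2.2]

end PrimeSumsOfRatio

/-! ### The integrals of log I₀ that make up C. -/

section MainIntegrals

open Real MeasureTheory intervalIntegral

lemma continuous_logBesselDeriv : Continuous logBesselDeriv := differentiable_logBesselDeriv.continuous

lemma hasDerivAt_log_besselIZero_two_mul (t : ℝ) :
    HasDerivAt (fun t => log (besselIZero (2 * t))) (2 * logBesselDeriv (2 * t)) t := by
  have h1 : HasDerivAt (fun t : ℝ => 2 * t) 2 t := by simpa using (hasDerivAt_id t).const_mul 2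
  have := (hasDerivAt_log_besselIZero (2 * t)).comp t h1
  exact this.congr_deriv (mul_comm _ _)

lemma integrableOn_log_besselIZero_two_mul :
    IntegrableOn (fun t => log (besselIZero (2 * t)) / t ^ 2) (Set.Ioc 0 1) := by
  refine Measure.integrableOn_of_bounded (M := 4) (by simp) ?_ ?_
  · exact ((continuous_log_besselIZero.comp (continuous_const_mul 2)).measurable.div
      (measurable_id.pow_const 2)).aestronglyMeasurable
  · refine (ae_restrict_iff' measurableSet_Ioc).mpr (Filter.Eventually.of_forall fun t ht => ?_)
    have := (abs_log_besselIZero_two_mul_le ht.1.le).1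
    have h0 := ht.1
    rw [norm_eq_abs, abs_div, abs_of_pos (by positivity : 0 < t ^ 2), div_le_iff₀ (by positivity)]
    exact this

lemma abs_sub_log_besselIZero_div_le {t : ℝ} (ht : 1 ≤ t) :
    |(2 * t - log (besselIZero (2 * t))) / t ^ 2| ≤ 5 * t ^ (-(3 / 2) : ℝ) := by
  have h := (abs_sub_log_besselIZero_le ht).1
  have h0 : 0 < t := by linarith
  have e : 5 * t ^ (-(3 / 2) : ℝ) = 5 * √t / t ^ 2 := by
    rw [sqrt_eq_rpow, mul_div_assoc, ← rpow_natCast, ← rpow_sub h0]; norm_num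
  rw [e, abs_div, abs_of_pos (by positivity : 0 < t ^ 2)]
  gcongr

lemma integrableOn_sub_log_besselIZero :
    IntegrableOn (fun t => (2 * t - log (besselIZero (2 * t))) / t ^ 2) (Set.Ioi 1) := by
  refine Integrable.mono' (((integrableOn_Ioi_rpow_of_lt (a := -(3 / 2)) (by norm_num)
    zero_lt_one)).const_mul 5) ?_ ?_
  · exact (((continuous_const_mul 2).sub
      (continuous_log_besselIZero.comp (continuous_const_mul 2))).measurable.div
      (measurable_id.pow_const 2)).aestronglyMeasurable
  · refine (ae_restrict_iff' measurableSet_Ioi).mpr (Filter.Eventually.of_forall fun t ht => ?_)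
    exact abs_sub_log_besselIZero_div_le (le_of_lt ht)

lemma integrableOn_log_besselIZero :
    IntegrableOn (fun t : ℝ => log (besselIZero t) / t ^ 2) (Set.Ioc 0 2) := by
  refine Measure.integrableOn_of_bounded (M := 4) (by simp) ?_ ?_
  · exact (continuous_log_besselIZero.measurable.div
      (measurable_id.pow_const 2)).aestronglyMeasurable
  · refine (ae_restrict_iff' measurableSet_Ioc).mpr (Filter.Eventually.of_forall fun t ht => ?_)
    have h1 := log_besselIZero_nonneg t
    have h2 := log_besselIZero_le_sq t
    have h0 := ht.1
    rw [norm_eq_abs, abs_div, abs_of_pos (by positivity : 0 < t ^ 2), div_le_iff₀ (by positivity),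
      abs_of_nonneg h1]
    nlinarith

lemma integrableOn_log_besselIZero_sub :
    IntegrableOn (fun t : ℝ => (log (besselIZero t) - t) / t ^ 2) (Set.Ioi 2) := by
  have h := (integrableOn_Ioi_comp_mul_left_iff
    (fun t : ℝ => (log (besselIZero t) - t) / t ^ 2) 1 (a := 2) (by norm_num)).mp (by
      refine IntegrableOn.congr_fun (f := fun t =>
        -1 / 4 * ((2 * t - log (besselIZero (2 * t))) / t ^ 2))
        (integrableOn_sub_log_besselIZero.const_mul (-1 / 4)) (fun t ht => ?_) measurableSet_Ioi
      have : t ≠ 0 := by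
        have : 1 < t := ht
        linarith
      simp only
      field_simp
      ring)
  simpa using h

/-- The substitution t ↦ 2t. The arguments 2k/p of I₀ lead to this form, and the factor 2 becomes
the one in 2k / log k. -/
lemma two_mul_momentConstant :
    2 * momentConstant = (∫ t in Set.Ioc (0 : ℝ) 1, log (besselIZero (2 * t)) / t ^ 2) -
      ∫ t in Set.Ioi (1 : ℝ), (2 * t - log (besselIZero (2 * t))) / t ^ 2 := by
  have h1 : ∫ t in Set.Ioc (0 : ℝ) 1, log (besselIZero (2 * t)) / t ^ 2 =
      2 * ∫ t in Set.Ioc (0 : ℝ) 2, log (besselIZero t) / t ^ 2 := by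
    rw [← integral_of_le (by norm_num), ← integral_of_le (by norm_num)]
    have := intervalIntegral.integral_comp_mul_left (a := 0) (b := 1)
      (fun t : ℝ => log (besselIZero t) / t ^ 2) (c := 2) (by norm_num)
    rw [mul_zero, mul_one, smul_eq_mul] at this
    have e : ∫ t in (0 : ℝ)..1, log (besselIZero (2 * t)) / t ^ 2 =
        4 * ∫ t in (0 : ℝ)..1, log (besselIZero (2 * t)) / (2 * t) ^ 2 := by
      rw [← intervalIntegral.integral_const_mul]
      congr 1; ext t
      rw [mul_pow, ← mul_div_assoc, show (2 : ℝ) ^ 2 = 4 by norm_num,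
        mul_div_mul_left _ _ (by norm_num)]
    rw [e, this]; ring
  have h2 : ∫ t in Set.Ioi (1 : ℝ), (2 * t - log (besselIZero (2 * t))) / t ^ 2 =
      -(2 * ∫ t in Set.Ioi (2 : ℝ), (log (besselIZero t) - t) / t ^ 2) := by
    have := integral_comp_mul_left_Ioi
      (fun t : ℝ => (log (besselIZero t) - t) / t ^ 2) 1 (b := 2) (by norm_num)
    rw [mul_one, smul_eq_mul] at this
    have e : ∫ t in Set.Ioi (1 : ℝ), (2 * t - log (besselIZero (2 * t))) / t ^ 2 =
        -4 * ∫ t in Set.Ioi (1 : ℝ), (log (besselIZero (2 * t)) - 2 * t) / (2 * t) ^ 2 := by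
      rw [← MeasureTheory.integral_const_mul]
      congr 1; ext t
      rw [mul_pow, ← mul_div_assoc, show (2 : ℝ) ^ 2 = 4 by norm_num, neg_mul, ← mul_neg,
        mul_div_mul_left _ _ (by norm_num), neg_sub]
    rw [e, this]; ring
  rw [h1, h2, momentConstant]; ring

lemma abs_log_le_rpow {t : ℝ} (ht : 1 ≤ t) {r : ℝ} (hr : 0 < r) : |log t| ≤ t ^ r / r := by
  rw [abs_of_nonneg (log_nonneg ht)]
  exact log_le_rpow_div (by linarith) hr

/-- The contribution of the primes between `√k` and `k`. -/
lemma exists_abs_sum_small_primes_sub_le :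
    ∃ C > 0, ∀ k : ℕ, 2 ≤ k →
      |∑ p ∈ (Finset.Ioc ⌊√(k : ℝ)⌋₊ k).filter Nat.Prime,
          (2 * ((k : ℝ) / p) - log (besselIZero (2 * ((k : ℝ) / p)))) -
        k / log k * ∫ t in Set.Ioi (1 : ℝ), (2 * t - log (besselIZero (2 * t))) / t ^ 2| ≤
        C * (k / log k ^ 2) := by
  obtain ⟨C, hC, h⟩ := exists_abs_sum_ratio_sub_le
  refine ⟨480 * C + 40, by linarith, fun k hk => ?_⟩
  have hk2 : (2 : ℝ) ≤ k := by exact_mod_cast hk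
  have hk0 : (0 : ℝ) < k := by linarith
  have hlk : 0 < log k := log_pos (by linarith)
  have hs0 : 0 < √(k : ℝ) := sqrt_pos.mpr hk0
  have hs1 : 1 ≤ √(k : ℝ) := by rw [one_le_sqrt]; linarith
  have hss : √(k : ℝ) * √k = k := mul_self_sqrt hk0.le
  have hsk : √(k : ℝ) ≤ k := by nlinarith
  have hdiv : (k : ℝ) / √k = √k := div_sqrt
  have hkk : (k : ℝ) / k = 1 := div_self hk0.ne'
  -- The exponent 3/4 is 1/2, from the size of 2t - log I₀(2t), plus 1/4, which pays for the
  -- logarithm.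
  have key := h (fun t => 2 * t - log (besselIZero (2 * t)))
    (fun t => 2 - 2 * logBesselDeriv (2 * t)) (fun t => 20 * t ^ (3 / 4 : ℝ)) (√k) k k
    (sqrt_le_sqrt hk2) hsk hsk
  rw [hdiv, hkk] at key
  have hsqrt : ∀ t : ℝ, 1 ≤ t → √t ≤ t ^ (3 / 4 : ℝ) := fun t ht => by
    rw [sqrt_eq_rpow]; exact rpow_le_rpow_of_exponent_le ht (by norm_num)
  have key := key
    (fun t _ => by
      have h1 : HasDerivAt (fun t : ℝ => 2 * t) 2 t := by simpa using (hasDerivAt_id t).const_mul 2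
      exact h1.sub (hasDerivAt_log_besselIZero_two_mul t))
    ((continuous_const.sub (continuous_const.mul (continuous_logBesselDeriv.comp
      (continuous_const_mul 2)))).continuousOn)
    (continuousOn_const.mul (continuousOn_id.rpow_const fun t _ => Or.inr (by norm_num)))
    (fun t ht => by
      have := hsqrt t ht.1
      have h2 := (abs_sub_log_besselIZero_le ht.1).1
      have : 0 ≤ √t := sqrt_nonneg t
      linarith)
    (fun t ht => by
      have := hsqrt t ht.1
      have h2 := (abs_sub_log_besselIZero_le ht.1).2
      have : 0 ≤ √t := sqrt_nonneg t
      linarith)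
    (fun t ht => by
      have h2 := (abs_sub_log_besselIZero_le ht.1).1
      have h3 := abs_log_le_rpow ht.1 (r := 1 / 4) (by norm_num)
      have ht0 : 0 < t := by linarith [ht.1]
      calc _ ≤ 5 * √t * (t ^ (1 / 4 : ℝ) / (1 / 4)) := by gcongr
        _ = 20 * (√t * t ^ (1 / 4 : ℝ)) := by ring
        _ = 20 * t ^ (3 / 4 : ℝ) := by
          rw [sqrt_eq_rpow, ← rpow_add ht0]; norm_num)
  rw [Nat.floor_natCast, log_sqrt hk0.le, one_rpow, intervalIntegral.integral_const_mul] at key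
  have hint := integral_ratio_rpow_le hs0 hsk
  have hs34 : √(k : ℝ) ^ (3 / 4 : ℝ) ≤ √k := by
    calc _ ≤ √(k : ℝ) ^ (1 : ℝ) := rpow_le_rpow_of_exponent_le hs1 (by norm_num)
      _ = √k := rpow_one _
  have herr : C / (log k / 2) ^ 2 * (√k * (20 * √k ^ (3 / 4 : ℝ)) + k * (20 * 1) +
      20 * ∫ u in √(k : ℝ)..k, (k / u) ^ (3 / 4 : ℝ)) ≤ 480 * C * (k / log k ^ 2) := by
    have : √k * (20 * √k ^ (3 / 4 : ℝ)) + k * (20 * 1) +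
        20 * ∫ u in √(k : ℝ)..k, (k / u) ^ (3 / 4 : ℝ) ≤ 120 * k := by nlinarith
    calc _ ≤ C / (log k / 2) ^ 2 * (120 * k) := by gcongr
      _ = _ := by field_simp; ring
  -- Completing the integral beyond t = √k costs O(k^{-1/4}), hence O(1 / log k).
  have htail : |∫ t in Set.Ioi √(k : ℝ), (2 * t - log (besselIZero (2 * t))) / t ^ 2| ≤
      40 / log k := by
    have hint2 := integrableOn_Ioi_rpow_of_lt (a := -(3 / 2)) (by norm_num) hs0
    have h1 : |∫ t in Set.Ioi √(k : ℝ), (2 * t - log (besselIZero (2 * t))) / t ^ 2| ≤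
        ∫ t in Set.Ioi √(k : ℝ), 5 * t ^ (-(3 / 2) : ℝ) := by
      refine MeasureTheory.norm_integral_le_of_norm_le
        (f := fun t => (2 * t - log (besselIZero (2 * t))) / t ^ 2) (hint2.const_mul 5)
        ((ae_restrict_iff' measurableSet_Ioi).mpr (Filter.Eventually.of_forall fun t ht => ?_))
      exact abs_sub_log_besselIZero_div_le (hs1.trans (le_of_lt ht))
    rw [MeasureTheory.integral_const_mul, integral_Ioi_rpow_of_lt (by norm_num) hs0] at h1
    refine h1.trans ?_
    have h2 : √(k : ℝ) ^ (-(3 / 2) + 1 : ℝ) = (k : ℝ) ^ (-(1 / 4) : ℝ) := by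
      rw [sqrt_eq_rpow, ← rpow_mul hk0.le]; norm_num
    rw [h2, le_div_iff₀ hlk]
    have h3 := log_le_rpow_div hk0.le (ε := 1 / 4) (by norm_num)
    have h4 : (k : ℝ) ^ (-(1 / 4) : ℝ) * (k : ℝ) ^ (1 / 4 : ℝ) = 1 := by
      rw [← rpow_add hk0]; norm_num
    have h5 : 0 < (k : ℝ) ^ (-(1 / 4) : ℝ) := rpow_pos_of_pos hk0 _
    norm_num at h3 h4 h5 ⊢
    nlinarith
  have hsplit : ∫ t in Set.Ioi (1 : ℝ), (2 * t - log (besselIZero (2 * t))) / t ^ 2 =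
      (∫ t in (1 : ℝ)..√k, (2 * t - log (besselIZero (2 * t))) / t ^ 2) +
      ∫ t in Set.Ioi √(k : ℝ), (2 * t - log (besselIZero (2 * t))) / t ^ 2 :=
    (integral_interval_add_Ioi integrableOn_sub_log_besselIZero
      (integrableOn_sub_log_besselIZero.mono_set (Set.Ioi_subset_Ioi hs1))).symm
  rw [hsplit, mul_add]
  have htail2 : |k / log k * ∫ t in Set.Ioi √(k : ℝ), (2 * t - log (besselIZero (2 * t))) / t ^ 2| ≤
      40 * (k / log k ^ 2) := by
    rw [abs_mul, abs_of_pos (by positivity)]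
    calc _ ≤ k / log k * (40 / log k) := by gcongr
      _ = _ := by ring
  have g1 := abs_le.mp (key.trans herr)
  have g2 := abs_le.mp htail2
  rw [add_mul, abs_le]
  constructor <;> linarith [g1.1, g1.2, g2.1, g2.2]

/-- The contribution of the primes between `k` and `y`. -/
lemma exists_abs_sum_large_primes_sub_le :
    ∃ C > 0, ∀ (k : ℕ) (y : ℝ), 2 ≤ k → (k : ℝ) ≤ y →
      |∑ p ∈ (Finset.Ioc k ⌊y⌋₊).filter Nat.Prime, log (besselIZero (2 * ((k : ℝ) / p))) -
        k / log k * ∫ t in Set.Ioc (0 : ℝ) 1, log (besselIZero (2 * t)) / t ^ 2| ≤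
        C * (k / log k * (k / y + 1 / log k)) := by
  obtain ⟨C, hC, h⟩ := exists_abs_sum_ratio_sub_le
  refine ⟨32 * C + 4, by linarith, fun k y hk hky => ?_⟩
  have hk2 : (2 : ℝ) ≤ k := by exact_mod_cast hk
  have hk0 : (0 : ℝ) < k := by linarith
  have hy0 : 0 < y := by linarith
  have hlk : 0 < log k := log_pos (by linarith)
  have hkk : (k : ℝ) / k = 1 := div_self hk0.ne'
  have hky0 : 0 < k / y := by positivity
  have hky1 : k / y ≤ 1 := by rwa [div_le_one hy0]
  have hs2 : √2 ≤ k := by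
    refine le_trans ?_ hk2
    rw [sqrt_le_left (by norm_num)]; norm_num
  -- Near 0 the function is O(t²); half a power is given up to absorb the logarithm.
  have key := h (fun t => log (besselIZero (2 * t)))
    (fun t => 2 * logBesselDeriv (2 * t)) (fun t => 8 * t ^ (3 / 2 : ℝ)) k y k hs2 hky le_rfl
  rw [hkk] at key
  have hsq : ∀ t : ℝ, 0 < t → t ≤ 1 → t ^ 2 ≤ t ^ (3 / 2 : ℝ) := fun t ht ht1 => by
    rw [← rpow_natCast]
    exact rpow_le_rpow_of_exponent_ge ht ht1 (by norm_num)
  have key := key (fun t _ => hasDerivAt_log_besselIZero_two_mul t)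
    ((continuous_const.mul (continuous_logBesselDeriv.comp (continuous_const_mul 2))).continuousOn)
    (continuousOn_const.mul (continuousOn_id.rpow_const fun t _ => Or.inr (by norm_num)))
    (fun t ht => by
      have ht0 : 0 < t := lt_of_lt_of_le hky0 ht.1
      have := hsq t ht0 ht.2
      have h2 := (abs_log_besselIZero_two_mul_le ht0.le).1
      have : 0 ≤ t ^ 2 := sq_nonneg t
      linarith)
    (fun t ht => by
      have ht0 : 0 < t := lt_of_lt_of_le hky0 ht.1
      have := hsq t ht0 ht.2
      have h2 := (abs_log_besselIZero_two_mul_le ht0.le).2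
      have : 0 ≤ t ^ 2 := sq_nonneg t
      linarith)
    (fun t ht => by
      have ht0 : 0 < t := lt_of_lt_of_le hky0 ht.1
      have h2 := (abs_log_besselIZero_two_mul_le ht0.le).1
      have h3 := abs_log_le_rpow (t := t⁻¹) ((one_le_inv₀ ht0).mpr ht.2) (r := 1 / 2) (by norm_num)
      rw [log_inv, abs_neg, inv_rpow ht0.le, ← rpow_neg ht0.le] at h3
      calc _ ≤ 4 * t ^ 2 * (t ^ (-(1 / 2) : ℝ) / (1 / 2)) := by gcongr
        _ = 8 * (t ^ 2 * t ^ (-(1 / 2) : ℝ)) := by ring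
        _ = 8 * t ^ (3 / 2 : ℝ) := by
          rw [← rpow_natCast, ← rpow_add ht0]; norm_num)
  rw [Nat.floor_natCast, one_rpow, intervalIntegral.integral_const_mul] at key
  have hint := integral_ratio_rpow_le' hk0 hky
  have hk32 : y * (k / y) ^ (3 / 2 : ℝ) ≤ k := by
    calc y * (k / y) ^ (3 / 2 : ℝ) ≤ y * (k / y) ^ (1 : ℝ) := by
          gcongr y * ?_
          exact rpow_le_rpow_of_exponent_ge hky0 hky1 (by norm_num)
      _ = k := by rw [rpow_one]; field_simp
  have herr : C / log k ^ 2 * (k * (8 * 1) + y * (8 * (k / y) ^ (3 / 2 : ℝ)) +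
      8 * ∫ u in (k : ℝ)..y, (k / u) ^ (3 / 2 : ℝ)) ≤ 32 * C * (k / log k * (1 / log k)) := by
    have : k * (8 * 1) + y * (8 * (k / y) ^ (3 / 2 : ℝ)) +
        8 * ∫ u in (k : ℝ)..y, (k / u) ^ (3 / 2 : ℝ) ≤ 32 * k := by nlinarith
    calc _ ≤ C / log k ^ 2 * (32 * k) := by gcongr
      _ = _ := by field_simp
  have hii : ∀ a b : ℝ, 0 ≤ a → a ≤ b → b ≤ 1 →
      IntervalIntegrable (fun t => log (besselIZero (2 * t)) / t ^ 2) volume a b :=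
    fun a b ha hab hb => (intervalIntegrable_iff_integrableOn_Ioc_of_le hab).mpr
      (integrableOn_log_besselIZero_two_mul.mono_set (Set.Ioc_subset_Ioc ha hb))
  have hsplit : ∫ t in Set.Ioc (0 : ℝ) 1, log (besselIZero (2 * t)) / t ^ 2 =
      (∫ t in (0 : ℝ)..(k / y), log (besselIZero (2 * t)) / t ^ 2) +
      ∫ t in (k / y)..1, log (besselIZero (2 * t)) / t ^ 2 := by
    rw [← integral_of_le zero_le_one, integral_add_adjacent_intervals
      (hii _ _ le_rfl hky0.le hky1) (hii _ _ hky0.le hky1 le_rfl)]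
  -- The primes stop at y, so the range t < k/y is missing from the integral; this is the source of
  -- the error term k/y.
  have htail : |∫ t in (0 : ℝ)..(k / y), log (besselIZero (2 * t)) / t ^ 2| ≤ 4 * (k / y) := by
    have := norm_integral_le_of_norm_le_const (a := (0 : ℝ)) (b := k / y) (C := 4)
      (f := fun t => log (besselIZero (2 * t)) / t ^ 2) (fun t ht => by
        rw [Set.uIoc_of_le hky0.le] at ht
        have h0 := ht.1
        rw [norm_eq_abs, abs_div, abs_of_pos (by positivity : 0 < t ^ 2),
          div_le_iff₀ (by positivity)]
        exact (abs_log_besselIZero_two_mul_le h0.le).1)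
    rwa [sub_zero, abs_of_pos hky0] at this
  have htail2 : |k / log k * ∫ t in (0 : ℝ)..(k / y), log (besselIZero (2 * t)) / t ^ 2| ≤
      4 * (k / log k * (k / y)) := by
    rw [abs_mul, abs_of_pos (by positivity)]
    calc _ ≤ k / log k * (4 * (k / y)) := by gcongr
      _ = _ := by ring
  rw [hsplit, mul_add]
  have g1 := abs_le.mp (key.trans herr)
  have g2 := abs_le.mp htail2
  have g3 : 0 ≤ 32 * C * (k / log k * (k / y)) := by positivity
  have g4 : 0 ≤ 4 * (k / log k * (1 / log k)) := by positivity
  have e : (32 * C + 4) * (k / log k * (k / y + 1 / log k)) =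
    32 * C * (k / log k * (k / y)) + 32 * C * (k / log k * (1 / log k)) +
    4 * (k / log k * (k / y)) + 4 * (k / log k * (1 / log k)) := by ring
  rw [e, abs_le]
  constructor <;> linarith [g1.1, g1.2, g2.1, g2.2]

end MainIntegrals

/-! ### The asymptotic formula for the Dirichlet sum. -/

section SmoothSumAsymptotics

open Real

/-- The product of the maxima of the local factors over `p ≤ k`. -/
noncomputable def maxProduct (δ : ℤ) (k : ℕ) : ℝ :=
  ∏ p ∈ Nat.primesBelow (k + 1), (1 - (δ : ℝ) / p) ^ (-(2 * (k : ℤ) * δ))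

lemma primesBelow_succ_eq (n : ℕ) :
    Nat.primesBelow (n + 1) = (Finset.Ioc 0 n).filter Nat.Prime := by
  ext p
  rw [Nat.mem_primesBelow, Finset.mem_filter, Finset.mem_Ioc]
  exact ⟨fun h => ⟨⟨h.2.pos, by omega⟩, h.2⟩, fun h => ⟨by omega, h.2⟩⟩

lemma sum_primes_consecutive (f : ℕ → ℝ) {l m n : ℕ} (hlm : l ≤ m) (hmn : m ≤ n) :
    ∑ p ∈ (Finset.Ioc l n).filter Nat.Prime, f p =
      ∑ p ∈ (Finset.Ioc l m).filter Nat.Prime, f p +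
        ∑ p ∈ (Finset.Ioc m n).filter Nat.Prime, f p := by
  simp only [Finset.sum_filter]
  exact (Finset.sum_Ioc_consecutive _ hlm hmn).symm

lemma one_div_prime_mem {p : ℕ} (hp : p.Prime) : 0 ≤ 1 / (p : ℝ) ∧ 1 / (p : ℝ) ≤ 1 / 2 := by
  have : (2 : ℝ) ≤ p := by exact_mod_cast hp.two_le
  exact ⟨by positivity, one_div_le_one_div_of_le (by norm_num) this⟩

lemma maxProduct_eq (δ : ℤ) (k : ℕ) :
    maxProduct δ k = ∏ p ∈ Nat.primesBelow (k + 1), localMax δ k (1 / p) := by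
  refine Finset.prod_congr rfl fun p _ => ?_
  rw [localMax, mul_one_div]

lemma maxProduct_pos {δ : ℤ} (hδ : δ = 1 ∨ δ = -1) (k : ℕ) : 0 < maxProduct δ k := by
  rw [maxProduct_eq]
  refine Finset.prod_pos fun p hp => ?_
  have := one_div_prime_mem (Nat.prime_of_mem_primesBelow hp)
  exact localMax_pos hδ k this.1 (by linarith [this.2])

lemma smoothDivisorSum_pos {δ : ℤ} (hδ : δ = 1 ∨ δ = -1) (k : ℕ) (y : ℝ) :
    0 < smoothDivisorSum ((δ : ℝ) * k) y := by
  rw [(summable_and_smoothDivisorSum_eq_prod hδ k y).2]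
  refine Finset.prod_pos fun p hp => ?_
  have := one_div_prime_mem (Nat.prime_of_mem_primesBelow hp)
  exact localSum_pos hδ k this.1 (by linarith [this.2])

lemma log_smoothDivisorSum {δ : ℤ} (hδ : δ = 1 ∨ δ = -1) (k : ℕ) (y : ℝ) :
    log (smoothDivisorSum ((δ : ℝ) * k) y) =
      ∑ p ∈ (Finset.Ioc 0 ⌊y⌋₊).filter Nat.Prime, log (localSum ((δ : ℝ) * k) (1 / p)) := by
  rw [(summable_and_smoothDivisorSum_eq_prod hδ k y).2, ← primesBelow_succ_eq]
  refine log_prod fun p hp => ?_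
  have := one_div_prime_mem (Nat.prime_of_mem_primesBelow hp)
  exact (localSum_pos hδ k this.1 (by linarith [this.2])).ne'

lemma log_maxProduct {δ : ℤ} (hδ : δ = 1 ∨ δ = -1) (k : ℕ) :
    log (maxProduct δ k) =
      ∑ p ∈ (Finset.Ioc 0 k).filter Nat.Prime, log (localMax δ k (1 / p)) := by
  rw [maxProduct_eq, ← primesBelow_succ_eq]
  refine log_prod fun p hp => ?_
  have := one_div_prime_mem (Nat.prime_of_mem_primesBelow hp)
  exact (localMax_pos hδ k this.1 (by linarith [this.2])).ne'

lemma sum_primes_div_sq_le (k : ℕ) {m n : ℕ} (hm : m ≠ 0) (hmn : m ≤ n) :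
    ∑ p ∈ (Finset.Ioc m n).filter Nat.Prime, (k : ℝ) * (1 / (p : ℝ)) ^ 2 ≤ (k : ℝ) / m := by
  have h1 : ∑ p ∈ (Finset.Ioc m n).filter Nat.Prime, ((p : ℝ) ^ 2)⁻¹ ≤
      ∑ p ∈ Finset.Ioc m n, ((p : ℝ) ^ 2)⁻¹ :=
    Finset.sum_le_sum_of_subset_of_nonneg (Finset.filter_subset _ _) fun _ _ _ => by positivity
  have h2 := sum_Ioc_inv_sq_le_sub (α := ℝ) hm hmn
  have h3 : (0 : ℝ) ≤ (n : ℝ)⁻¹ := by positivity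
  rw [← Finset.mul_sum, div_eq_mul_inv]
  simp only [one_div, inv_pow]
  gcongr
  linarith

/-- Mean and maximum differ by at most 36√(1 + k/p), a power of k. This is used for p ≤ √k, where
the approximation error O(k/p²) would be too large. -/
lemma abs_log_localSum_sub_log_localMax_le {δ : ℤ} (hδ : δ = 1 ∨ δ = -1) {k : ℕ} (hk : 2 ≤ k)
    {p : ℕ} (hp : p.Prime) :
    |log (localSum ((δ : ℝ) * k) (1 / p)) - log (localMax δ k (1 / p))| ≤ 7 * log k := by
  obtain ⟨h0, h2⟩ := one_div_prime_mem hp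
  have hk2 : (2 : ℝ) ≤ k := by exact_mod_cast hk
  have hQ := localMax_pos hδ k h0 (by linarith)
  have hD := localSum_pos hδ k h0 (by linarith)
  have h3 := log_le_log hD (localSum_le_localMax hδ k h0 (by linarith))
  have hs : 0 < √(1 + k * (1 / (p : ℝ))) := sqrt_pos.mpr (by positivity)
  have h4 := log_le_log (by positivity) (localMax_div_le_localSum hδ k h0 h2)
  rw [log_div hQ.ne' (by positivity), log_mul (by norm_num) hs.ne', log_sqrt (by positivity)] at h4
  have hl2 := log_two_gt_d9
  have h5 : log (1 + k * (1 / (p : ℝ))) ≤ 2 * log k := by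
    rw [show 2 * log (k : ℝ) = ((2 : ℕ) : ℝ) * log k by norm_num, ← log_pow]
    exact log_le_log (by positivity) (by nlinarith)
  have h6 : log 36 ≤ 6 * log k := by
    have : 6 * log (2 : ℝ) ≤ 6 * log k := by
      have := log_le_log (by norm_num) hk2; linarith
    refine le_trans ?_ this
    rw [show 6 * log (2 : ℝ) = ((6 : ℕ) : ℝ) * log 2 by norm_num, ← log_pow]
    exact log_le_log (by norm_num) (by norm_num)
  rw [abs_le]
  have hlk : 0 ≤ log (k : ℝ) := log_nonneg (by linarith)
  constructor <;> linarith

/-- The asymptotic formula for the smooth divisor sum. -/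
lemma exists_abs_log_smoothDivisorSum_sub_le :
    ∃ A > 0, ∀ (k : ℕ) (y : ℝ) (δ : ℤ), (δ = 1 ∨ δ = -1) → 2 ≤ k → (k : ℝ) ≤ y →
      |log (smoothDivisorSum ((δ : ℝ) * k) y) - log (maxProduct δ k) -
        2 * k / log k * momentConstant| ≤ A * (k / log k * (k / y + 1 / log k)) := by
  obtain ⟨C₁, hC₁, h₁⟩ := exists_abs_sum_small_primes_sub_le
  obtain ⟨C₂, hC₂, h₂⟩ := exists_abs_sum_large_primes_sub_le
  refine ⟨C₁ + C₂ + 1512 + 128 + 32, by linarith, fun k y δ hδ hk hky => ?_⟩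
  have hk2 : (2 : ℝ) ≤ k := by exact_mod_cast hk
  have hk0 : (0 : ℝ) < k := by linarith
  have hy0 : 0 < y := by linarith
  have hlk : 0 < log (k : ℝ) := log_pos (by linarith)
  have hs1 : 1 ≤ √(k : ℝ) := by rw [one_le_sqrt]; linarith
  have hss : √(k : ℝ) * √k = k := mul_self_sqrt hk0.le
  set m := ⌊√(k : ℝ)⌋₊ with hm
  set N := ⌊y⌋₊ with hN
  have hm1 : 1 ≤ m := (Nat.one_le_floor_iff _).mpr hs1
  have hmk : m ≤ k := by
    exact Nat.floor_le_of_le (by nlinarith)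
  have hkN : k ≤ N := by rw [hN, Nat.le_floor_iff hy0.le]; exact hky
  have hms : (m : ℝ) ≤ √k := Nat.floor_le (by positivity)
  have hms2 : √(k : ℝ) ≤ 2 * m := by
    have h1 := Nat.lt_floor_add_one √(k : ℝ)
    have h2 : (1 : ℝ) ≤ m := by exact_mod_cast hm1
    rw [← hm] at h1; linarith
  have hl2 : log (k : ℝ) ^ 2 ≤ 16 * √k := by
    have h1 := log_le_rpow_div hk0.le (ε := 1 / 4) (by norm_num)
    have h2 : ((k : ℝ) ^ (1 / 4 : ℝ)) ^ 2 = √k := by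
      rw [← rpow_natCast, ← rpow_mul hk0.le, sqrt_eq_rpow]; norm_num
    rw [← h2]
    calc log (k : ℝ) ^ 2 ≤ ((k : ℝ) ^ (1 / 4 : ℝ) / (1 / 4)) ^ 2 := pow_le_pow_left₀ hlk.le h1 2
      _ = _ := by ring
  have hl3 : log (k : ℝ) ^ 3 ≤ 216 * √k := by
    have h1 := log_le_rpow_div hk0.le (ε := 1 / 6) (by norm_num)
    have h2 : ((k : ℝ) ^ (1 / 6 : ℝ)) ^ 3 = √k := by
      rw [← rpow_natCast, ← rpow_mul hk0.le, sqrt_eq_rpow]; norm_num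
    rw [← h2]
    calc log (k : ℝ) ^ 3 ≤ ((k : ℝ) ^ (1 / 6 : ℝ) / (1 / 6)) ^ 3 := pow_le_pow_left₀ hlk.le h1 3
      _ = _ := by ring
  set E := (k : ℝ) / log k ^ 2 with hE
  have hE0 : 0 < E := by positivity
  set d : ℕ → ℝ := fun p => log (localSum ((δ : ℝ) * k) (1 / p)) with hd
  set q : ℕ → ℝ := fun p => log (localMax δ k (1 / p)) with hq
  set f : ℕ → ℝ := fun p => log (besselIZero (2 * ((k : ℝ) / p))) with hf
  have hdec : log (smoothDivisorSum ((δ : ℝ) * k) y) - log (maxProduct δ k) =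
      ∑ p ∈ (Finset.Ioc 0 m).filter Nat.Prime, (d p - q p) +
      ∑ p ∈ (Finset.Ioc m k).filter Nat.Prime, (d p - q p) +
      ∑ p ∈ (Finset.Ioc k N).filter Nat.Prime, d p := by
    rw [log_smoothDivisorSum hδ, log_maxProduct hδ, sum_primes_consecutive _ (Nat.zero_le m)
      (hmk.trans hkN), sum_primes_consecutive _ hmk hkN, sum_primes_consecutive _ (Nat.zero_le m)
      hmk, Finset.sum_sub_distrib, Finset.sum_sub_distrib]
    ring
  -- At most √k primes, each contributing O(log k).
  have s1 : |∑ p ∈ (Finset.Ioc 0 m).filter Nat.Prime, (d p - q p)| ≤ 1512 * E := by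
    calc _ ≤ ∑ p ∈ (Finset.Ioc 0 m).filter Nat.Prime, |d p - q p| := Finset.abs_sum_le_sum_abs _ _
      _ ≤ ∑ p ∈ (Finset.Ioc 0 m).filter Nat.Prime, 7 * log k :=
        Finset.sum_le_sum fun p hp =>
          abs_log_localSum_sub_log_localMax_le hδ hk (Finset.mem_filter.mp hp).2
      _ ≤ ∑ p ∈ Finset.Ioc 0 m, 7 * log k :=
        Finset.sum_le_sum_of_subset_of_nonneg (Finset.filter_subset _ _) fun _ _ _ => by positivity
      _ = m * (7 * log k) := by simp
      _ ≤ √k * (7 * log k) := by gcongr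
      _ ≤ 1512 * E := by
        rw [hE, mul_div_assoc', le_div_iff₀ (by positivity)]
        calc √k * (7 * log k) * log k ^ 2 = 7 * √k * log k ^ 3 := by ring
          _ ≤ 7 * √k * (216 * √k) := by gcongr
          _ = 1512 * (√k * √k) := by ring
          _ = _ := by rw [hss]
  -- The mean is replaced by I₀(2k/p) and the maximum by e^{2k/p}; the errors O(k/p²) sum to O(√k)
  -- over p > √k.
  have s2 : |∑ p ∈ (Finset.Ioc m k).filter Nat.Prime, (d p - q p) +
      ∑ p ∈ (Finset.Ioc m k).filter Nat.Prime, (2 * ((k : ℝ) / p) - f p)| ≤ 128 * E := by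
    rw [← Finset.sum_add_distrib]
    calc _ ≤ ∑ p ∈ (Finset.Ioc m k).filter Nat.Prime, |d p - q p + (2 * ((k : ℝ) / p) - f p)| :=
          Finset.abs_sum_le_sum_abs _ _
      _ ≤ ∑ p ∈ (Finset.Ioc m k).filter Nat.Prime, 4 * ((k : ℝ) * (1 / (p : ℝ)) ^ 2) := by
          refine Finset.sum_le_sum fun p hp => ?_
          obtain ⟨h0, h2⟩ := one_div_prime_mem (Finset.mem_filter.mp hp).2
          have g1 := abs_le.mp (abs_log_localSum_sub_le hδ k h0 h2)
          have g2 := abs_le.mp (abs_log_localMax_sub_le hδ k h0 h2)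
          have e : (k : ℝ) * (1 / (p : ℝ)) = k / p := by ring
          rw [e] at g1
          have e2 : 2 * (k : ℝ) * (1 / (p : ℝ)) = 2 * (k / p) := by ring
          rw [e2] at g2
          simp only [hd, hq, hf]
          rw [abs_le]
          constructor <;> linarith [g1.1, g1.2, g2.1, g2.2]
      _ = 4 * ∑ p ∈ (Finset.Ioc m k).filter Nat.Prime, (k : ℝ) * (1 / (p : ℝ)) ^ 2 := by
          rw [Finset.mul_sum]
      _ ≤ 4 * (k / m) := by
          gcongr
          exact sum_primes_div_sq_le k (by omega) hmk
      _ ≤ 8 * √k := by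
          have : (1 : ℝ) ≤ m := by exact_mod_cast hm1
          have h3 : (k : ℝ) / m ≤ 2 * √k := by
            rw [div_le_iff₀ (by linarith)]; nlinarith
          linarith
      _ ≤ 128 * E := by
          rw [hE, mul_div_assoc', le_div_iff₀ (by positivity)]
          nlinarith
  -- No maximum is factored out beyond k, and the errors O(k/p²) sum to O(1).
  have s3 : |∑ p ∈ (Finset.Ioc k N).filter Nat.Prime, d p -
      ∑ p ∈ (Finset.Ioc k N).filter Nat.Prime, f p| ≤ 8 * (4 * E) := by
    rw [← Finset.sum_sub_distrib]
    calc _ ≤ ∑ p ∈ (Finset.Ioc k N).filter Nat.Prime, |d p - f p| :=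
          Finset.abs_sum_le_sum_abs _ _
      _ ≤ ∑ p ∈ (Finset.Ioc k N).filter Nat.Prime, 2 * ((k : ℝ) * (1 / (p : ℝ)) ^ 2) := by
          refine Finset.sum_le_sum fun p hp => ?_
          obtain ⟨h0, h2⟩ := one_div_prime_mem (Finset.mem_filter.mp hp).2
          have g1 := abs_log_localSum_sub_le hδ k h0 h2
          have e : (k : ℝ) * (1 / (p : ℝ)) = k / p := by ring
          rw [e] at g1
          simp only [hd, hf]
          linarith
      _ = 2 * ∑ p ∈ (Finset.Ioc k N).filter Nat.Prime, (k : ℝ) * (1 / (p : ℝ)) ^ 2 := by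
          rw [Finset.mul_sum]
      _ ≤ 2 * (k / k) := by
          gcongr
          exact sum_primes_div_sq_le k (by omega) hkN
      _ = 2 := by rw [div_self hk0.ne', mul_one]
      _ ≤ 8 * (4 * E) := by
          rw [hE, ← mul_assoc, mul_div_assoc', le_div_iff₀ (by positivity)]
          nlinarith
  have s4 := h₁ k hk
  have s5 := h₂ k y hk hky
  rw [← hm] at s4
  have hEle : E ≤ k / log k * (k / y + 1 / log k) := by
    have e : E = k / log k * (0 + 1 / log k) := by rw [hE]; field_simp; ring
    rw [e]
    gcongr
    positivity
  have hC : 2 * k / log k * momentConstant = k / log k * (2 * momentConstant) := by ring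
  rw [hdec, hC, two_mul_momentConstant, mul_sub]
  set R := k / log k * (k / y + 1 / log k)
  have t1 : C₁ * E ≤ C₁ * R := by gcongr
  have g1 := abs_le.mp s1
  have g2 := abs_le.mp s2
  have g3 := abs_le.mp s3
  have g4 := abs_le.mp (s4.trans t1)
  have g5 := abs_le.mp s5
  rw [abs_le]
  constructor <;> linarith [g1.1, g1.2, g2.1, g2.2, g3.1, g3.2, g4.1, g4.2, g5.1, g5.2]

end SmoothSumAsymptotics

/-! ### Calculus of series of terms c (m/n)^{it} and their mean values. -/

section TrigSeries

open Complex MeasureTheory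
open scoped ENNReal

/-- `g` is the sum of an absolutely convergent series `∑ cᵢ (mᵢ/nᵢ)^{it}`, where `mᵢ/nᵢ` is a reduced
fraction built from the primes in `B` with `mᵢ nᵢ ≤ X`; `M` is its constant term, and
`∑ |cᵢ| (mᵢ nᵢ)^α ≤ S`. -/
def TrigSeries (B : Set ℕ) (α : ℝ) (X : ℝ≥0∞) (M S : ℝ) (g : ℝ → ℂ) : Prop :=
  ∃ (ι : Type) (_ : Countable ι) (c : ι → ℝ) (m n : ι → ℕ),
    (∀ i, m i * n i ≠ 0 ∧ (m i).Coprime (n i) ∧ (∀ p ∈ (m i * n i).primeFactors, p ∈ B) ∧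
      ((m i * n i : ℕ) : ℝ≥0∞) ≤ X) ∧
    (∃ S' ≤ S, HasSum (fun i => |c i| * ((m i * n i : ℕ) : ℝ) ^ α) S') ∧
    HasSum (fun i => if m i * n i = 1 then c i else 0) M ∧
    ∀ t : ℝ, HasSum (fun i => (c i : ℂ) * exp (((t * Real.log (m i / n i) : ℝ) : ℂ) * I)) (g t)

variable {B B' : Set ℕ} {α : ℝ} {X X' : ℝ≥0∞} {M M' S S' : ℝ} {g g' : ℝ → ℂ}

lemma TrigSeries.nonneg (h : TrigSeries B α X M S g) : 0 ≤ S := by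
  obtain ⟨ι, _, c, m, n, -, ⟨S', hS', hs⟩, -⟩ := h
  exact (hs.nonneg fun i => by positivity).trans hS'

lemma TrigSeries.mono (h : TrigSeries B α X M S g) (hS : S ≤ S') : TrigSeries B α X M S' g := by
  obtain ⟨ι, hι, c, m, n, h1, ⟨S₀, hS₀, hs⟩, h3⟩ := h
  exact ⟨ι, hι, c, m, n, h1, ⟨S₀, hS₀.trans hS, hs⟩, h3⟩

lemma trigSeries_const (B : Set ℕ) (α : ℝ) {X : ℝ≥0∞} (hX : 1 ≤ X) (a : ℝ) :
    TrigSeries B α X a |a| fun _ => a := by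
  refine ⟨Unit, inferInstance, fun _ => a, fun _ => 1, fun _ => 1, fun _ => ⟨by simp, by simp,
    by simp, by simpa using hX⟩, ⟨|a|, le_rfl, ?_⟩, ?_, fun t => ?_⟩
  · simp
  · simp
  · simp

lemma TrigSeries.smul (h : TrigSeries B α X M S g) (a : ℝ) :
    TrigSeries B α X (a * M) (|a| * S) fun t => a * g t := by
  obtain ⟨ι, hι, c, m, n, h1, ⟨S', hS', hs⟩, hM, hg⟩ := h
  refine ⟨ι, hι, fun i => a * c i, m, n, h1, ⟨|a| * S', by gcongr, ?_⟩, ?_, fun t => ?_⟩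
  · refine (hs.mul_left |a|).congr_fun fun i => ?_
    rw [abs_mul, mul_assoc]
  · refine (hM.mul_left a).congr_fun fun i => ?_
    split_ifs <;> simp
  · refine ((hg t).mul_left (a : ℂ)).congr_fun fun i => ?_
    push_cast; ring

lemma TrigSeries.conj (h : TrigSeries B α X M S g) :
    TrigSeries B α X M S fun t => starRingEnd ℂ (g t) := by
  obtain ⟨ι, hι, c, m, n, h1, ⟨S', hS', hs⟩, hM, hg⟩ := h
  refine ⟨ι, hι, c, n, m, fun i => ?_, ⟨S', hS', ?_⟩, ?_, fun t => ?_⟩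
  · obtain ⟨h2, h3, h4, h5⟩ := h1 i
    rw [mul_comm]
    exact ⟨h2, h3.symm, h4, h5⟩
  · simpa only [mul_comm (n _)] using hs
  · simpa only [mul_comm (n _)] using hM
  · refine (hasSum_conj'.mpr (hg t)).congr_fun fun i => ?_
    rw [map_mul, conj_ofReal, ← exp_conj, map_mul, conj_ofReal, conj_I, ← inv_div (m i : ℝ),
      Real.log_inv]
    push_cast; ring_nf

lemma TrigSeries.add (h : TrigSeries B α X M S g) (h' : TrigSeries B α X M' S' g') :
    TrigSeries B α X (M + M') (S + S') fun t => g t + g' t := by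
  obtain ⟨ι, hι, c, m, n, h1, ⟨s, hs, hss⟩, hM, hg⟩ := h
  obtain ⟨ι', hι', c', m', n', h1', ⟨s', hs', hss'⟩, hM', hg'⟩ := h'
  refine ⟨ι ⊕ ι', inferInstance, Sum.elim c c', Sum.elim m m', Sum.elim n n', ?_,
    ⟨s + s', add_le_add hs hs', ?_⟩, ?_, fun t => ?_⟩
  · rintro (i | i)
    · exact h1 i
    · exact h1' i
  · exact HasSum.sum (by simpa [Function.comp_def] using hss) (by simpa [Function.comp_def] using hss')
  · exact HasSum.sum (by exact hM) (by exact hM')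
  · exact HasSum.sum (by simpa [Function.comp_def] using hg t)
      (by simpa [Function.comp_def] using hg' t)

lemma TrigSeries.ofReal_re (h : TrigSeries B α X M S g) :
    TrigSeries B α X M S fun t => ((g t).re : ℂ) := by
  have := (h.add h.conj).smul (1 / 2)
  rw [abs_of_nonneg (by norm_num)] at this
  convert this using 1
  · ring
  · ring
  · funext t
    rw [add_conj]; push_cast; ring

/-- Unique factorization replaces independence of the log p: over disjoint sets of primes the
product fractions are still reduced, and mm'nn' = 1 only if both fractions are trivial, so the
constant term is the product of the two. -/
lemma TrigSeries.mul (h : TrigSeries B α X M S g) (h' : TrigSeries B' α X' M' S' g')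
    (hB : Disjoint B B') (hα : 0 ≤ α) :
    TrigSeries (B ∪ B') α (X * X') (M * M') (S * S') fun t => g t * g' t := by
  have hS₀ := h.nonneg
  have hS₀' := h'.nonneg
  obtain ⟨ι, hι, c, m, n, h1, ⟨s, hs, hss⟩, hM, hg⟩ := h
  obtain ⟨ι', hι', c', m', n', h1', ⟨s', hs', hss'⟩, hM', hg'⟩ := h'
  have hmul : ∀ q : ι × ι', m q.1 * m' q.2 * (n q.1 * n' q.2) =
      (m q.1 * n q.1) * (m' q.2 * n' q.2) := fun q => by ring
  have hone : ∀ (i : ι), (1 : ℝ) ≤ ((m i * n i : ℕ) : ℝ) ^ α := fun i =>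
    Real.one_le_rpow (by exact_mod_cast Nat.one_le_iff_ne_zero.mpr (h1 i).1) hα
  have hone' : ∀ (i : ι'), (1 : ℝ) ≤ ((m' i * n' i : ℕ) : ℝ) ^ α := fun i =>
    Real.one_le_rpow (by exact_mod_cast Nat.one_le_iff_ne_zero.mpr (h1' i).1) hα
  have hsum : Summable fun i => |c i| := hss.summable.of_nonneg_of_le (fun _ => abs_nonneg _)
    fun i => le_mul_of_one_le_right (abs_nonneg _) (hone i)
  have hsum' : Summable fun i => |c' i| := hss'.summable.of_nonneg_of_le (fun _ => abs_nonneg _)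
    fun i => le_mul_of_one_le_right (abs_nonneg _) (hone' i)
  have hs0 : 0 ≤ s := hss.nonneg fun i => by positivity
  have hs0' : 0 ≤ s' := hss'.nonneg fun i => by positivity
  refine ⟨ι × ι', inferInstance, fun q => c q.1 * c' q.2, fun q => m q.1 * m' q.2,
    fun q => n q.1 * n' q.2, fun q => ?_, ⟨s * s', by gcongr, ?_⟩, ?_, fun t => ?_⟩
  · obtain ⟨a1, a2, a3, a4⟩ := h1 q.1
    obtain ⟨b1, b2, b3, b4⟩ := h1' q.2
    rw [hmul]
    have hcop : (m q.1 * n q.1).Coprime (m' q.2 * n' q.2) := by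
      rw [← Nat.disjoint_primeFactors a1 b1, Finset.disjoint_left]
      exact fun p hp hp' => Set.disjoint_left.mp hB (a3 p hp) (b3 p hp')
    refine ⟨mul_ne_zero a1 b1, ?_, fun p hp => ?_, ?_⟩
    · refine Nat.Coprime.mul_left (Nat.Coprime.mul_right a2 ?_) (Nat.Coprime.mul_right ?_ b2)
      · exact (hcop.coprime_dvd_left (Dvd.intro _ rfl)).coprime_dvd_right (Dvd.intro_left _ rfl)
      · exact ((hcop.coprime_dvd_left (Dvd.intro_left _ rfl)).coprime_dvd_right
          (Dvd.intro _ rfl)).symm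
    · rw [Nat.primeFactors_mul a1 b1, Finset.mem_union] at hp
      exact hp.imp (a3 p) (b3 p)
    · rw [Nat.cast_mul]; exact mul_le_mul' a4 b4
  · refine (hss.mul hss' ?_).congr_fun fun q => ?_
    · exact hss.summable.mul_of_nonneg hss'.summable (fun i => by positivity) fun i => by positivity
    · rw [hmul, abs_mul, Nat.cast_mul, Real.mul_rpow (by positivity) (by positivity)]; ring
  · have hsm : Summable fun q : ι × ι' => (if m q.1 * n q.1 = 1 then c q.1 else 0) *
        (if m' q.2 * n' q.2 = 1 then c' q.2 else 0) := by
      refine Summable.of_norm_bounded (hsum.mul_of_nonneg hsum' (fun i => abs_nonneg _)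
        fun i => abs_nonneg _) fun q => ?_
      rw [norm_mul]
      refine mul_le_mul ?_ ?_ (norm_nonneg _) (abs_nonneg _)
      · split_ifs <;> simp
      · split_ifs <;> simp
    refine (hM.mul hM' hsm).congr_fun fun q => ?_
    rw [hmul]
    by_cases h2 : m q.1 * n q.1 = 1
    · by_cases h3 : m' q.2 * n' q.2 = 1
      · rw [if_pos h2, if_pos h3, h2, h3, if_pos (mul_one 1)]
      · rw [if_neg h3, if_neg fun h => h3 (mul_eq_one.mp h).2, mul_zero]
    · rw [if_neg h2, if_neg fun h => h2 (mul_eq_one.mp h).1, zero_mul]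
  · have hnorm : ∀ a x : ℝ, |a| = ‖(a : ℂ) * exp ((x : ℂ) * I)‖ := fun a x => by
      rw [norm_mul, norm_exp_ofReal_mul_I, mul_one, norm_real]; rfl
    have hsm := summable_mul_of_summable_norm
      (f := fun i => (c i : ℂ) * exp (((t * Real.log (m i / n i) : ℝ) : ℂ) * I))
      (g := fun i => (c' i : ℂ) * exp (((t * Real.log (m' i / n' i) : ℝ) : ℂ) * I))
      (hsum.congr fun i => hnorm _ _) (hsum'.congr fun i => hnorm _ _)
    refine ((hg t).mul (hg' t) hsm).congr_fun fun q => ?_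
    · obtain ⟨a1, -⟩ := h1 q.1
      obtain ⟨b1, -⟩ := h1' q.2
      have k1 : (m q.1 : ℝ) ≠ 0 := by exact_mod_cast left_ne_zero_of_mul a1
      have k2 : (n q.1 : ℝ) ≠ 0 := by exact_mod_cast right_ne_zero_of_mul a1
      have k3 : (m' q.2 : ℝ) ≠ 0 := by exact_mod_cast left_ne_zero_of_mul b1
      have k4 : (n' q.2 : ℝ) ≠ 0 := by exact_mod_cast right_ne_zero_of_mul b1
      have : Real.log (((m q.1 * m' q.2 : ℕ) : ℝ) / ((n q.1 * n' q.2 : ℕ) : ℝ)) =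
          Real.log (m q.1 / n q.1) + Real.log (m' q.2 / n' q.2) := by
        rw [← Real.log_mul (div_ne_zero k1 k2) (div_ne_zero k3 k4)]
        push_cast
        rw [mul_div_mul_comm]
      rw [this, mul_add, ofReal_add, add_mul, exp_add]
      push_cast; ring

lemma TrigSeries.prod {ι : Type*} [DecidableEq ι] (s : Finset ι) (B : ι → Set ℕ) (X : ι → ℝ≥0∞)
    (M S : ι → ℝ) (g : ι → ℝ → ℂ) (hα : 0 ≤ α) (h : ∀ i ∈ s, TrigSeries (B i) α (X i) (M i) (S i) (g i))
    (hB : ∀ i ∈ s, ∀ j ∈ s, i ≠ j → Disjoint (B i) (B j)) :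
    TrigSeries (⋃ i ∈ s, B i) α (∏ i ∈ s, X i) (∏ i ∈ s, M i) (∏ i ∈ s, S i)
      fun t => ∏ i ∈ s, g i t := by
  induction s using Finset.induction_on with
  | empty => simpa using trigSeries_const ∅ α le_rfl 1
  | insert a s ha ih =>
    simp only [Finset.prod_insert ha, Finset.set_biUnion_insert]
    refine (h a (Finset.mem_insert_self a s)).mul (ih (fun i hi => h i (Finset.mem_insert_of_mem hi))
      fun i hi j hj => hB i (Finset.mem_insert_of_mem hi) j (Finset.mem_insert_of_mem hj)) ?_ hα
    rw [Set.disjoint_iUnion₂_right]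
    exact fun i hi => hB a (Finset.mem_insert_self a s) i (Finset.mem_insert_of_mem hi)
      fun h => ha (h ▸ hi)

/-- Truncation to fractions of bounded height. -/
lemma TrigSeries.truncate (h : TrigSeries B α ⊤ M S g) (hα : 0 ≤ α) {Y : ℝ} (hY : 1 ≤ Y) :
    ∃ g₁ : ℝ → ℂ, TrigSeries B 0 (ENNReal.ofReal Y) M S g₁ ∧ ∀ t, ‖g t - g₁ t‖ ≤ Y ^ (-α) * S := by
  obtain ⟨ι, hι, c, m, n, h1, ⟨s, hs, hss⟩, hM, hg⟩ := h
  have hN : ∀ (i : ι), (1 : ℝ) ≤ ((m i * n i : ℕ) : ℝ) := fun i => by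
    exact_mod_cast Nat.one_le_iff_ne_zero.mpr (h1 i).1
  have hone : ∀ (i : ι), (1 : ℝ) ≤ ((m i * n i : ℕ) : ℝ) ^ α := fun i => Real.one_le_rpow (hN i) hα
  have hsum : Summable fun i => |c i| := hss.summable.of_nonneg_of_le (fun _ => abs_nonneg _)
    fun i => le_mul_of_one_le_right (abs_nonneg _) (hone i)
  classical
  -- Discarded terms are kept as zero multiples of the fraction 1/1, so the index type is unchanged.
  -- The constant term survives because 1 ≤ Y.
  set P : ι → Prop := fun i => ((m i * n i : ℕ) : ℝ) ≤ Y with hP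
  set c₁ : ι → ℝ := fun i => if P i then c i else 0 with hc₁
  set m₁ : ι → ℕ := fun i => if P i then m i else 1 with hm₁
  set n₁ : ι → ℕ := fun i => if P i then n i else 1 with hn₁
  have hcle : ∀ i, |c₁ i| ≤ |c i| := fun i => by
    simp only [hc₁]; split_ifs <;> simp
  have hsum₁ : Summable fun i => |c₁ i| := hsum.of_nonneg_of_le (fun _ => abs_nonneg _) hcle
  have hnorm : ∀ (a : ℝ) (x : ℝ), ‖(a : ℂ) * exp ((x : ℂ) * I)‖ = |a| := fun a x => by
    rw [norm_mul, norm_exp_ofReal_mul_I, mul_one, norm_real]; rfl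
  have hsumt : ∀ t : ℝ, Summable fun i =>
      (c₁ i : ℂ) * exp (((t * Real.log (m₁ i / n₁ i) : ℝ) : ℂ) * I) := fun t =>
    Summable.of_norm (hsum₁.congr fun i => (hnorm _ _).symm)
  refine ⟨_, ⟨ι, hι, c₁, m₁, n₁, fun i => ?_, ⟨∑' i, |c₁ i|, ?_, ?_⟩, ?_, fun t => (hsumt t).hasSum⟩,
    fun t => ?_⟩
  · obtain ⟨a1, a2, a3, a4⟩ := h1 i
    by_cases hi : P i
    · simp only [hm₁, hn₁, if_pos hi]
      refine ⟨a1, a2, a3, ?_⟩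
      rw [← ENNReal.ofReal_natCast]
      exact ENNReal.ofReal_le_ofReal hi
    · simp only [hm₁, hn₁, if_neg hi]
      refine ⟨by simp, by simp, by simp, ?_⟩
      simpa using hY
  · refine le_trans ?_ hs
    rw [← hss.tsum_eq]
    exact hsum₁.tsum_le_tsum (fun i => (hcle i).trans
      (le_mul_of_one_le_right (abs_nonneg _) (hone i))) hss.summable
  · simpa using hsum₁.hasSum
  · refine hM.congr_fun fun i => ?_
    by_cases hi : P i
    · simp only [hm₁, hn₁, hc₁, if_pos hi]
    · have : m i * n i ≠ 1 := fun h => hi (by simp only [hP, h]; simpa using hY)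
      simp [hm₁, hn₁, hc₁, if_neg hi, this]
  · have hd := (hg t).sub (hsumt t).hasSum
    have hb : ∀ i, ‖(c i : ℂ) * exp (((t * Real.log (m i / n i) : ℝ) : ℂ) * I) -
        (c₁ i : ℂ) * exp (((t * Real.log (m₁ i / n₁ i) : ℝ) : ℂ) * I)‖ ≤
        Y ^ (-α) * (|c i| * ((m i * n i : ℕ) : ℝ) ^ α) := fun i => by
      by_cases hi : P i
      · simp only [hm₁, hn₁, hc₁, if_pos hi, sub_self, norm_zero]
        have := hone i
        positivity
      · simp only [hc₁, if_neg hi, ofReal_zero, zero_mul, sub_zero]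
        rw [hnorm]
        have h2 : Y ≤ ((m i * n i : ℕ) : ℝ) := le_of_not_ge hi
        -- Rankin's trick: a discarded term has mn ≥ Y, so it may be weighted by (mn/Y)^α.
        have h3 : 1 ≤ Y ^ (-α) * ((m i * n i : ℕ) : ℝ) ^ α := by
          rw [Real.rpow_neg (by linarith), inv_mul_eq_div, one_le_div (by positivity)]
          exact Real.rpow_le_rpow (by linarith) h2 hα
        calc |c i| ≤ |c i| * (Y ^ (-α) * ((m i * n i : ℕ) : ℝ) ^ α) :=
              le_mul_of_one_le_right (abs_nonneg _) h3
          _ = _ := by ring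
    refine (tsum_of_norm_bounded (hss.mul_left (Y ^ (-α))) hb).trans' (le_of_eq ?_) |>.trans ?_
    · rw [hd.tsum_eq]
    · gcongr

lemma TrigSeries.continuous (h : TrigSeries B 0 X M S g) : Continuous g := by
  obtain ⟨ι, hι, c, m, n, -, ⟨s, hs, hss⟩, -, hg⟩ := h
  have e : g = fun t => ∑' i, (c i : ℂ) * exp (((t * Real.log (m i / n i) : ℝ) : ℂ) * I) := by
    funext t; exact (hg t).tsum_eq.symm
  rw [e]
  refine continuous_tsum (u := fun i => |c i|) (fun i => by fun_prop) (by simpa using hss.summable)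
    fun i t => ?_
  rw [norm_mul, norm_exp_ofReal_mul_I, mul_one, norm_real]; rfl

/-- Distinct integers differ by at least 1, which keeps the logarithm of their ratio away from 0. -/
lemma inv_mul_le_abs_log_div {m n : ℕ} (h : m * n ≠ 0) (hmn : m ≠ n) :
    ((m * n : ℕ) : ℝ)⁻¹ ≤ |Real.log ((m : ℝ) / n)| := by
  have key : ∀ m n : ℕ, m * n ≠ 0 → n < m → ((m * n : ℕ) : ℝ)⁻¹ ≤ Real.log ((m : ℝ) / n) := by
    intro m n h hlt
    have hm : (0 : ℝ) < m := by exact_mod_cast Nat.pos_of_ne_zero (left_ne_zero_of_mul h)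
    have hn : (1 : ℝ) ≤ n := by
      exact_mod_cast Nat.one_le_iff_ne_zero.mpr (right_ne_zero_of_mul h)
    have h1 := Real.one_sub_inv_le_log_of_pos (x := (m : ℝ) / n) (by positivity)
    refine le_trans ?_ h1
    have h2 : (n : ℝ) + 1 ≤ m := by exact_mod_cast hlt
    rw [inv_div, Nat.cast_mul, one_sub_div hm.ne', inv_eq_one_div, div_le_div_iff₀ (by positivity) hm]
    nlinarith [mul_nonneg (by linarith : (0 : ℝ) ≤ m - n - 1) (by positivity : (0 : ℝ) ≤ m * n)]
  rcases lt_or_gt_of_ne hmn with h1 | h1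
  · rw [← inv_div, Real.log_inv, abs_neg, mul_comm]
    exact (key n m (by rwa [mul_comm]) h1).trans (le_abs_self _)
  · exact (key m n h h1).trans (le_abs_self _)

/-- The mean value over `[T, 2T]` is the constant term, up to an error controlled by the height. -/
lemma TrigSeries.norm_integral_sub_le {Y : ℝ} (hY : 0 ≤ Y)
    (h : TrigSeries B 0 (ENNReal.ofReal Y) M S g) {T : ℝ} (hT : 0 < T) :
    ‖(1 / T : ℂ) * (∫ t in T..2 * T, g t) - M‖ ≤ 2 * Y * S / T := by
  obtain ⟨ι, hι, c, m, n, h1, ⟨s, hs, hss⟩, hM, hg⟩ := h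
  have hsum : HasSum (fun i => |c i|) s := by simpa using hss
  set G : ι → C(ℝ, ℂ) := fun i =>
    ⟨fun t => (c i : ℂ) * exp (((t * Real.log (m i / n i) : ℝ) : ℂ) * I), by fun_prop⟩ with hG
  have hGn : ∀ i t, ‖G i t‖ = |c i| := fun i t => by
    change ‖(c i : ℂ) * exp (((t * Real.log (m i / n i) : ℝ) : ℂ) * I)‖ = _
    rw [norm_mul, norm_exp_ofReal_mul_I, mul_one, norm_real]; rfl
  have key := intervalIntegral.hasSum_intervalIntegral_of_summable_norm (f := G)
    (a := T) (b := 2 * T) (by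
      refine hsum.summable.of_nonneg_of_le (fun _ => norm_nonneg _) fun i => ?_
      refine (ContinuousMap.norm_le _ (abs_nonneg _)).mpr fun t => ?_
      rw [ContinuousMap.restrict_apply, hGn])
  have e1 : ∀ t : ℝ, ∑' i, G i t = g t := fun t => (hg t).tsum_eq
  simp_rw [e1] at key
  have hd := key.sub ((hasSum_ofReal.mpr hM).mul_left (T : ℂ))
  -- A nonzero frequency ω integrates to at most 2/|ω| ≤ 2mn ≤ 2Y; a trivial fraction integrates
  -- exactly.
  have hb : ∀ i, ‖(∫ t in T..2 * T, G i t) - T * ((if m i * n i = 1 then c i else 0 : ℝ) : ℂ)‖ ≤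
      2 * Y * |c i| := fun i => by
    obtain ⟨a1, a2, -, a4⟩ := h1 i
    change ‖(∫ t in T..2 * T, (c i : ℂ) * exp (((t * Real.log (m i / n i) : ℝ) : ℂ) * I)) - _‖ ≤ _
    by_cases hi : m i * n i = 1
    · obtain ⟨h2, h3⟩ := mul_eq_one.mp hi
      simp only [h2, h3]
      have : (∫ t in T..2 * T, (c i : ℂ) * exp (((t * Real.log ((1 : ℕ) / (1 : ℕ)) : ℝ) : ℂ) * I)) =
          T * c i := by
        simp
        left; ring
      rw [this]; simp; positivity
    · rw [if_neg hi, ofReal_zero, mul_zero, sub_zero, intervalIntegral.integral_const_mul, norm_mul,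
        norm_real, Real.norm_eq_abs, mul_comm]
      refine mul_le_mul_of_nonneg_right ?_ (abs_nonneg _)
      have hmn : m i ≠ n i := fun h => hi (by
        rw [h, Nat.coprime_self] at a2
        rw [h, a2])
      have hω := inv_mul_le_abs_log_div a1 hmn
      set ω := Real.log ((m i : ℝ) / n i)
      have hN : (0 : ℝ) < ((m i * n i : ℕ) : ℝ) := by exact_mod_cast Nat.pos_of_ne_zero a1
      have hω0 : 0 < |ω| := lt_of_lt_of_le (by positivity) hω
      have hNY : ((m i * n i : ℕ) : ℝ) ≤ Y := by
        rw [← ENNReal.ofReal_natCast] at a4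
        exact (ENNReal.ofReal_le_ofReal_iff hY).mp a4
      have hωI : (ω : ℂ) * I ≠ 0 := mul_ne_zero (by exact_mod_cast abs_pos.mp hω0) I_ne_zero
      have e : ∀ t : ℝ, exp (((t * ω : ℝ) : ℂ) * I) = exp (((ω : ℂ) * I) * t) := fun t => by
        congr 1; push_cast; ring
      simp_rw [e]
      rw [integral_exp_mul_complex hωI, norm_div, norm_mul, norm_I, mul_one, norm_real,
        Real.norm_eq_abs]
      have e2 : ∀ t : ℝ, ‖exp (((ω : ℂ) * I) * t)‖ = 1 := fun t => by
        rw [← e, norm_exp_ofReal_mul_I]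
      have h5 : ‖exp (((ω : ℂ) * I) * ((2 * T : ℝ) : ℂ)) - exp (((ω : ℂ) * I) * T)‖ ≤ 2 := by
        refine (norm_sub_le _ _).trans ?_
        rw [e2, e2]; norm_num
      rw [div_le_iff₀ hω0]
      refine h5.trans ?_
      have h6 : 1 ≤ Y * |ω| := by
        calc (1 : ℝ) = ((m i * n i : ℕ) : ℝ) * ((m i * n i : ℕ) : ℝ)⁻¹ := (mul_inv_cancel₀ hN.ne').symm
          _ ≤ Y * |ω| := by gcongr
      linarith
  have hfin : ‖(∫ t in T..2 * T, g t) - T * M‖ ≤ 2 * Y * s := by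
    rw [← hd.tsum_eq]
    exact tsum_of_norm_bounded (hsum.mul_left _) hb
  have hTc : (T : ℂ) ≠ 0 := by exact_mod_cast hT.ne'
  have e3 : (1 / T : ℂ) * (∫ t in T..2 * T, g t) - M = (1 / T : ℂ) * ((∫ t in T..2 * T, g t) - T * M) := by
    field_simp
  rw [e3, norm_mul, norm_div, norm_one, norm_real, Real.norm_of_nonneg hT.le, one_div_mul_eq_div]
  gcongr
  exact hfin.trans (by gcongr)

end TrigSeries

/-! ### The series of a single local factor. -/

section LocalSeries

open Complex MeasureTheory
open scoped ENNReal

-- Squaring the modulus of the binomial series gives terms indexed by (a, b) with frequency (a - b)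
-- log p and weight ρ^{|a-b|}, ρ = p^α. Bounding |a - b| by a + b gives the first entry of the
-- minimum, used for large p. Bounding ρ^{|a-b|} by ρ^a ρ^{-b} + ρ^{-a} ρ^b gives the second, whose
-- logarithm has no term linear in log ρ beyond that of the maximum at ρ = 1; it is used for small
-- p.
set_option maxHeartbeats 1000000 in
lemma trigSeries_localFactor {δ : ℤ} (hδ : δ = 1 ∨ δ = -1) (k : ℕ) {p : ℕ} (hp : p.Prime) {α : ℝ}
    (hα : 0 ≤ α) (hα1 : (p : ℝ) ^ α * (1 / p) < 1) :
    TrigSeries {p} α ⊤ (localSum ((δ : ℝ) * k) (1 / p))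
      (min (((1 - δ * ((p : ℝ) ^ α * (1 / p))) ^ (-(δ * (k : ℤ)))) ^ 2)
        (2 * ((1 - δ * ((p : ℝ) ^ α * (1 / p))) ^ (-(δ * (k : ℤ))) *
          (1 - δ * ((p : ℝ) ^ (-α) * (1 / p))) ^ (-(δ * (k : ℤ))))))
      fun t => ((circleNormSq (1 / p) (t * Real.log p) ^ (-(δ * (k : ℤ))) : ℝ) : ℂ) := by
  have hp0 : (0 : ℝ) < p := by exact_mod_cast hp.pos
  have hp1 : (1 : ℝ) < p := by exact_mod_cast hp.one_lt
  set x : ℝ := 1 / p with hx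
  have hx0 : 0 ≤ x := by positivity
  have hx1 : x < 1 := by rw [hx, div_lt_one hp0]; exact hp1
  set ρ : ℝ := (p : ℝ) ^ α with hρ
  have hρ1 : 1 ≤ ρ := Real.one_le_rpow hp1.le hα
  have hρ' : (p : ℝ) ^ (-α) = ρ⁻¹ := by rw [hρ, Real.rpow_neg hp0.le]
  rw [hρ']
  set b : ℕ → ℝ := binomCoeff ((δ : ℝ) * k) with hb
  have hA := hasSum_abs_binomCoeff hδ k (r := ρ * x) (by positivity) hα1
  have hB := hasSum_abs_binomCoeff hδ k (r := ρ⁻¹ * x) (by positivity) (by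
    have : ρ⁻¹ ≤ 1 := inv_le_one_of_one_le₀ hρ1
    nlinarith)
  rw [← hb] at hA hB
  set A := (1 - δ * (ρ * x)) ^ (-(δ * (k : ℤ)))
  set A' := (1 - δ * (ρ⁻¹ * x)) ^ (-(δ * (k : ℤ)))
  have hAA := hA.mul hA (hA.summable.mul_of_nonneg hA.summable (fun i => by positivity)
    fun i => by positivity)
  have hAB := hA.mul hB (hA.summable.mul_of_nonneg hB.summable (fun i => by positivity)
    fun i => by positivity)
  have hBA := hB.mul hA (hB.summable.mul_of_nonneg hA.summable (fun i => by positivity)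
    fun i => by positivity)
  have hmn : ∀ q : ℕ × ℕ, p ^ (q.1 - q.2) * p ^ (q.2 - q.1) = p ^ ((q.1 - q.2) + (q.2 - q.1)) :=
    fun q => (pow_add _ _ _).symm
  have hw : ∀ q : ℕ × ℕ, ((p ^ (q.1 - q.2) * p ^ (q.2 - q.1) : ℕ) : ℝ) ^ α =
      ρ ^ ((q.1 - q.2) + (q.2 - q.1)) := fun q => by
    rw [hmn, Nat.cast_pow, ← Real.rpow_natCast, ← Real.rpow_mul hp0.le, mul_comm,
      Real.rpow_mul hp0.le, Real.rpow_natCast]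
  set c : ℕ × ℕ → ℝ := fun q => b q.1 * x ^ q.1 * (b q.2 * x ^ q.2) with hc
  have habs : ∀ q : ℕ × ℕ, |c q| = |b q.1| * |b q.2| * x ^ q.1 * x ^ q.2 := fun q => by
    simp only [hc]
    rw [abs_mul, abs_mul, abs_mul, abs_of_nonneg (pow_nonneg hx0 _), abs_of_nonneg (pow_nonneg hx0 _)]
    ring
  have hle1 : ∀ q : ℕ × ℕ, |c q| * ((p ^ (q.1 - q.2) * p ^ (q.2 - q.1) : ℕ) : ℝ) ^ α ≤
      |b q.1| * (ρ * x) ^ q.1 * (|b q.2| * (ρ * x) ^ q.2) := fun q => by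
    rw [hw, habs]
    have h1 : ρ ^ ((q.1 - q.2) + (q.2 - q.1)) ≤ ρ ^ (q.1 + q.2) :=
      pow_le_pow_right₀ hρ1 (by omega)
    calc _ ≤ |b q.1| * |b q.2| * x ^ q.1 * x ^ q.2 * ρ ^ (q.1 + q.2) := by gcongr
      _ = _ := by rw [mul_pow, mul_pow, pow_add]; ring
  have hle2 : ∀ q : ℕ × ℕ, |c q| * ((p ^ (q.1 - q.2) * p ^ (q.2 - q.1) : ℕ) : ℝ) ^ α ≤
      |b q.1| * (ρ * x) ^ q.1 * (|b q.2| * (ρ⁻¹ * x) ^ q.2) +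
      |b q.1| * (ρ⁻¹ * x) ^ q.1 * (|b q.2| * (ρ * x) ^ q.2) := fun q => by
    rw [hw, habs]
    have hρ0 : ρ ≠ 0 := by linarith
    have h1 : ρ ^ ((q.1 - q.2) + (q.2 - q.1)) ≤ ρ ^ q.1 * ρ⁻¹ ^ q.2 + ρ⁻¹ ^ q.1 * ρ ^ q.2 := by
      rcases le_total q.2 q.1 with h | h
      · have e : ρ ^ ((q.1 - q.2) + (q.2 - q.1)) = ρ ^ q.1 * ρ⁻¹ ^ q.2 := by
          rw [Nat.sub_eq_zero_of_le h, add_zero, pow_sub₀ _ hρ0 h, inv_pow]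
        rw [e]
        exact le_add_of_nonneg_right (by positivity)
      · have e : ρ ^ ((q.1 - q.2) + (q.2 - q.1)) = ρ⁻¹ ^ q.1 * ρ ^ q.2 := by
          rw [Nat.sub_eq_zero_of_le h, zero_add, pow_sub₀ _ hρ0 h, inv_pow, mul_comm]
        rw [e]
        exact le_add_of_nonneg_left (by positivity)
    calc _ ≤ |b q.1| * |b q.2| * x ^ q.1 * x ^ q.2 * (ρ ^ q.1 * ρ⁻¹ ^ q.2 + ρ⁻¹ ^ q.1 * ρ ^ q.2) := by
          gcongr
      _ = _ := by simp only [mul_pow]; ring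
  have hsum : Summable fun q : ℕ × ℕ =>
      |c q| * ((p ^ (q.1 - q.2) * p ^ (q.2 - q.1) : ℕ) : ℝ) ^ α :=
    hAA.summable.of_nonneg_of_le (fun q => by positivity) hle1
  -- The subtractions are truncated, so one exponent is always 0 and the fraction is automatically
  -- reduced.
  refine ⟨ℕ × ℕ, inferInstance, c, fun q => p ^ (q.1 - q.2), fun q => p ^ (q.2 - q.1), fun q => ?_,
    ⟨_, ?_, hsum.hasSum⟩, ?_, fun t => ?_⟩
  · refine ⟨mul_ne_zero (pow_ne_zero _ hp.ne_zero) (pow_ne_zero _ hp.ne_zero), ?_, fun l hl => ?_,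
      le_top⟩
    · rcases le_total q.2 q.1 with h | h
      · simp [Nat.sub_eq_zero_of_le h]
      · simp [Nat.sub_eq_zero_of_le h]
    · rw [hmn] at hl
      have h1 := Nat.prime_of_mem_primeFactors hl
      exact (Nat.prime_dvd_prime_iff_eq h1 hp).mp
        (h1.dvd_of_dvd_pow (Nat.dvd_of_mem_primeFactors hl))
  · refine le_min ?_ ?_
    · rw [sq, ← hAA.tsum_eq]
      exact hsum.tsum_le_tsum hle1 hAA.summable
    · have h2 := hAB.add hBA
      rw [show A * A' + A' * A = 2 * (A * A') by ring] at h2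
      rw [← h2.tsum_eq]
      exact hsum.tsum_le_tsum hle2 h2.summable
  · have hinj : Function.Injective fun a : ℕ => (a, a) := fun a b h => (Prod.mk.inj h).1
    have hone : ∀ q : ℕ × ℕ, p ^ (q.1 - q.2) * p ^ (q.2 - q.1) = 1 ↔ q.1 = q.2 := fun q => by
      rw [hmn, Nat.pow_eq_one]
      have := hp.one_lt
      omega
    refine (hinj.hasSum_iff (f := fun q : ℕ × ℕ =>
      if p ^ (q.1 - q.2) * p ^ (q.2 - q.1) = 1 then c q else 0) ?_).mp ?_
    · intro q hq
      exact if_neg fun h => hq ⟨q.1, by ext <;> simp [(hone q).mp h]⟩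
    · have h3 := (hasSum_localSum hδ k hx0 hx1)
      rw [← localSum_eq_integral hδ k hx0 hx1] at h3
      refine h3.congr_fun fun a => ?_
      simp only [Function.comp]
      rw [if_pos ((hone (a, a)).mpr rfl)]
      simp only [hc, hb]
      ring
  · have h4 := hasSum_normSq_fourier (summable_abs_binomCoeff hδ k hx0 hx1)
      (hasSum_binomCoeff_exp hδ k hx0 hx1 (t * Real.log p))
    rw [norm_zpow_sq_eq] at h4
    refine h4.congr_fun fun q => ?_
    have e : Real.log (((p ^ (q.1 - q.2) : ℕ) : ℝ) / ((p ^ (q.2 - q.1) : ℕ) : ℝ)) =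
        ((q.1 : ℝ) - q.2) * Real.log p := by
      rw [Nat.cast_pow, Nat.cast_pow, Real.log_div (by positivity) (by positivity), Real.log_pow,
        Real.log_pow]
      rcases le_total q.2 q.1 with h | h
      · rw [Nat.sub_eq_zero_of_le h, Nat.cast_sub h]; push_cast; ring
      · rw [Nat.sub_eq_zero_of_le h, Nat.cast_sub h]; push_cast; ring
    rw [e]
    simp only [hc, hb]
    congr 2
    push_cast
    ring

end LocalSeries

/-! ### Mean values of products of nonnegative blocks. -/

section Blocks

open MeasureTheory
open scoped ENNReal

/-- Telescoping, with the remaining factors f enlarged to u, so that the right side involves only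
the majorants, which are the functions of small height. -/
lemma prod_sub_prod_le_sum {ι : Type*} [DecidableEq ι] (s : Finset ι) (f u d : ι → ℝ)
    (hf : ∀ i ∈ s, 0 ≤ f i) (hfu : ∀ i ∈ s, f i ≤ u i) (hd : ∀ i ∈ s, u i - f i ≤ d i) :
    ∏ i ∈ s, u i - ∏ i ∈ s, f i ≤ ∑ i ∈ s, ∏ j ∈ s, if j = i then d i else u j := by
  induction s using Finset.induction_on with
  | empty => simp
  | insert a s ha ih =>
    have hmem := fun {i} (hi : i ∈ s) => Finset.mem_insert_of_mem (a := i) (b := a) hi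
    have ha' := Finset.mem_insert_self a s
    have ih' := ih (fun i hi => hf i (hmem hi)) (fun i hi => hfu i (hmem hi))
      fun i hi => hd i (hmem hi)
    have hu0 : ∀ i ∈ s, 0 ≤ u i := fun i hi => (hf i (hmem hi)).trans (hfu i (hmem hi))
    rw [Finset.prod_insert ha, Finset.prod_insert ha, Finset.sum_insert ha, Finset.prod_insert ha,
      if_pos rfl]
    have e1 : ∏ j ∈ s, (if j = a then d a else u j) = ∏ j ∈ s, u j :=
      Finset.prod_congr rfl fun j hj => if_neg (by rintro rfl; exact ha hj)
    have e2 : ∑ i ∈ s, ∏ j ∈ insert a s, (if j = i then d i else u j) =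
        u a * ∑ i ∈ s, ∏ j ∈ s, if j = i then d i else u j := by
      rw [Finset.mul_sum]
      refine Finset.sum_congr rfl fun i hi => ?_
      rw [Finset.prod_insert ha, if_neg (by rintro rfl; exact ha hi)]
    rw [e1, e2]
    have h1 : (u a - f a) * ∏ j ∈ s, u j ≤ d a * ∏ j ∈ s, u j :=
      mul_le_mul_of_nonneg_right (hd a ha') (Finset.prod_nonneg hu0)
    have h2 : 0 ≤ ∏ j ∈ s, u j - ∏ j ∈ s, f j := sub_nonneg.mpr
      (Finset.prod_le_prod (fun i hi => hf i (hmem hi)) fun i hi => hfu i (hmem hi))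
    have h3 : f a * (∏ j ∈ s, u j - ∏ j ∈ s, f j) ≤
        u a * ∑ i ∈ s, ∏ j ∈ s, if j = i then d i else u j :=
      mul_le_mul (hfu a ha') ih' h2 ((hf a ha').trans (hfu a ha'))
    linarith

/-- The mean value of a product of normalized nonnegative blocks, each of which is well approximated
by a series of small height. -/
lemma abs_mean_prod_sub_one_le {ι : Type*} [DecidableEq ι] (J : Finset ι) (B : ι → Set ℕ)
    (α H S : ι → ℝ) (f : ι → ℝ → ℝ) {ε T : ℝ} (hT : 0 < T) (hε : 0 < ε)
    (hα : ∀ j ∈ J, 0 ≤ α j) (hH : ∀ j ∈ J, 0 ≤ H j)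
    (hB : ∀ i ∈ J, ∀ j ∈ J, i ≠ j → Disjoint (B i) (B j))
    (hf : ∀ j ∈ J, TrigSeries (B j) (α j) ⊤ 1 (S j) fun t => (f j t : ℂ))
    (hf0 : ∀ j ∈ J, ∀ t, 0 ≤ f j t) (hfc : ∀ j ∈ J, Continuous (f j)) (hε1 : ε ≤ 1)
    (hS : ∀ j ∈ J, Real.exp (-(α j * H j)) * S j ≤ ε) :
    |(1 / T) * (∫ t in T..2 * T, ∏ j ∈ J, f j t) - 1| ≤
      ((1 + ε) ^ J.card - 1) + 2 * J.card * ε * (1 + ε) ^ J.card +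
        (1 + 2 * J.card * ε) *
          (2 * Real.exp (∑ j ∈ J, H j) * ∏ j ∈ J, 2 * Real.exp (α j * H j)) / T := by
  have htr : ∀ j : ι, ∃ g₁ : ℝ → ℂ, j ∈ J →
      TrigSeries (B j) 0 (ENNReal.ofReal (Real.exp (H j))) 1 (S j) g₁ ∧
      ∀ t, ‖(f j t : ℂ) - g₁ t‖ ≤ ε := fun j => by
    by_cases hj : j ∈ J
    · obtain ⟨g₁, h1, h2⟩ := (hf j hj).truncate (hα j hj) (Real.one_le_exp (hH j hj))
      refine ⟨g₁, fun _ => ⟨h1, fun t => (h2 t).trans ?_⟩⟩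
      rw [← Real.exp_mul, mul_comm (H j), neg_mul]
      exact hS j hj
    · exact ⟨0, fun h => absurd h hj⟩
  choose g hg using htr
  -- A majorant of the block: the real part of its truncation, raised by the truncation error. Its
  -- constant term is 1 + ε.
  set u : ι → ℝ → ℝ := fun j t => (g j t).re + ε with hu
  have hS2 : ∀ j ∈ J, S j + ε ≤ 2 * Real.exp (α j * H j) := fun j hj => by
    have h1 := hS j hj
    rw [Real.exp_neg, inv_mul_le_iff₀ (Real.exp_pos _)] at h1
    have h2 : 1 ≤ Real.exp (α j * H j) := Real.one_le_exp (mul_nonneg (hα j hj) (hH j hj))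
    nlinarith
  have hone : ∀ j ∈ J, (1 : ℝ≥0∞) ≤ ENNReal.ofReal (Real.exp (H j)) := fun j hj => by
    rw [ENNReal.one_le_ofReal]; exact Real.one_le_exp (hH j hj)
  have hut : ∀ j ∈ J, TrigSeries (B j) 0 (ENNReal.ofReal (Real.exp (H j))) (1 + ε)
      (2 * Real.exp (α j * H j)) fun t => (u j t : ℂ) := fun j hj => by
    have h1 := ((hg j hj).1.ofReal_re.add (trigSeries_const (B j) 0 (hone j hj) ε)).mono
      (S' := 2 * Real.exp (α j * H j)) (by rw [abs_of_pos hε]; exact hS2 j hj)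
    simpa only [hu, Complex.ofReal_add] using h1
  have hre : ∀ j ∈ J, ∀ t, |f j t - (g j t).re| ≤ ε := fun j hj t => by
    have := (Complex.abs_re_le_norm _).trans ((hg j hj).2 t)
    rwa [Complex.sub_re, Complex.ofReal_re] at this
  have hfu : ∀ j ∈ J, ∀ t, f j t ≤ u j t := fun j hj t => by
    have := (abs_le.mp (hre j hj t)).2
    simp only [hu]; linarith
  have huf : ∀ j ∈ J, ∀ t, u j t - f j t ≤ 2 * ε := fun j hj t => by
    have := (abs_le.mp (hre j hj t)).1
    simp only [hu]; linarith
  -- The contribution of all nonconstant terms: height times coefficient sums, divided by T.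
  set K := (2 * Real.exp (∑ j ∈ J, H j) * ∏ j ∈ J, 2 * Real.exp (α j * H j)) / T with hK
  have hmean : ∀ (v : ι → ℝ → ℝ) (m s : ι → ℝ), (∀ j ∈ J,
      TrigSeries (B j) 0 (ENNReal.ofReal (Real.exp (H j))) (m j)
        (s j * (2 * Real.exp (α j * H j))) fun t => (v j t : ℂ)) →
      |(1 / T) * (∫ t in T..2 * T, ∏ j ∈ J, v j t) - ∏ j ∈ J, m j| ≤ (∏ j ∈ J, s j) * K ∧
      IntervalIntegrable (fun t => ∏ j ∈ J, v j t) volume T (2 * T) := by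
    intro v m s hv
    have h1 := TrigSeries.prod J B (fun j => ENNReal.ofReal (Real.exp (H j))) m
      (fun j => s j * (2 * Real.exp (α j * H j))) (fun j t => (v j t : ℂ)) le_rfl hv hB
    rw [← ENNReal.ofReal_prod_of_nonneg fun j _ => (Real.exp_pos _).le] at h1
    have h2 := h1.norm_integral_sub_le (Finset.prod_nonneg fun j _ => (Real.exp_pos _).le) hT
    have h3 := h1.continuous
    simp_rw [← Complex.ofReal_prod] at h2 h3
    rw [intervalIntegral.integral_ofReal] at h2
    have e : (1 / T : ℂ) * ((∫ t in T..2 * T, ∏ j ∈ J, v j t : ℝ) : ℂ) - ((∏ j ∈ J, m j : ℝ) : ℂ) =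
        (((1 / T) * (∫ t in T..2 * T, ∏ j ∈ J, v j t) - ∏ j ∈ J, m j : ℝ) : ℂ) := by push_cast; rfl
    rw [e, Complex.norm_real, Real.norm_eq_abs, ← Real.exp_sum, Finset.prod_mul_distrib] at h2
    refine ⟨h2.trans (le_of_eq ?_), ?_⟩
    · rw [hK]; ring
    · have h4 := Complex.continuous_re.comp h3
      simp only [Function.comp_def, Complex.ofReal_re] at h4
      exact h4.intervalIntegrable _ _
  have hK0 : 0 ≤ K := by
    rw [hK]; positivity
  obtain ⟨hu1, hu2⟩ := hmean u (fun _ => 1 + ε) (fun _ => 1) fun j hj => by simpa using hut j hj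
  rw [Finset.prod_const, Finset.prod_const_one, one_mul] at hu1
  -- The i-th telescoping product has the constant 2ε in place of one majorant, so its mean is
  -- smaller by a factor of order ε.
  have hw : ∀ i ∈ J, (1 / T) * (∫ t in T..2 * T, ∏ j ∈ J, if j = i then 2 * ε else u j t) ≤
      2 * ε * (1 + ε) ^ J.card + 2 * ε * K ∧ IntervalIntegrable
        (fun t => ∏ j ∈ J, if j = i then 2 * ε else u j t) volume T (2 * T) := fun i hi => by
    obtain ⟨h1, h2⟩ := hmean (fun j t => if j = i then 2 * ε else u j t)
      (fun j => if j = i then 2 * ε else 1 + ε) (fun j => if j = i then 2 * ε else 1) fun j hj => by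
        by_cases hji : j = i
        · simp only [hji, if_true]
          rw [hji] at hj
          refine (trigSeries_const (B i) 0 (hone i hj) (2 * ε)).mono ?_
          rw [abs_of_pos (by positivity)]
          have : 1 ≤ Real.exp (α i * H i) := Real.one_le_exp (mul_nonneg (hα i hj) (hH i hj))
          nlinarith
        · simp only [if_neg hji]
          simpa using hut j hj
    refine ⟨?_, h2⟩
    rw [Finset.prod_ite_eq' J i (fun _ => 2 * ε), if_pos hi] at h1
    have h3 : ∏ j ∈ J, (if j = i then 2 * ε else 1 + ε) ≤ 2 * ε * (1 + ε) ^ J.card := by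
      calc ∏ j ∈ J, (if j = i then 2 * ε else 1 + ε) ≤
          ∏ j ∈ J, (if j = i then 2 * ε else 1) * (1 + ε) := by
            refine Finset.prod_le_prod (fun j _ => ?_) fun j _ => ?_
            · split_ifs <;> positivity
            · split_ifs
              · nlinarith
              · linarith
        _ = _ := by
            rw [Finset.prod_mul_distrib, Finset.prod_ite_eq' J i (fun _ => 2 * ε), if_pos hi,
              Finset.prod_const]
    linarith [(abs_le.mp h1).2]
  have hfI : IntervalIntegrable (fun t => ∏ j ∈ J, f j t) volume T (2 * T) :=
    (continuous_finsetProd J hfc).intervalIntegrable _ _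
  have hT2 : T ≤ 2 * T := by linarith
  have hup : ∫ t in T..2 * T, ∏ j ∈ J, f j t ≤ ∫ t in T..2 * T, ∏ j ∈ J, u j t :=
    intervalIntegral.integral_mono_on hT2 hfI hu2 fun t _ =>
      Finset.prod_le_prod (fun j hj => hf0 j hj t) fun j hj => hfu j hj t
  have hlow : (∫ t in T..2 * T, ∏ j ∈ J, u j t) - ∫ t in T..2 * T, ∏ j ∈ J, f j t ≤
      ∑ i ∈ J, ∫ t in T..2 * T, ∏ j ∈ J, if j = i then 2 * ε else u j t := by
    rw [← intervalIntegral.integral_sub hu2 hfI,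
      ← intervalIntegral.integral_finsetSum fun i hi => (hw i hi).2]
    refine intervalIntegral.integral_mono_on hT2 (hu2.sub hfI) ?_ fun t _ =>
      prod_sub_prod_le_sum J (fun j => f j t) (fun j => u j t) (fun _ => 2 * ε)
        (fun j hj => hf0 j hj t) (fun j hj => hfu j hj t) fun j hj => huf j hj t
    simpa only [Finset.sum_fn] using IntervalIntegrable.sum J fun i hi => (hw i hi).2
  have hT1 : 0 ≤ 1 / T := by positivity
  have hup' := mul_le_mul_of_nonneg_left hup hT1
  have hlow' := mul_le_mul_of_nonneg_left hlow hT1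
  have hsum : 1 / T * ∑ i ∈ J, ∫ t in T..2 * T, ∏ j ∈ J, (if j = i then 2 * ε else u j t) ≤
      J.card * (2 * ε * (1 + ε) ^ J.card + 2 * ε * K) := by
    rw [Finset.mul_sum, ← nsmul_eq_mul]
    exact Finset.sum_le_card_nsmul _ _ _ fun i hi => (hw i hi).1
  have h1ε : 1 ≤ (1 + ε) ^ J.card := one_le_pow₀ (by linarith)
  have hX : 0 ≤ (J.card : ℝ) * ε * (1 + ε) ^ J.card := by positivity
  have hY : 0 ≤ (J.card : ℝ) * ε * K := by positivity
  rw [mul_div_assoc, ← hK]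
  obtain ⟨hu3, hu4⟩ := abs_le.mp hu1
  rw [mul_sub] at hlow'
  rw [abs_le]
  constructor <;> nlinarith

end Blocks

/-! ### Weighted coefficient sums of the normalized local factors. -/

section LocalLoss

open Real

/-- For 0 ≤ v ≤ 3/5 one has 1/(1 - v) ≤ e^{2.5 v}; the constant 14 exceeds 2 · 2.5 · 2.72. -/
lemma localSeries_le_exp {δ : ℤ} (hδ : δ = 1 ∨ δ = -1) (k : ℕ) {x ρ : ℝ} (hx : 0 ≤ x) (hρ : 0 ≤ ρ)
    (hρ1 : ρ ≤ 2.72) (hρx : ρ * x ≤ 3 / 5) :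
    ((1 - δ * (ρ * x)) ^ (-(δ * (k : ℤ)))) ^ 2 ≤ exp (14 * k * x) := by
  have hu0 : 0 ≤ ρ * x := by positivity
  have hk : (0 : ℝ) ≤ k := Nat.cast_nonneg k
  have key : (1 - δ * (ρ * x)) ^ (-(δ * (k : ℤ))) ≤ exp (k * (2.5 * (ρ * x))) := by
    rcases hδ with rfl | rfl
    · rw [one_mul, zpow_neg, zpow_natCast, Int.cast_one, one_mul, ← inv_pow, exp_nat_mul]
      have h1 : 0 < 1 - ρ * x := by linarith
      refine pow_le_pow_left₀ (by positivity) ?_ k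
      rw [inv_le_comm₀ h1 (exp_pos _), ← exp_neg, ← le_log_iff_exp_le h1]
      refine le_trans ?_ (one_sub_inv_le_log_of_pos h1)
      rw [neg_le, neg_sub, sub_le_iff_le_add, inv_le_iff_one_le_mul₀ h1]
      nlinarith
    · rw [neg_one_mul, neg_neg, zpow_natCast, exp_nat_mul]
      refine pow_le_pow_left₀ (by push_cast; linarith) ?_ k
      have := add_one_le_exp (2.5 * (ρ * x))
      push_cast
      linarith
  calc _ ≤ exp (k * (2.5 * (ρ * x))) ^ 2 := by
        refine pow_le_pow_left₀ (zpow_nonneg ?_ _) key 2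
        rcases hδ with rfl | rfl <;> push_cast <;> linarith
    _ = exp (k * (5 * (ρ * x))) := by rw [← exp_nat_mul]; congr 1; push_cast; ring
    _ ≤ _ := by
        refine exp_le_exp.mpr ?_
        have : ρ * x ≤ 2.72 * x := by gcongr
        nlinarith

/-- The product (1 - δe^s x)(1 - δe^{-s} x) equals (1 - δx)² - δx(e^s + e^{-s} - 2), and the last
bracket is O(s²). So the linear terms in s cancel and the loss beyond the maximum is quadratic.
Replacing the maximum by the mean costs 36√(1 + kx), and 72 = 2 · 36. -/
lemma two_mul_localSeries_le {δ : ℤ} (hδ : δ = 1 ∨ δ = -1) (k : ℕ) {x s : ℝ} (hx : 0 ≤ x)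
    (hx2 : x ≤ 1 / 2) (hs : 0 ≤ s) (hs8 : s ≤ 1 / 8) :
    2 * ((1 - δ * (exp s * x)) ^ (-(δ * (k : ℤ))) * (1 - δ * (exp (-s) * x)) ^ (-(δ * (k : ℤ)))) ≤
      localSum ((δ : ℝ) * k) x * exp (log 72 + log (1 + k * x) / 2 + 9 * (k * x * s ^ 2)) := by
  have hk : (0 : ℝ) ≤ k := Nat.cast_nonneg k
  set η := exp s + exp (-s) - 2 with hη
  have hη0 : 0 ≤ η := by
    have h1 : exp s * exp (-s) = 1 := by rw [← exp_add]; simp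
    nlinarith [sq_nonneg (exp s - exp (-s)), exp_pos s, exp_pos (-s), sq_nonneg (exp s + exp (-s) - 2)]
  have hηs : η ≤ 1.125 * s ^ 2 := by
    have h1 := cosh_le_exp_half_sq s
    rw [cosh_eq] at h1
    have h2 := add_one_le_exp (-(s ^ 2 / 2))
    have h3 : exp (s ^ 2 / 2) * exp (-(s ^ 2 / 2)) = 1 := by rw [← exp_add]; simp
    have h4 : s ^ 2 ≤ 1 / 64 := by nlinarith
    have h5 : exp (s ^ 2 / 2) ≤ 1.125 := by nlinarith [exp_pos (s ^ 2 / 2)]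
    have h6 : exp (s ^ 2 / 2) * (1 - s ^ 2 / 2) ≤ 1 := by nlinarith [exp_pos (s ^ 2 / 2)]
    nlinarith [sq_nonneg s]
  have hprod : (1 - δ * (exp s * x)) * (1 - δ * (exp (-s) * x)) =
      (1 - (δ : ℝ) * x) ^ 2 - δ * (x * η) := by
    have h1 : exp s * exp (-s) = 1 := by rw [← exp_add]; simp
    have h2 : (δ : ℝ) ^ 2 = 1 := by rcases hδ with rfl | rfl <;> norm_num
    rw [hη]
    linear_combination (δ : ℝ) ^ 2 * x ^ 2 * h1
  have hxη : x * η ≤ 1 / 100 := by nlinarith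
  have hxη0 : 0 ≤ x * η := by positivity
  have hQ : ((1 - (δ : ℝ) * x) ^ 2 - δ * (x * η)) ^ (-(δ * (k : ℤ))) ≤
      localMax δ k x * exp (9 * (k * x * s ^ 2)) := by
    have hexp : exp (k * (8 * (x * η))) ≤ exp (9 * (k * x * s ^ 2)) := by
      refine exp_le_exp.mpr ?_
      have : k * x * η ≤ k * x * (1.125 * s ^ 2) := by gcongr
      linarith
    have hL := (localMax_pos hδ k hx (by linarith : x < 1)).le
    refine le_trans ?_ (mul_le_mul_of_nonneg_left hexp hL)
    rcases hδ with rfl | rfl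
    · rw [localMax_one, one_mul, zpow_neg, zpow_natCast, Int.cast_one, one_mul, one_mul,
        exp_nat_mul, ← inv_pow, ← inv_pow, ← mul_pow]
      have h3 : 1 / 4 ≤ (1 - x) ^ 2 := by nlinarith
      have h4 : 0 < (1 - x) ^ 2 - x * η := by linarith
      refine pow_le_pow_left₀ (by positivity) ?_ k
      rw [inv_le_iff_one_le_mul₀ h4, mul_comm, ← mul_assoc, ← div_eq_mul_inv]
      have h5 : 1 - 4 * (x * η) ≤ ((1 - x) ^ 2 - x * η) / (1 - x) ^ 2 := by
        rw [le_div_iff₀ (by linarith)]; nlinarith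
      have h6 := add_one_le_exp (8 * (x * η))
      calc (1 : ℝ) ≤ (1 - 4 * (x * η)) * (8 * (x * η) + 1) := by nlinarith
        _ ≤ _ := mul_le_mul h5 h6 (by positivity) (div_nonneg h4.le (sq_nonneg _))
    · rw [localMax_neg_one, neg_one_mul, neg_neg, zpow_natCast, exp_nat_mul, ← mul_pow]
      push_cast
      refine pow_le_pow_left₀ (by nlinarith) ?_ k
      have h6 := add_one_le_exp (8 * (x * η))
      have h7 : 1 ≤ (1 + x) ^ 2 := by nlinarith
      nlinarith
  rw [← mul_zpow, hprod]
  have hD := localMax_div_le_localSum hδ k hx hx2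
  have hs0 : 0 < √(1 + k * x) := sqrt_pos.mpr (by positivity)
  rw [div_le_iff₀ (by positivity)] at hD
  have he : exp (log 72 + log (1 + k * x) / 2 + 9 * (k * x * s ^ 2)) =
      72 * √(1 + k * x) * exp (9 * (k * x * s ^ 2)) := by
    rw [exp_add, exp_add, exp_log (by norm_num), ← log_sqrt (by positivity), exp_log hs0]
  rw [he]
  calc _ ≤ 2 * (localMax δ k x * exp (9 * (k * x * s ^ 2))) := by gcongr
    _ ≤ 2 * (localSum ((δ : ℝ) * k) x * (36 * √(1 + k * x)) * exp (9 * (k * x * s ^ 2))) := by gcongr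
    _ = _ := by ring

/-- The normalized local factor of `|ζ(1 + it; y)|^{2δk}`. -/
noncomputable def normLocalFactor (δ : ℤ) (k p : ℕ) (t : ℝ) : ℝ :=
  circleNormSq (1 / p) (t * log p) ^ (-(δ * (k : ℤ))) / localSum ((δ : ℝ) * k) (1 / p)

lemma trigSeries_normLocalFactor_of_le {δ : ℤ} (hδ : δ = 1 ∨ δ = -1) (k : ℕ) {p : ℕ} (hp : p.Prime)
    {α W : ℝ} (hα : 0 ≤ α) (hα1 : (p : ℝ) ^ α * (1 / p) < 1)
    (hW : min (((1 - δ * ((p : ℝ) ^ α * (1 / p))) ^ (-(δ * (k : ℤ)))) ^ 2)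
        (2 * ((1 - δ * ((p : ℝ) ^ α * (1 / p))) ^ (-(δ * (k : ℤ))) *
          (1 - δ * ((p : ℝ) ^ (-α) * (1 / p))) ^ (-(δ * (k : ℤ))))) ≤
      localSum ((δ : ℝ) * k) (1 / p) * W) :
    TrigSeries {p} α ⊤ 1 W fun t => (normLocalFactor δ k p t : ℂ) := by
  obtain ⟨h0, h2⟩ := one_div_prime_mem hp
  have hD := localSum_pos hδ k h0 (by linarith)
  have h := ((trigSeries_localFactor hδ k hp hα hα1).mono hW).smul
    (localSum ((δ : ℝ) * k) (1 / p))⁻¹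
  rw [inv_mul_cancel₀ hD.ne', abs_of_pos (inv_pos.mpr hD), ← mul_assoc, inv_mul_cancel₀ hD.ne',
    one_mul] at h
  convert h using 2 with t
  rw [normLocalFactor, div_eq_inv_mul]
  push_cast
  rfl

/-- The first entry of the minimum with p^α ≤ e. The bound α ≤ 1/10 is only needed for p = 2 and 3,
to keep p^{α-1} ≤ 3/5. -/
lemma trigSeries_normLocalFactor_large {δ : ℤ} (hδ : δ = 1 ∨ δ = -1) (k : ℕ) {p : ℕ} (hp : p.Prime)
    {α : ℝ} (hα : 0 ≤ α) (hα1 : α * log p ≤ 1) (hα2 : α ≤ 1 / 10) :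
    TrigSeries {p} α ⊤ 1 (exp (14 * k * (1 / p))) fun t => (normLocalFactor δ k p t : ℂ) := by
  obtain ⟨h0, h2⟩ := one_div_prime_mem hp
  have hp0 : (0 : ℝ) < p := by exact_mod_cast hp.pos
  have hp1 : (2 : ℝ) ≤ p := by exact_mod_cast hp.two_le
  have hρ : (p : ℝ) ^ α = exp (α * log p) := by rw [rpow_def_of_pos hp0, mul_comm]
  have hρ1 : (p : ℝ) ^ α ≤ 2.72 := by
    rw [hρ]
    refine (exp_le_exp.mpr hα1).trans ?_
    linarith [exp_one_lt_d9]
  have hρx : (p : ℝ) ^ α * (1 / p) ≤ 3 / 5 := by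
    rw [mul_one_div, div_le_iff₀ hp0]
    rcases le_or_gt 5 p with h5 | h5
    · have : (5 : ℝ) ≤ p := by exact_mod_cast h5
      linarith
    · have h4 : (p : ℝ) ≤ 4 := by exact_mod_cast (by omega : p ≤ 4)
      have h5 : log p ≤ 1.4 := by
        refine (log_le_log hp0 h4).trans ?_
        rw [show (4 : ℝ) = 2 ^ 2 by norm_num, log_pow]
        have := log_two_lt_d9
        push_cast; linarith
      have h6 : α * log p ≤ 0.14 := by
        have := log_nonneg (by linarith : (1 : ℝ) ≤ p)
        nlinarith
      have h7 : exp (α * log p) ≤ 1.2 := by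
        refine (exp_le_exp.mpr h6).trans ?_
        have := add_one_le_exp (-0.14 : ℝ)
        have h8 : exp (0.14 : ℝ) * exp (-0.14 : ℝ) = 1 := by rw [← exp_add]; norm_num
        nlinarith [exp_pos (0.14 : ℝ)]
      rw [hρ]; linarith
  refine trigSeries_normLocalFactor_of_le hδ k hp hα (by linarith) ((min_le_left _ _).trans ?_)
  refine (localSeries_le_exp hδ k h0 (by positivity) hρ1 hρx).trans ?_
  exact le_mul_of_one_le_left (exp_pos _).le (one_le_localSum hδ k h0 (by linarith))

lemma trigSeries_normLocalFactor_small {δ : ℤ} (hδ : δ = 1 ∨ δ = -1) (k : ℕ) {p : ℕ} (hp : p.Prime)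
    {α : ℝ} (hα : 0 ≤ α) (hα1 : α * log p ≤ 1 / 8) :
    TrigSeries {p} α ⊤ 1
      (exp (log 72 + log (1 + k * (1 / p)) / 2 + 9 * (k * (1 / p) * (α * log p) ^ 2)))
      fun t => (normLocalFactor δ k p t : ℂ) := by
  obtain ⟨h0, h2⟩ := one_div_prime_mem hp
  have hp0 : (0 : ℝ) < p := by exact_mod_cast hp.pos
  have hp1 : (1 : ℝ) ≤ p := by exact_mod_cast hp.one_le
  have hρ : (p : ℝ) ^ α = exp (α * log p) := by rw [rpow_def_of_pos hp0, mul_comm]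
  have hρ' : (p : ℝ) ^ (-α) = exp (-(α * log p)) := by rw [rpow_def_of_pos hp0]; ring_nf
  have hs0 : 0 ≤ α * log p := mul_nonneg hα (log_nonneg hp1)
  refine trigSeries_normLocalFactor_of_le hδ k hp hα ?_ ((min_le_right _ _).trans ?_)
  · rw [hρ]
    have := add_one_le_exp (-(α * log p))
    have h8 : exp (α * log p) * exp (-(α * log p)) = 1 := by rw [← exp_add]; simp
    nlinarith [exp_pos (α * log p)]
  · rw [hρ, hρ']
    exact two_mul_localSeries_le hδ k h0 h2 hs0 hα1

lemma normLocalFactor_pos {δ : ℤ} (hδ : δ = 1 ∨ δ = -1) (k : ℕ) {p : ℕ} (hp : p.Prime) (t : ℝ) :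
    0 < normLocalFactor δ k p t := by
  obtain ⟨h0, h2⟩ := one_div_prime_mem hp
  exact div_pos (zpow_pos (circleNormSq_pos h0 (by linarith) _) _)
    (localSum_pos hδ k h0 (by linarith))

lemma continuous_normLocalFactor (δ : ℤ) (k : ℕ) {p : ℕ} (hp : p.Prime) :
    Continuous (normLocalFactor δ k p) := by
  obtain ⟨h0, h2⟩ := one_div_prime_mem hp
  exact ((continuous_circleNormSq_zpow h0 (by linarith) _).comp (continuous_mul_const _)).div_const _

lemma norm_truncatedZeta_zpow (δ : ℤ) (k : ℕ) (y t : ℝ) :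
    ‖truncatedZeta (1 + (t : ℂ) * Complex.I) y‖ ^ (2 * (δ * (k : ℤ))) =
      ∏ p ∈ Nat.primesBelow (⌊y⌋₊ + 1), circleNormSq (1 / p) (t * log p) ^ (-(δ * (k : ℤ))) := by
  rw [truncatedZeta, norm_prod, ← Finset.prod_zpow]
  refine Finset.prod_congr rfl fun p hp => ?_
  have hp' := Nat.prime_of_mem_primesBelow hp
  have hp0 : (p : ℂ) ≠ 0 := by exact_mod_cast hp'.ne_zero
  have e : (p : ℂ) ^ (-(1 + (t : ℂ) * Complex.I)) =
      ((1 / p : ℝ) : ℂ) * Complex.exp (((-(t * log p) : ℝ) : ℂ) * Complex.I) := by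
    rw [neg_add, Complex.cpow_add _ _ hp0, Complex.cpow_neg_one, Complex.cpow_def_of_ne_zero hp0,
      ← Complex.ofReal_natCast, ← Complex.ofReal_log (Nat.cast_nonneg p)]
    push_cast
    rw [one_div]
    ring_nf
  rw [e, norm_inv, inv_zpow', show -(2 * (δ * (k : ℤ))) = 2 * (-(δ * k)) by ring, zpow_mul, show ((2 : ℤ)) = ((2 : ℕ) : ℤ) by rfl,
    zpow_natCast, normSq_one_sub_mul_exp, circleNormSq, circleNormSq, cos_neg]

/-- Factors out the local means, so that only the mean of the normalized product has to be shown to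
be close to 1. -/
lemma truncatedZetaMoment_eq {δ : ℤ} (hδ : δ = 1 ∨ δ = -1) (k : ℕ) (T y : ℝ) :
    truncatedZetaMoment T y (2 * (δ * k)) = smoothDivisorSum ((δ : ℝ) * k) y *
      ((1 / T) * ∫ t in T..2 * T, ∏ p ∈ Nat.primesBelow (⌊y⌋₊ + 1), normLocalFactor δ k p t) := by
  rw [(summable_and_smoothDivisorSum_eq_prod hδ k y).2, truncatedZetaMoment,
    mul_left_comm (∏ p ∈ _, localSum _ _)]
  refine congrArg (fun x : ℝ => 1 / T * x) ?_
  rw [← intervalIntegral.integral_const_mul]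
  refine intervalIntegral.integral_congr fun t _ => ?_
  rw [norm_truncatedZeta_zpow, ← Finset.prod_mul_distrib]
  refine Finset.prod_congr rfl fun p hp => ?_
  obtain ⟨h0, h2⟩ := one_div_prime_mem (Nat.prime_of_mem_primesBelow hp)
  rw [normLocalFactor, mul_div_cancel₀]
  exact (localSum_pos hδ k h0 (by linarith)).ne'

end LocalLoss

/-! ### Sums over primes from Chebyshev's bound. -/

section ChebyshevSums

open Real MeasureTheory intervalIntegral

/-- Partial summation against Chebyshev's bound for `θ`. -/
lemma sum_primes_mul_log_le {f f' : ℝ → ℝ} {u v : ℝ} (hu : 0 < u) (huv : u ≤ v)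
    (hf : ∀ t ∈ Set.Icc u v, HasDerivAt f (f' t) t) (hf' : ContinuousOn f' (Set.Icc u v))
    (hneg : ∀ t ∈ Set.Icc u v, f' t ≤ 0) (hpos : ∀ t ∈ Set.Icc u v, 0 ≤ f t) :
    ∑ p ∈ (Finset.Ioc ⌊u⌋₊ ⌊v⌋₊).filter Nat.Prime, f p * log p ≤
      log 4 * (u * f u + ∫ t in u..v, f t) := by
  have hderiv : ∀ t ∈ Set.Icc u v, deriv f t = f' t := fun t ht => (hf t ht).deriv
  have hcf : ContinuousOn f (Set.Icc u v) := fun t ht => (hf t ht).continuousAt.continuousWithinAt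
  have hI : ∀ {G : ℝ → ℝ}, ContinuousOn G (Set.Icc u v) → IntervalIntegrable G volume u v :=
    fun hG => ContinuousOn.intervalIntegrable (by rwa [Set.uIcc_of_le huv])
  have habel := sum_mul_eq_sub_sub_integral_mul (f := f)
    (fun n => if n.Prime then log n else 0) hu.le huv
    (fun t ht => (hf t ht).differentiableAt)
    ((hf'.congr hderiv).integrableOn_compact isCompact_Icc)
  have hθ : ∀ t : ℝ, ∑ n ∈ Finset.Icc 0 ⌊t⌋₊, (if n.Prime then log (n : ℝ) else 0) =
      Chebyshev.theta t := fun t => by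
    rw [Chebyshev.theta_eq_sum_Icc, Finset.sum_filter]
  simp only [hθ, mul_ite, mul_zero] at habel
  rw [← Finset.sum_filter, ← integral_of_le huv] at habel
  have hle := fun t (ht : t ∈ Set.Icc u v) =>
    Chebyshev.theta_le_log4_mul_x (x := t) (by linarith [ht.1])
  have h1 : -∫ t in u..v, deriv f t * Chebyshev.theta t ≤ ∫ t in u..v, log 4 * (-(f' t * t)) := by
    rw [← intervalIntegral.integral_neg]
    refine integral_mono_on huv ?_ (hI ((hf'.mul continuousOn_id).neg.const_smul (log 4))) ?_
    · refine IntervalIntegrable.neg ?_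
      refine IntervalIntegrable.continuousOn_mul Chebyshev.theta_mono.intervalIntegrable ?_
      rw [Set.uIcc_of_le huv]
      exact hf'.congr hderiv
    · intro t ht
      rw [hderiv t ht]
      nlinarith [hneg t ht, hle t ht]
  have h2 : ∫ t in u..v, (f' t * t + f t) = f v * v - f u * u := by
    refine integral_eq_sub_of_hasDerivAt (f := fun t => f t * t) (fun t ht => ?_)
      (hI ((hf'.mul continuousOn_id).add hcf))
    rw [Set.uIcc_of_le huv] at ht
    exact ((hf t ht).mul (hasDerivAt_id t)).congr_deriv (by simp)
  have h2' := integral_add (f := fun t => f' t * t) (hI (hf'.mul continuousOn_id)) (hI hcf)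
  rw [h2'] at h2
  rw [intervalIntegral.integral_const_mul, intervalIntegral.integral_neg] at h1
  have h3 : f v * Chebyshev.theta v ≤ f v * (log 4 * v) :=
    mul_le_mul_of_nonneg_left (hle v ⟨huv, le_rfl⟩) (hpos v ⟨huv, le_rfl⟩)
  have h4 : 0 ≤ f u * Chebyshev.theta u :=
    mul_nonneg (hpos u ⟨le_rfl, huv⟩) (Chebyshev.theta_nonneg u)
  have h5 : log 4 * (f v * v - f u * u) =
      log 4 * ((∫ t in u..v, f' t * t) + ∫ t in u..v, f t) := by rw [h2]
  rw [habel]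
  linarith

lemma sum_primes_log_div_le {u v : ℝ} (hu : 0 < u) (huv : u ≤ v) :
    ∑ p ∈ (Finset.Ioc ⌊u⌋₊ ⌊v⌋₊).filter Nat.Prime, log p / p ≤ log 4 * (1 + log (v / u)) := by
  have hpos : ∀ t ∈ Set.Icc u v, 0 < t := fun t ht => by linarith [ht.1]
  have h := sum_primes_mul_log_le (f := fun t => t⁻¹) (f' := fun t => -(t ^ 2)⁻¹) hu huv
    (fun t ht => hasDerivAt_inv (hpos t ht).ne')
    ((continuousOn_pow 2).inv₀ fun t ht => pow_ne_zero 2 (hpos t ht).ne').neg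
    (fun t ht => by have := hpos t ht; simp; positivity) fun t ht => (inv_pos.mpr (hpos t ht)).le
  rw [integral_inv_of_pos hu (by linarith), mul_inv_cancel₀ hu.ne'] at h
  refine le_trans (le_of_eq (Finset.sum_congr rfl fun p _ => ?_)) h
  rw [div_eq_inv_mul]

lemma sum_primes_log_div_sqrt_le {v : ℝ} (hv : 1 ≤ v) :
    ∑ p ∈ (Finset.Ioc 1 ⌊v⌋₊).filter Nat.Prime, log p / √p ≤ log 4 * (2 * √v) := by
  have hpos : ∀ t ∈ Set.Icc 1 v, 0 < t := fun t ht => by linarith [ht.1]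
  have h := sum_primes_mul_log_le (f := fun t => t ^ (-(1 / 2) : ℝ))
    (f' := fun t => -(1 / 2) * t ^ (-(1 / 2) - 1 : ℝ)) zero_lt_one hv
    (fun t ht => hasDerivAt_rpow_const (Or.inl (hpos t ht).ne'))
    (continuousOn_const.mul (continuousOn_id.rpow_const fun t ht => Or.inl (hpos t ht).ne'))
    (fun t ht => by
      have := rpow_pos_of_pos (hpos t ht) (-(1 / 2) - 1 : ℝ)
      linarith) fun t ht => (rpow_pos_of_pos (hpos t ht) _).le
  rw [integral_rpow (Or.inl (by norm_num)), Nat.floor_one, one_rpow, one_rpow] at h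
  have e : v ^ (-(1 / 2) + 1 : ℝ) = √v := by rw [sqrt_eq_rpow]; norm_num
  rw [e] at h
  refine le_trans (le_of_eq (Finset.sum_congr rfl fun p _ => ?_)) (h.trans ?_)
  · rw [rpow_neg (Nat.cast_nonneg p), ← sqrt_eq_rpow, div_eq_inv_mul]
  · have : 0 < log 4 := log_pos (by norm_num)
    refine mul_le_mul_of_nonneg_left ?_ this.le
    norm_num
    linarith

lemma sum_primes_inv_le {u v : ℝ} (hu : 1 < u) (huv : u ≤ v) :
    ∑ p ∈ (Finset.Ioc ⌊u⌋₊ ⌊v⌋₊).filter Nat.Prime, 1 / (p : ℝ) ≤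
      log 4 * (1 + log (v / u)) / log u := by
  have hlu := log_pos hu
  rw [le_div_iff₀ hlu, Finset.sum_mul]
  refine le_trans (Finset.sum_le_sum fun p hp => ?_) (sum_primes_log_div_le (by linarith) huv)
  have hp' := (Finset.mem_Ioc.mp (Finset.mem_filter.mp hp).1).1
  have hup : u < p := (Nat.floor_lt (by linarith)).mp hp'
  rw [one_div_mul_eq_div]
  have : log u ≤ log p := log_le_log (by linarith) hup.le
  gcongr

/-- `∑_{p ≤ x} √(x / p) ≪ x / log x`. -/
lemma sum_primes_sqrt_div_le {x : ℝ} (hx : 1 < x) :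
    ∑ p ∈ (Finset.Ioc 1 ⌊x⌋₊).filter Nat.Prime, √(x / p) ≤
      4 * x ^ (3 / 4 : ℝ) + 5.6 * (x / log x) := by
  have hx0 : 0 < x := by linarith
  have hlx := log_pos hx
  have hs1 : 1 ≤ √x := by rw [one_le_sqrt]; linarith
  have hss : √x * √x = x := mul_self_sqrt hx0.le
  have hl4 : log 4 = 2 * log 2 := by
    rw [show (4 : ℝ) = 2 ^ 2 by norm_num, log_pow]; norm_num
  have hl2 := log_two_lt_d9
  have hl2' := log_two_gt_d9
  rw [sum_primes_consecutive _ (Nat.one_le_floor_iff _ |>.mpr hs1)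
    (Nat.floor_mono (by nlinarith : √x ≤ x))]
  have h1 : ∑ p ∈ (Finset.Ioc 1 ⌊√x⌋₊).filter Nat.Prime, √(x / p) ≤ 4 * x ^ (3 / 4 : ℝ) := by
    calc _ ≤ ∑ p ∈ (Finset.Ioc 1 ⌊√x⌋₊).filter Nat.Prime, √x / log 2 * (log p / √p) := by
          refine Finset.sum_le_sum fun p hp => ?_
          have hp2 : (2 : ℝ) ≤ p := by exact_mod_cast (Finset.mem_filter.mp hp).2.two_le
          have h2 : log 2 ≤ log p := log_le_log (by norm_num) hp2
          have hsp : 0 < √(p : ℝ) := sqrt_pos.mpr (by linarith)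
          rw [sqrt_div hx0.le, div_mul_div_comm, div_le_div_iff₀ hsp (by positivity)]
          calc √x * (log 2 * √p) ≤ √x * (log p * √p) := by gcongr
            _ = _ := by ring
      _ = √x / log 2 * ∑ p ∈ (Finset.Ioc 1 ⌊√x⌋₊).filter Nat.Prime, log p / √p := by
          rw [Finset.mul_sum]
      _ ≤ √x / log 2 * (log 4 * (2 * √(√x))) := by
          gcongr
          exact sum_primes_log_div_sqrt_le hs1
      _ = 4 * (√x * √(√x)) := by rw [hl4]; field_simp; ring
      _ = 4 * x ^ (3 / 4 : ℝ) := by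
          rw [sqrt_eq_rpow, sqrt_eq_rpow, ← rpow_mul hx0.le, ← rpow_add hx0]; norm_num
  -- Above √x one has log x ≤ 2 log p, which supplies the saving of log x; below, only log p ≥ log 2
  -- is used. The constant 5.6 exceeds 4 log 4.
  have h2 : ∑ p ∈ (Finset.Ioc ⌊√x⌋₊ ⌊x⌋₊).filter Nat.Prime, √(x / p) ≤ 5.6 * (x / log x) := by
    calc _ ≤ ∑ p ∈ (Finset.Ioc ⌊√x⌋₊ ⌊x⌋₊).filter Nat.Prime, 2 * √x / log x * (log p / √p) := by
          refine Finset.sum_le_sum fun p hp => ?_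
          have hp2 : (2 : ℝ) ≤ p := by exact_mod_cast (Finset.mem_filter.mp hp).2.two_le
          have hp' := (Finset.mem_Ioc.mp (Finset.mem_filter.mp hp).1).1
          have hup : √x < p := (Nat.floor_lt (by linarith)).mp hp'
          have h2 : log x ≤ 2 * log p := by
            have := log_le_log (by linarith) hup.le
            rw [log_sqrt hx0.le] at this
            linarith
          have hsp : 0 < √(p : ℝ) := sqrt_pos.mpr (by linarith)
          rw [sqrt_div hx0.le, div_mul_div_comm, div_le_div_iff₀ hsp (by positivity)]
          calc √x * (log x * √p) ≤ √x * (2 * log p * √p) := by gcongr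
            _ = _ := by ring
      _ ≤ ∑ p ∈ (Finset.Ioc 1 ⌊x⌋₊).filter Nat.Prime, 2 * √x / log x * (log p / √p) := by
          refine Finset.sum_le_sum_of_subset_of_nonneg (Finset.filter_subset_filter _
            (Finset.Ioc_subset_Ioc_left (Nat.one_le_floor_iff _ |>.mpr hs1))) fun p hp _ => ?_
          have hp2 : (2 : ℝ) ≤ p := by exact_mod_cast (Finset.mem_filter.mp hp).2.two_le
          have := log_nonneg (by linarith : (1 : ℝ) ≤ p)
          positivity
      _ = 2 * √x / log x * ∑ p ∈ (Finset.Ioc 1 ⌊x⌋₊).filter Nat.Prime, log p / √p := by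
          rw [Finset.mul_sum]
      _ ≤ 2 * √x / log x * (log 4 * (2 * √x)) := by
          gcongr
          exact sum_primes_log_div_sqrt_le hx.le
      _ = 4 * log 4 * (√x * √x) / log x := by ring
      _ ≤ 5.6 * (x / log x) := by
          rw [hss, mul_div_assoc]
          gcongr
          rw [hl4]; linarith
  linarith

end ChebyshevSums

/-! ### The criterion for a partition into blocks. -/

section BlockCriterion

open Real ENNReal

lemma TrigSeries.mono_bound {B : Set ℕ} {α M S : ℝ} {X X' : ℝ≥0∞} {g : ℝ → ℂ}
    (h : TrigSeries B α X M S g) (hX : X ≤ X') : TrigSeries B α X' M S g := by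
  obtain ⟨ι, hι, c, m, n, h1, h2, h3, h4⟩ := h
  exact ⟨ι, hι, c, m, n, fun i => ⟨(h1 i).1, (h1 i).2.1, (h1 i).2.2.1, (h1 i).2.2.2.trans hX⟩,
    h2, h3, h4⟩

/-- A partition of the primes up to `y` into `N` blocks on which the loss `∑ w p` is smaller than
the gain `α j * H j` controls the mean value of the product of the local factors. -/
lemma abs_mean_normLocalFactor_sub_one_le {δ : ℤ} (hδ : δ = 1 ∨ δ = -1) (k : ℕ) (P : Finset ℕ)
    (hP : ∀ p ∈ P, p.Prime) (b : ℕ → ℕ) (N : ℕ) (hb : ∀ p ∈ P, b p < N) (α H w : ℕ → ℝ)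
    {L η : ℝ} (hα : ∀ j, 0 ≤ α j) (hH : ∀ j, 0 ≤ H j) (hη : 0 ≤ η) (hNη : N * exp (-η) ≤ 1)
    (hw : ∀ p ∈ P, TrigSeries {p} (α (b p)) ⊤ 1 (exp (w p)) fun t => (normLocalFactor δ k p t : ℂ))
    (hloss : ∀ j < N, ∑ p ∈ P with b p = j, w p ≤ α j * H j - η)
    (hHL : ∑ j ∈ Finset.range N, H j ≤ L / 3) (hαL : ∑ j ∈ Finset.range N, α j * H j ≤ L / 3) :
    |(1 / exp L) * (∫ t in exp L..2 * exp L, ∏ p ∈ P, normLocalFactor δ k p t) - 1| ≤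
      8 * (N * exp (-η)) + 3 * (2 ^ (N + 1) * exp (-(L / 3))) := by
  have hfib : ∀ t, ∏ p ∈ P, normLocalFactor δ k p t =
      ∏ j ∈ Finset.range N, ∏ p ∈ P with b p = j, normLocalFactor δ k p t := fun t =>
    (Finset.prod_fiberwise_of_maps_to (fun p hp => Finset.mem_range.mpr (hb p hp)) _).symm
  simp only [hfib]
  have hε : 0 < exp (-η) := exp_pos _
  refine (abs_mean_prod_sub_one_le (Finset.range N)
    (fun j => ⋃ p ∈ P.filter (b · = j), {p}) α H (fun j => exp (∑ p ∈ P with b p = j, w p))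
    (fun j t => ∏ p ∈ P with b p = j, normLocalFactor δ k p t) (exp_pos L) hε
    (fun j _ => hα j) (fun j _ => hH j) ?_ ?_ ?_ ?_ (exp_le_one_iff.mpr (by linarith)) ?_).trans ?_
  · intro i _ j _ hij
    rw [Set.disjoint_left]
    intro q hq hq'
    simp only [Set.mem_iUnion, Finset.mem_filter, Set.mem_singleton_iff, exists_prop] at hq hq'
    obtain ⟨p, ⟨-, h1⟩, rfl⟩ := hq
    obtain ⟨p', ⟨-, h2⟩, rfl⟩ := hq'
    exact hij (h1.symm.trans h2)
  · intro j _
    have h := TrigSeries.prod (P.filter (b · = j)) (fun p => {p}) (fun _ => ⊤) (fun _ => 1)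
      (fun p => exp (w p)) (fun p t => (normLocalFactor δ k p t : ℂ)) (hα j)
      (fun p hp => by
        obtain ⟨h1, h2⟩ := Finset.mem_filter.mp hp
        simpa only [h2] using hw p h1)
      (fun i _ j _ hij => Set.disjoint_singleton.mpr hij)
    rw [Finset.prod_const_one, ← exp_sum] at h
    convert h.mono_bound le_top using 2 with t
    push_cast
    rfl
  · exact fun j _ t => Finset.prod_nonneg fun p hp =>
      (normLocalFactor_pos hδ k (hP p (Finset.mem_filter.mp hp).1) t).le
  · exact fun j _ => continuous_finsetProd _ fun p hp =>
      continuous_normLocalFactor δ k (hP p (Finset.mem_filter.mp hp).1)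
  · intro j hj
    rw [← exp_add]
    exact exp_le_exp.mpr (by linarith [hloss j (Finset.mem_range.mp hj)])
  · set ε := exp (-η)
    have h1 : (1 + ε) ^ N ≤ 1 + 2 * (N * ε) := by
      have h2 : (1 + ε) ^ N ≤ exp (N * ε) := by
        rw [exp_nat_mul]
        exact pow_le_pow_left₀ (by linarith) (by linarith [add_one_le_exp ε]) _
      have h3 := abs_exp_sub_one_le (x := N * ε) (by rwa [abs_of_nonneg (by positivity)])
      rw [abs_of_nonneg (a := N * ε) (by positivity)] at h3
      linarith [le_abs_self (exp (N * ε) - 1)]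
    have h4 : (∏ j ∈ Finset.range N, 2 * exp (α j * H j)) ≤ 2 ^ N * exp (L / 3) := by
      rw [Finset.prod_mul_distrib, Finset.prod_const, Finset.card_range, ← exp_sum]
      gcongr
    have h5 : exp (∑ j ∈ Finset.range N, H j) ≤ exp (L / 3) := exp_le_exp.mpr hHL
    rw [Finset.card_range]
    have h6 : 0 ≤ N * ε := by positivity
    -- Height e^{L/3} and coefficient sum 2^N e^{L/3} against T = e^L leave a factor e^{-L/3}.
    have h7 : (1 + 2 * N * ε) * (2 * exp (∑ j ∈ Finset.range N, H j) *
        ∏ j ∈ Finset.range N, 2 * exp (α j * H j)) / exp L ≤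
        3 * (2 * exp (L / 3) * (2 ^ N * exp (L / 3))) / exp L := by
      gcongr
      linarith
    have h8 : 3 * (2 * exp (L / 3) * (2 ^ N * exp (L / 3))) / exp L =
        3 * (2 ^ (N + 1) * exp (-(L / 3))) := by
      rw [div_eq_iff (exp_pos _).ne']
      have : exp (L / 3) * exp (L / 3) = exp (-(L / 3)) * exp L := by
        rw [← exp_add, ← exp_add]; ring_nf
      rw [pow_succ]
      linear_combination 6 * 2 ^ N * this
    nlinarith

end BlockCriterion

/-! ### Total loss over a block of primes. -/

section BlockLosses

open Real

/-- With v = log(k/p), the logarithmic loss at p is at most 1.8v. The further factor v² pays for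
16^j, and the right side is 20√(k/p), whose sum over primes is O(k / log k). -/
lemma mul_pow_le_sqrt {v : ℝ} (hv : 4 ≤ v) : 1.8 * v * v ^ 2 ≤ 20 * exp (v / 2) := by
  have h1 := add_one_le_exp (v / 6 - 1)
  have h2 : (v / 6) ^ 3 ≤ exp (v / 6 - 1) ^ 3 :=
    pow_le_pow_left₀ (by linarith) (by linarith) 3
  have h3 : exp (v / 6 - 1) ^ 3 * exp 1 ^ 3 = exp (v / 2) := by
    rw [← exp_nat_mul, ← exp_nat_mul, ← exp_add]
    ring_nf
  have h4 : (2.7 : ℝ) ^ 3 ≤ exp 1 ^ 3 :=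
    pow_le_pow_left₀ (by norm_num) (by linarith [exp_one_gt_d9]) 3
  have h5 : (0 : ℝ) ≤ exp (v / 6 - 1) ^ 3 := by positivity
  nlinarith [mul_le_mul_of_nonneg_left h4 h5]

/-- The logarithmic losses are at most 16^{-j} · 20√(k/p). In the quadratic losses α_j² brings
64^{-j}, while the sum of log p / p over the block is O(4^j). So both parts are of size 16^{-j} k/l,
like the gain α_j H_j. -/
lemma sum_loss_small_le {k j : ℕ} {l q : ℝ} (hj : 1 ≤ j) (P : Finset ℕ)
    (hP : ∀ p ∈ P, p.Prime ∧ 4 ^ j ≤ log (k / p) ∧ log (k / p) < 4 ^ (j + 1))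
    (hl : 0 < l) (hk : l / 2 ≤ log k) (hkq : log k ≤ q) (hlq : l ≤ q)
    (hs : ∑ p ∈ (Finset.Ioc 1 ⌊(k : ℝ)⌋₊).filter Nat.Prime, √(k / p) ≤ 7 * (k / log k)) :
    ∑ p ∈ P, (log 72 + log (1 + k * (1 / p)) / 2 +
      9 * (k * (1 / p) * ((1 / 8) ^ j / q * log p) ^ 2)) ≤ (1 / 16) ^ j * (334 * (k / l)) := by
  have hlk : 0 < log k := by linarith
  have hq : 0 < q := by linarith
  have hk1 : (1 : ℝ) < k := by
    by_contra h
    push Not at h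
    have := log_nonpos (Nat.cast_nonneg k) h
    linarith
  have h4j : (4 : ℝ) ≤ 4 ^ j := by
    calc (4 : ℝ) = 4 ^ 1 := by norm_num
      _ ≤ 4 ^ j := pow_le_pow_right₀ (by norm_num) hj
  have hlog : ∀ p ∈ P, log (k / p) = log k - log p := fun p hp =>
    log_div (by linarith) (by exact_mod_cast (hP p hp).1.ne_zero)
  have hpk : ∀ p ∈ P, (p : ℝ) ≤ k := fun p hp => by
    have hp0 : (0 : ℝ) < p := by exact_mod_cast (hP p hp).1.pos
    have := (hP p hp).2.1
    rw [hlog p hp] at this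
    exact (log_le_log_iff hp0 (by linarith)).mp (by linarith)
  rw [Finset.sum_add_distrib]
  have hA : ∑ p ∈ P, (log 72 + log (1 + k * (1 / p)) / 2) ≤ (1 / 16) ^ j * (280 * (k / l)) := by
    calc _ ≤ ∑ p ∈ P, (1 / 16) ^ j * (20 * √(k / p)) := by
          refine Finset.sum_le_sum fun p hp => ?_
          have hp0 : (0 : ℝ) < p := by exact_mod_cast (hP p hp).1.pos
          have hv1 := (hP p hp).2.1
          set v := log (k / p) with hv
          have hkp : 0 < (k : ℝ) / p := by positivity
          have e1 : √(k / p) = exp (v / 2) := by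
            rw [hv, ← log_sqrt hkp.le, exp_log (sqrt_pos.mpr hkp)]
          have h1 : log (1 + k * (1 / p)) ≤ log 2 + v := by
            rw [hv, ← log_mul (by norm_num) hkp.ne']
            refine log_le_log (by positivity) ?_
            have : 1 ≤ (k : ℝ) / p := (one_le_div hp0).mpr (hpk p hp)
            rw [mul_one_div]; linarith
          have h2 : log 72 ≤ 7 * log 2 := by
            have : log 72 ≤ log (2 ^ 7) := log_le_log (by norm_num) (by norm_num)
            rw [log_pow] at this
            exact_mod_cast this
          have h3 := log_two_lt_d9
          have h4 := mul_pow_le_sqrt (h4j.trans hv1)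
          have h5 : (16 : ℝ) ^ j ≤ v ^ 2 := by
            calc (16 : ℝ) ^ j = (4 ^ j) ^ 2 := by rw [← pow_mul, mul_comm, pow_mul]; norm_num
              _ ≤ v ^ 2 := pow_le_pow_left₀ (by positivity) hv1 2
          have h6 : (0 : ℝ) < 16 ^ j := by positivity
          rw [e1, one_div_pow, div_mul_eq_mul_div, le_div_iff₀ h6, one_mul]
          refine le_trans ?_ h4
          have h7 := h4j.trans hv1
          exact mul_le_mul (by linarith) h5 h6.le (by linarith)
      _ = (1 / 16) ^ j * (20 * ∑ p ∈ P, √(k / p)) := by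
          rw [Finset.mul_sum, Finset.mul_sum]
      _ ≤ (1 / 16) ^ j * (20 * (7 * (k / log k))) := by
          gcongr
          refine le_trans (Finset.sum_le_sum_of_subset_of_nonneg (fun p hp => ?_)
            fun p _ _ => sqrt_nonneg _) hs
          rw [Finset.mem_filter, Finset.mem_Ioc]
          exact ⟨⟨(hP p hp).1.one_lt, Nat.le_floor (hpk p hp)⟩, (hP p hp).1⟩
      _ ≤ (1 / 16) ^ j * (20 * (7 * (k / (l / 2)))) := by gcongr
      _ = _ := by rw [div_div_eq_mul_div]; ring
  have hB : ∑ p ∈ P, 9 * (k * (1 / p) * ((1 / 8) ^ j / q * log p) ^ 2) ≤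
      (1 / 16) ^ j * (54 * (k / l)) := by
    have hu : 0 < k * exp (-4 ^ (j + 1)) := by positivity
    have huk : k * exp (-4 ^ (j + 1)) ≤ k :=
      mul_le_of_le_one_right (Nat.cast_nonneg k) (exp_le_one_iff.mpr (by simp))
    calc _ ≤ ∑ p ∈ P, 9 * k * ((1 / 8) ^ j / q) ^ 2 * q * (log p / p) := by
          refine Finset.sum_le_sum fun p hp => ?_
          have hp1 : (1 : ℝ) ≤ p := by exact_mod_cast (hP p hp).1.one_le
          have h1 : log p ≤ q := (log_le_log (by linarith) (hpk p hp)).trans hkq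
          have h2 := log_nonneg hp1
          calc 9 * (k * (1 / p) * ((1 / 8) ^ j / q * log p) ^ 2) =
              9 * k * ((1 / 8) ^ j / q) ^ 2 * log p * (log p / p) := by ring
            _ ≤ _ := by gcongr
      _ = 9 * k * ((1 / 8) ^ j / q) ^ 2 * q * ∑ p ∈ P, log p / p := by rw [Finset.mul_sum]
      _ ≤ 9 * k * ((1 / 8) ^ j / q) ^ 2 * q * (log 4 * (1 + log (k / (k * exp (-4 ^ (j + 1)))))) := by
          gcongr
          refine le_trans (Finset.sum_le_sum_of_subset_of_nonneg (fun p hp => ?_) fun p hp _ => ?_)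
            (sum_primes_log_div_le hu huk)
          · have hp0 : (0 : ℝ) < p := by exact_mod_cast (hP p hp).1.pos
            rw [Finset.mem_filter, Finset.mem_Ioc]
            refine ⟨⟨(Nat.floor_lt hu.le).mpr ?_, Nat.le_floor (hpk p hp)⟩, (hP p hp).1⟩
            have h1 := (hP p hp).2.2
            rw [log_lt_iff_lt_exp (by positivity), div_lt_iff₀ hp0] at h1
            rw [exp_neg, ← div_eq_mul_inv, div_lt_iff₀ (exp_pos _)]
            linarith
          · exact div_nonneg (log_natCast_nonneg p) (Nat.cast_nonneg p)
      _ = 9 * k * (1 / 64) ^ j / q * (log 4 * (1 + 4 * 4 ^ j)) := by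
          have e1 : (k : ℝ) / (k * exp (-4 ^ (j + 1))) = exp (4 ^ (j + 1)) := by
            rw [exp_neg]
            field_simp
          have e2 : (((1 : ℝ) / 8) ^ j / q) ^ 2 * q = (1 / 64) ^ j / q := by
            rw [div_pow, ← pow_mul, mul_comm j 2, pow_mul]
            field_simp
            norm_num
          rw [e1, log_exp, mul_assoc (9 * (k : ℝ)), e2, pow_succ]
          ring
      _ ≤ 9 * k * (1 / 64) ^ j / l * (1.4 * (4.25 * 4 ^ j)) := by
          have : log 4 ≤ 1.4 := by
            rw [show (4 : ℝ) = 2 ^ 2 by norm_num, log_pow]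
            have := log_two_lt_d9
            push_cast; linarith
          gcongr
          linarith
      _ = (1 / 16) ^ j * (53.55 * (k / l)) := by
          have e : ((1 : ℝ) / 64) ^ j * 4 ^ j = (1 / 16) ^ j := by
            rw [← mul_pow]; norm_num
          rw [← e]; ring
      _ ≤ _ := by gcongr; norm_num
  calc _ ≤ _ := add_le_add hA hB
    _ = _ := by ring

/-- Mertens-type summation of 1/p over k e^{-4} < p ≤ y. As log k ≥ l/2 and l ≥ 16, the denominator
log k - 4 is at least l/4. -/
lemma sum_loss_large_le {k : ℕ} {l y : ℝ} (P : Finset ℕ)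
    (hP : ∀ p ∈ P, p.Prime ∧ log (k / p) < 4 ∧ (p : ℝ) ≤ y) (hl : 16 ≤ l) (hk : l / 2 ≤ log k)
    (hky : (k : ℝ) ≤ y) :
    ∑ p ∈ P, 14 * k * (1 / (p : ℝ)) ≤ 77.65 * (k * (5 + log (y / k)) / l) := by
  have hk1 : (1 : ℝ) < k := by
    by_contra h
    push Not at h
    have := log_nonpos (Nat.cast_nonneg k) h
    linarith
  have hu : 0 < k * exp (-4) := by positivity
  have hlu : log (k * exp (-4)) = log k - 4 := by
    rw [log_mul (by linarith) (exp_pos _).ne', log_exp]; ring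
  have hu1 : 1 < k * exp (-4) := by
    rw [← log_pos_iff hu.le, hlu]
    linarith
  have huk : k * exp (-4) ≤ y :=
    (mul_le_of_le_one_right (Nat.cast_nonneg k) (exp_le_one_iff.mpr (by norm_num))).trans hky
  have h5 : 0 ≤ log (y / k) := log_nonneg ((one_le_div (by linarith)).mpr hky)
  rw [← Finset.mul_sum]
  calc _ ≤ 14 * k * (log 4 * (1 + log (y / (k * exp (-4)))) / log (k * exp (-4))) := by
        gcongr
        refine le_trans (Finset.sum_le_sum_of_subset_of_nonneg (fun p hp => ?_) fun p hp _ => ?_)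
            (sum_primes_inv_le hu1 huk)
        · have hp0 : (0 : ℝ) < p := by exact_mod_cast (hP p hp).1.pos
          rw [Finset.mem_filter, Finset.mem_Ioc]
          refine ⟨⟨(Nat.floor_lt hu.le).mpr ?_, Nat.le_floor (hP p hp).2.2⟩, (hP p hp).1⟩
          have h1 := (hP p hp).2.1
          rw [log_lt_iff_lt_exp (by positivity), div_lt_iff₀ hp0] at h1
          rw [exp_neg, ← div_eq_mul_inv, div_lt_iff₀ (exp_pos _)]
          linarith
        · positivity
    _ = 14 * log 4 * (k * (5 + log (y / k)) / (log k - 4)) := by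
        rw [hlu, ← div_div, log_div (div_pos (by linarith) (by linarith)).ne' (exp_pos _).ne',
          log_exp]
        ring
    _ ≤ 14 * 1.3865 * (k * (5 + log (y / k)) / (l / 4)) := by
        have : log 4 ≤ 1.3865 := by
          rw [show (4 : ℝ) = 2 ^ 2 by norm_num, log_pow]
          have := log_two_lt_d9
          push_cast; linarith
        have h6 : 0 < log k - 4 := by linarith
        gcongr
        linarith
    _ = 77.644 * (k * (5 + log (y / k)) / l) := by rw [div_div_eq_mul_div]; ring
    _ ≤ _ := by gcongr; norm_num

end BlockLosses

/-! ### Choice of the blocks; here l = log log T and L = log T. -/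

section MeanValue

open Real

lemma prime_le_of_mem_primesBelow_floor {p : ℕ} {y : ℝ} (hy : 0 ≤ y)
    (hp : p ∈ Nat.primesBelow (⌊y⌋₊ + 1)) : p.Prime ∧ (p : ℝ) ≤ y :=
  ⟨Nat.prime_of_mem_primesBelow hp,
    (Nat.le_floor_iff hy).mp (Nat.lt_succ_iff.mp (Nat.lt_of_mem_primesBelow hp))⟩

/-- The case log k ≥ l/2. Block 0 contains the primes with log(k/p) < 4, and block j ≥ 1 those with
4^j ≤ log(k/p) < 4^{j+1}. In every block the loss is below 16^{-j} L/(24l), at most half of the gain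
α_j H_j, and the other half yields the truncation error exp(-L/l⁴). -/
lemma abs_mean_sub_one_le_of_large {δ : ℤ} (hδ : δ = 1 ∨ δ = -1) {k : ℕ} {l y : ℝ} (hl : 24 ≤ l)
    (hLy : 2 ≤ log (y / exp l)) (hy : 0 < y) (hyl : log y ≤ 2 * l) (hk1 : l / 2 ≤ log k)
    (hk : k * log (y / exp l) ≤ exp (-10) * exp l)
    (hs : ∑ p ∈ (Finset.Ioc 1 ⌊(k : ℝ)⌋₊).filter Nat.Prime, √(k / p) ≤ 7 * (k / log k))
    (hη : (l + 1) * exp (-(exp l / l ^ 4)) ≤ 1) :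
    |(1 / exp (exp l)) * (∫ t in exp (exp l)..2 * exp (exp l),
        ∏ p ∈ Nat.primesBelow (⌊y⌋₊ + 1), normLocalFactor δ k p t) - 1| ≤
      8 * ((l + 1) * exp (-(exp l / l ^ 4))) + 3 * (exp (l + 2) * exp (-(exp l / 3))) := by
  set L := exp l with hL
  have hL0 : 0 < L := exp_pos l
  have hlogL : log L = l := log_exp l
  set q := log y with hq
  have hk0 : (0 : ℝ) < k := by
    rcases Nat.eq_zero_or_pos k with h | h
    · rw [h] at hk1
      simp at hk1
      linarith
    · exact_mod_cast h
  have hlyq : log (y / L) = q - l := by rw [log_div hy.ne' hL0.ne', hlogL]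
  have hlq : l ≤ q := by linarith
  have he10 : (2.7182 : ℝ) ^ 10 ≤ exp 10 := by
    have := pow_le_pow_left₀ (by norm_num) (by linarith [exp_one_gt_d9] : (2.7182 : ℝ) ≤ exp 1) 10
    rwa [← exp_nat_mul, mul_one, Nat.cast_ofNat] at this
  have hem10 : exp (-10) ≤ 1 / 21000 := by
    rw [exp_neg, ← one_div]
    exact one_div_le_one_div_of_le (by norm_num) (le_trans (by norm_num) he10)
  have hkL : (k : ℝ) ≤ exp (-10) / 2 * L := by nlinarith
  have hkL1 : (k : ℝ) ≤ L := by nlinarith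
  have hLy' : L ≤ y := by
    have : 0 ≤ log (y / L) := by linarith
    rw [hlyq] at this
    rw [← exp_log hy, hL]
    exact exp_le_exp.mpr (by linarith)
  have hky : (k : ℝ) ≤ y := hkL1.trans hLy'
  have hlogk : log k ≤ l := by
    rw [← hlogL]; exact log_le_log hk0 hkL1
  -- the relative size of `k` after weighting by logarithms
  have hmain : k * (5 + log (y / k)) ≤ 9 * exp (-10) * L := by
    have e1 : log (y / k) = log (y / L) + log (L / k) := by
      rw [← log_mul (by positivity) (by positivity)]
      congr 1
      field_simp
    -- From log u ≤ u - 1 at u = e^{-10} L/k; it controls k log(L/k) even when k is far below L.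
    have e2 : log (L / k) ≤ 9 + exp (-10) * (L / k) := by
      have h := log_le_sub_one_of_pos (show 0 < exp (-10) * (L / k) by positivity)
      rw [log_mul (exp_pos _).ne' (by positivity), log_exp] at h
      linarith
    have e3 : k * log (L / k) ≤ 9 * k + exp (-10) * L := by
      calc _ ≤ k * (9 + exp (-10) * (L / k)) := by gcongr
        _ = _ := by field_simp
    rw [e1]
    nlinarith
  set b : ℕ → ℕ := fun p => Nat.log 4 ⌊log (k / p)⌋₊ with hb
  set N := Nat.log 4 ⌊l⌋₊ + 1 with hN
  -- The powers 8^{-j} and 2^{-j} are chosen so that gain and loss both scale like 16^{-j}, while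
  -- the heights form a geometric series with sum at most L/3.
  set α : ℕ → ℝ := fun j => (1 / 8) ^ j / q with hα
  set H : ℕ → ℝ := fun j => (1 / 2) ^ j * (L / 6) with hH
  have hαH : ∀ j, α j * H j = (1 / 16) ^ j * (L / (6 * q)) := fun j => by
    have : ((1 : ℝ) / 16) ^ j = (1 / 8) ^ j * (1 / 2) ^ j := by rw [← mul_pow]; norm_num
    rw [this, hα, hH]
    field_simp
  have hq0 : 0 < q := by linarith
  have h4 : ∀ j < N, (4 : ℝ) ^ j ≤ l := fun j hj => by
    have h1 : 4 ^ j ≤ ⌊l⌋₊ :=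
      (Nat.pow_le_pow_right (by norm_num) (Nat.lt_succ_iff.mp hj)).trans
        (Nat.pow_log_le_self 4 (Nat.floor_pos.mpr (by linarith)).ne')
    calc (4 : ℝ) ^ j = ((4 ^ j : ℕ) : ℝ) := by push_cast; rfl
      _ ≤ ⌊l⌋₊ := by exact_mod_cast h1
      _ ≤ l := Nat.floor_le (by linarith)
  -- The gain is at least 16^{-j} L/(12l), since log y ≤ 2l. As 16^j ≤ l² and 24 ≤ l, half of it
  -- dominates L/l⁴.
  have hgain : ∀ j < N, (1 / 16) ^ j * (L / (24 * l)) ≤ α j * H j - L / l ^ 4 := fun j hj => by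
    have h16 : (16 : ℝ) ^ j ≤ l ^ 2 := by
      calc (16 : ℝ) ^ j = (4 ^ j) ^ 2 := by rw [← pow_mul, mul_comm, pow_mul]; norm_num
        _ ≤ l ^ 2 := pow_le_pow_left₀ (by positivity) (h4 j hj) 2
    have h1 : L / l ^ 4 ≤ (1 / 16) ^ j * (L / (24 * l)) := by
      rw [one_div_pow, one_div_mul_eq_div, div_div]
      refine div_le_div_of_nonneg_left hL0.le (by positivity) ?_
      calc 24 * l * 16 ^ j ≤ l * l * l ^ 2 := by gcongr
        _ = l ^ 4 := by ring
    have h2 : (1 / 16) ^ j * (L / (12 * l)) ≤ α j * H j := by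
      rw [hαH]
      gcongr ?_ * (L / ?_)
      linarith
    have h3 : (1 / 16) ^ j * (L / (12 * l)) = 2 * ((1 / 16) ^ j * (L / (24 * l))) := by
      field_simp; norm_num
    linarith
  have hN1 : (N : ℝ) ≤ l + 1 := by
    rw [hN]
    push_cast
    have h1 : (Nat.log 4 ⌊l⌋₊ : ℝ) ≤ ⌊l⌋₊ := by exact_mod_cast Nat.log_le_self 4 _
    have h2 := Nat.floor_le (by linarith : 0 ≤ l)
    linarith
  have hb0 : ∀ p, b p = 0 → log (k / p) < 4 := fun p h => by
    rw [hb] at h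
    rcases Nat.log_eq_zero_iff.mp h with h | h
    · by_contra hc
      push Not at hc
      have : 4 ≤ ⌊log (k / p)⌋₊ := Nat.le_floor (by exact_mod_cast hc)
      omega
    · omega
  have hbj : ∀ p, b p ≠ 0 → 4 ^ b p ≤ log (k / p) ∧ log (k / p) < 4 ^ (b p + 1) := fun p h => by
    have hv : 4 ≤ ⌊log (k / p)⌋₊ := by
      by_contra hc
      exact h (Nat.log_of_lt (by omega))
    have hv0 : 0 ≤ log (k / p) := by
      by_contra hc
      rw [Nat.floor_of_nonpos (by linarith)] at hv
      omega
    constructor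
    · calc (4 : ℝ) ^ b p = ((4 ^ b p : ℕ) : ℝ) := by push_cast; rfl
        _ ≤ ⌊log (k / p)⌋₊ := by exact_mod_cast Nat.pow_log_le_self 4 (by omega)
        _ ≤ _ := Nat.floor_le hv0
    · have h1 : ⌊log (k / p)⌋₊ < 4 ^ (b p + 1) := Nat.lt_pow_succ_log_self (by norm_num) _
      have := (Nat.floor_lt hv0).mp h1
      exact_mod_cast this
  have hP := fun p hp => prime_le_of_mem_primesBelow_floor (p := p) hy.le hp
  have hpq : ∀ p ∈ Nat.primesBelow (⌊y⌋₊ + 1), log p ≤ q := fun p hp =>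
    log_le_log (by exact_mod_cast (hP p hp).1.pos) (hP p hp).2
  refine (abs_mean_normLocalFactor_sub_one_le hδ k (Nat.primesBelow (⌊y⌋₊ + 1))
    (fun p hp => (hP p hp).1) b N (fun p hp => ?_) α H
    (fun p => if b p = 0 then 14 * k * (1 / (p : ℝ)) else log 72 + log (1 + k * (1 / p)) / 2 +
      9 * (k * (1 / p) * (α (b p) * log p) ^ 2)) (η := L / l ^ 4) (fun j => by positivity)
    (fun j => by positivity) (by positivity) (le_trans (by gcongr) hη) (fun p hp => ?_)
    (fun j hj => ?_) ?_ ?_).trans ?_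
  · refine Nat.lt_succ_of_le (Nat.log_mono_right (Nat.floor_mono ?_))
    have hp1 : (1 : ℝ) ≤ p := by exact_mod_cast (hP p hp).1.one_le
    rw [log_div hk0.ne' (by linarith)]
    linarith [log_nonneg hp1]
  · have hlp : log p / q ≤ 1 := (div_le_one hq0).mpr (hpq p hp)
    split_ifs with h
    · refine trigSeries_normLocalFactor_large hδ k (hP p hp).1 (by positivity) ?_ ?_
      · simpa [hα, h, div_eq_inv_mul] using hlp
      · simp only [hα, h, pow_zero]
        exact one_div_le_one_div_of_le (by norm_num) (by linarith)
    · refine trigSeries_normLocalFactor_small hδ k (hP p hp).1 (by positivity) ?_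
      calc α (b p) * log p = (1 / 8) ^ b p * (log p / q) := by rw [hα]; ring
        _ ≤ (1 / 8) ^ 1 * 1 := by
          refine mul_le_mul ?_ hlp (div_nonneg (log_natCast_nonneg p) hq0.le) (by norm_num)
          exact pow_le_pow_of_le_one (by norm_num) (by norm_num) (Nat.one_le_iff_ne_zero.mpr h)
        _ = 1 / 8 := by norm_num
  · refine le_trans ?_ (hgain j hj)
    rcases Nat.eq_zero_or_pos j with rfl | hj0
    · rw [Finset.sum_congr rfl fun p hp => if_pos (Finset.mem_filter.mp hp).2]
      refine (sum_loss_large_le (l := l) (y := y) _ (fun p hp => ?_) (by linarith) hk1 hky).trans ?_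
      · obtain ⟨h1, h2⟩ := Finset.mem_filter.mp hp
        exact ⟨(hP p h1).1, hb0 p h2, (hP p h1).2⟩
      -- This is where the constant e^{10} in the hypothesis on k is spent: 77.65 · 9 · 24 < 21000 <
      -- e^{10}.
      · calc 77.65 * (k * (5 + log (y / k)) / l) ≤ 77.65 * (9 * (1 / 21000) * L / l) := by
              gcongr 77.65 * (?_ / l)
              refine hmain.trans ?_
              gcongr
          _ = 77.65 * 9 / 21000 * 24 * (L / (24 * l)) := by field_simp
          _ ≤ _ := by
            rw [pow_zero]
            gcongr
            norm_num
    · rw [Finset.sum_congr rfl (g := fun p : ℕ => log 72 + log (1 + k * (1 / p)) / 2 +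
        9 * (k * (1 / p) * ((1 / 8) ^ j / q * log p) ^ 2)) fun p hp => by
          have h := (Finset.mem_filter.mp hp).2
          rw [if_neg (by omega), h]]
      refine (sum_loss_small_le hj0 _ (fun p hp => ?_) (by linarith) hk1 (hlogk.trans hlq) hlq
        hs).trans ?_
      · obtain ⟨h1, h2⟩ := Finset.mem_filter.mp hp
        have h3 := hbj p (by omega)
        rw [h2] at h3
        exact ⟨(hP p h1).1, h3⟩
      · gcongr (1 / 16) ^ j * ?_
        calc 334 * (k / l) ≤ 334 * (1 / 21000 / 2 * L / l) := by
              gcongr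
              refine hkL.trans ?_
              gcongr
          _ = 334 / 42000 * 24 * (L / (24 * l)) := by field_simp; norm_num
          _ ≤ 1 * (L / (24 * l)) := by gcongr; norm_num
          _ = _ := one_mul _
  · rw [hH, ← Finset.sum_mul]
    nlinarith [sum_geometric_two_le N]
  · calc _ ≤ ∑ j ∈ Finset.range N, (1 / 2) ^ j * (L / 6) := by
          refine Finset.sum_le_sum fun j _ => ?_
          rw [hαH]
          gcongr <;> linarith
      _ ≤ _ := by
        rw [← Finset.sum_mul]
        nlinarith [sum_geometric_two_le N]
  · have h2 : (2 : ℝ) ^ (N + 1) ≤ exp (l + 2) := by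
      calc (2 : ℝ) ^ (N + 1) ≤ exp 1 ^ (N + 1) := by
            gcongr; linarith [exp_one_gt_d9]
        _ = exp ((N + 1 : ℕ) * 1) := by rw [exp_nat_mul]
        _ ≤ _ := exp_le_exp.mpr (by push_cast; linarith)
    gcongr

/-- For k ≤ √L a single block suffices: the loss 14k Σ 1/p is O(√L · l), far below the gain of order
L/l. -/
lemma abs_mean_sub_one_le_of_small {δ : ℤ} (hδ : δ = 1 ∨ δ = -1) {k : ℕ} {l y : ℝ} (hl : 24 ≤ l)
    (hly : l ≤ log y) (hy : 0 < y) (hyl : log y ≤ 2 * l) (hk1 : (k : ℝ) ≤ exp (l / 2))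
    (hl2 : 448 * l * (1 + 2 * l) ≤ exp (l / 2))
    (hη : (l + 1) * exp (-(exp l / l ^ 4)) ≤ 1) :
    |(1 / exp (exp l)) * (∫ t in exp (exp l)..2 * exp (exp l),
        ∏ p ∈ Nat.primesBelow (⌊y⌋₊ + 1), normLocalFactor δ k p t) - 1| ≤
      8 * ((l + 1) * exp (-(exp l / l ^ 4))) + 3 * (exp (l + 2) * exp (-(exp l / 3))) := by
  set L := exp l with hL
  have hL0 : 0 < L := exp_pos l
  set q := log y with hq
  have hq0 : 0 < q := by linarith
  have hy1 : 1 ≤ y := by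
    by_contra h
    push Not at h
    linarith [log_nonpos hy.le h.le]
  have hP := fun p hp => prime_le_of_mem_primesBelow_floor (p := p) hy.le hp
  have hpq : ∀ p ∈ Nat.primesBelow (⌊y⌋₊ + 1), log p ≤ q := fun p hp =>
    log_le_log (by exact_mod_cast (hP p hp).1.pos) (hP p hp).2
  have hsum : ∑ p ∈ Nat.primesBelow (⌊y⌋₊ + 1), 1 / (p : ℝ) ≤ 2 * (1 + q) := by
    have h1 := sum_primes_log_div_le zero_lt_one hy1
    rw [div_one, Nat.floor_one] at h1
    have h2 : log 4 = 2 * log 2 := by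
      rw [show (4 : ℝ) = 2 ^ 2 by norm_num, log_pow]; norm_num
    have h3 : 0 < log 2 := log_pos (by norm_num)
    have h4 : log 2 * ∑ p ∈ Nat.primesBelow (⌊y⌋₊ + 1), 1 / (p : ℝ) ≤ log 4 * (1 + q) := by
      refine le_trans ?_ h1
      rw [Finset.mul_sum]
      refine le_trans (Finset.sum_le_sum (g := fun p : ℕ => log p / p) fun p hp => ?_)
        (Finset.sum_le_sum_of_subset_of_nonneg (fun p hp => ?_) fun p hp _ =>
          div_nonneg (log_natCast_nonneg p) (Nat.cast_nonneg p))
      · rw [mul_one_div]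
        have : (2 : ℝ) ≤ p := by exact_mod_cast (hP p hp).1.two_le
        gcongr
      · rw [Finset.mem_filter, Finset.mem_Ioc]
        exact ⟨⟨(hP p hp).1.one_lt, Nat.le_floor (hP p hp).2⟩, (hP p hp).1⟩
    rw [h2] at h4
    nlinarith
  have hexp : exp (l / 2) * exp (l / 2) = L := by rw [← exp_add, hL]; ring_nf
  have hη1 : exp (-(L / l ^ 4)) ≤ (l + 1) * exp (-(L / l ^ 4)) :=
    le_mul_of_one_le_left (exp_pos _).le (by linarith)
  refine (abs_mean_normLocalFactor_sub_one_le hδ k (Nat.primesBelow (⌊y⌋₊ + 1))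
    (fun p hp => (hP p hp).1) (fun _ => 0) 1 (fun p hp => zero_lt_one) (fun _ => 1 / q)
    (fun _ => L / 4) (fun p => 14 * k * (1 / (p : ℝ))) (L := L) (η := L / l ^ 4)
    (fun j => by positivity)
    (fun j => by positivity) (by positivity) (by push_cast; linarith) (fun p hp => ?_)
    (fun j hj => ?_) ?_ ?_).trans ?_
  · refine trigSeries_normLocalFactor_large hδ k (hP p hp).1 (by positivity) ?_
      (one_div_le_one_div_of_le (by norm_num) (by linarith))
    rw [one_div_mul_eq_div]
    exact (div_le_one hq0).mpr (hpq p hp)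
  · have h1 : L / (8 * l) ≤ 1 / q * (L / 4) := by
      rw [one_div_mul_eq_div, div_div]
      refine div_le_div_of_nonneg_left hL0.le (by positivity) (by linarith)
    have h2 : L / l ^ 4 ≤ L / (16 * l) := by
      refine div_le_div_of_nonneg_left hL0.le (by positivity) ?_
      have : 16 ≤ l ^ 3 := by
        calc (16 : ℝ) ≤ 24 ^ 3 := by norm_num
          _ ≤ l ^ 3 := by gcongr
      nlinarith
    have h3 : ∑ p ∈ Nat.primesBelow (⌊y⌋₊ + 1) with 0 = j, 14 * k * (1 / (p : ℝ)) ≤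
        14 * exp (l / 2) * (2 * (1 + 2 * l)) := by
      obtain rfl : j = 0 := by omega
      rw [Finset.filter_true_of_mem fun _ _ => rfl, ← Finset.mul_sum]
      gcongr
      linarith
    have h4 : 14 * exp (l / 2) * (2 * (1 + 2 * l)) ≤ L / (16 * l) := by
      rw [le_div_iff₀ (by positivity), ← hexp]
      nlinarith [exp_pos (l / 2)]
    have h5 : L / (8 * l) = 2 * (L / (16 * l)) := by field_simp; norm_num
    linarith
  · rw [Finset.sum_const, Finset.card_range, one_smul]
    linarith
  · simp only [Finset.sum_const, Finset.card_range, one_smul]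
    have : 1 / q ≤ 1 := by rw [div_le_one hq0]; linarith
    nlinarith
  · have h2 : (2 : ℝ) ^ (1 + 1) ≤ exp (l + 2) := by
      have := add_one_le_exp (l + 2)
      norm_num
      linarith
    push_cast
    gcongr
    linarith

end MeanValue

/-! ### The mean value estimate, uniformly in T. -/

section MeanValueUniform

open Real Filter

/-- The mean value of the normalized `|ζ(1 + it; y)|^{2δk}` over `[T, 2T]`. -/
noncomputable def normalizedMean (δ : ℤ) (k : ℕ) (T y : ℝ) : ℝ :=
  (1 / T) * ∫ t in T..2 * T, ∏ p ∈ Nat.primesBelow (⌊y⌋₊ + 1), normLocalFactor δ k p t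

lemma localMax_le_four_pow {δ : ℤ} (hδ : δ = 1 ∨ δ = -1) (k : ℕ) {x : ℝ} (hx0 : 0 ≤ x)
    (hx : x ≤ 1 / 2) : localMax δ k x ≤ 4 ^ k := by
  rcases hδ with rfl | rfl
  · have h : (1 / 4 : ℝ) ≤ (1 - x) ^ 2 := by nlinarith
    rw [localMax_one, ← inv_pow]
    exact pow_le_pow_left₀ (by positivity)
      ((inv_anti₀ (by norm_num) h).trans (by norm_num)) k
  · rw [localMax_neg_one]
    exact pow_le_pow_left₀ (by positivity) (by nlinarith) k

lemma normLocalFactor_le {δ : ℤ} (hδ : δ = 1 ∨ δ = -1) (k : ℕ) {p : ℕ} (hp : p.Prime) (t : ℝ) :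
    normLocalFactor δ k p t ≤ 16 ^ k := by
  obtain ⟨h0, h2⟩ := one_div_prime_mem hp
  have h3 := localMax_le_four_pow hδ k h0 h2
  have h4 := circleNormSq_zpow_le_localMax hδ k h0 (by linarith) (t * log p)
  rw [normLocalFactor, div_le_iff₀ (localSum_pos hδ k h0 (by linarith))]
  have h5 : (4 : ℝ) ^ k ≤ 16 ^ k := pow_le_pow_left₀ (by norm_num) (by norm_num) k
  refine ((h4.trans h3).trans h5).trans (le_mul_of_one_le_right (by positivity) ?_)
  exact one_le_localSum hδ k h0 (by linarith)

/-- The reciprocal of the integrand is the integrand for -δ, so the upper bound applies to it. -/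
lemma le_normLocalFactor {δ : ℤ} (hδ : δ = 1 ∨ δ = -1) (k : ℕ) {p : ℕ} (hp : p.Prime) (t : ℝ) :
    (16 ^ k)⁻¹ ≤ normLocalFactor δ k p t := by
  obtain ⟨h0, h2⟩ := one_div_prime_mem hp
  have hx : (1 : ℝ) / p < 1 := by linarith
  have hδ' : -δ = 1 ∨ -δ = -1 := by omega
  have h3 := (circleNormSq_zpow_le_localMax hδ' k h0 hx (t * log p)).trans
    (localMax_le_four_pow hδ' k h0 h2)
  have h4 := (localSum_le_localMax hδ k h0 hx).trans (localMax_le_four_pow hδ k h0 h2)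
  have hpos := zpow_pos (circleNormSq_pos h0 hx (t * log p)) (-(-δ * (k : ℤ)))
  have h5 : (4 ^ k)⁻¹ ≤ circleNormSq (1 / p) (t * log p) ^ (-(δ * (k : ℤ))) := by
    have h6 := inv_anti₀ hpos h3
    rwa [← zpow_neg, neg_neg, neg_mul, zpow_neg, ← zpow_neg] at h6
  rw [normLocalFactor, le_div_iff₀ (localSum_pos hδ k h0 hx)]
  refine le_trans ?_ h5
  calc ((16 : ℝ) ^ k)⁻¹ * localSum (δ * k) (1 / p) ≤ (16 ^ k)⁻¹ * 4 ^ k := by gcongr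
    _ = (4 ^ k)⁻¹ := by
      rw [show (16 : ℝ) = 4 * 4 by norm_num, mul_pow]
      field_simp

/-- A crude bound, only used while T is bounded. -/
lemma abs_log_normalizedMean_le {δ : ℤ} (hδ : δ = 1 ∨ δ = -1) (k : ℕ) {T y : ℝ} (hT : 0 < T)
    (hy : 0 ≤ y) :
    0 < normalizedMean δ k T y ∧ |log (normalizedMean δ k T y)| ≤ 3 * k * (y + 1) := by
  set P := Nat.primesBelow (⌊y⌋₊ + 1) with hPdef
  have hP : ∀ p ∈ P, p.Prime := fun p hp => Nat.prime_of_mem_primesBelow hp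
  have hcard : (P.card : ℝ) ≤ y + 1 := by
    have h1 : P.card ≤ ⌊y⌋₊ + 1 := (Finset.card_filter_le _ _).trans_eq (Finset.card_range _)
    have h2 : (P.card : ℝ) ≤ ⌊y⌋₊ + 1 := by exact_mod_cast h1
    linarith [Nat.floor_le hy]
  have hlog : log ((16 ^ k) ^ P.card) ≤ 3 * k * (y + 1) := by
    rw [log_pow, log_pow, show (16 : ℝ) = 2 ^ 4 by norm_num, log_pow]
    have h1 := log_two_lt_d9
    have h2 : ((4 : ℕ) : ℝ) * log 2 ≤ 3 := by push_cast; linarith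
    have h3 : (0 : ℝ) ≤ log 2 := (log_pos (by norm_num)).le
    calc _ ≤ (y + 1) * (k * 3) := by gcongr
      _ = _ := by ring
  have hcont : Continuous fun t => ∏ p ∈ P, normLocalFactor δ k p t :=
    continuous_finsetProd _ fun p hp => continuous_normLocalFactor δ k (hP p hp)
  have hconst : ∀ c : ℝ, (1 / T) * ∫ _ in T..2 * T, c = c := fun c => by
    rw [intervalIntegral.integral_const, smul_eq_mul]
    field_simp
    ring
  have hup : normalizedMean δ k T y ≤ (16 ^ k) ^ P.card := by
    rw [← hconst ((16 ^ k) ^ P.card), normalizedMean]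
    gcongr
    refine intervalIntegral.integral_mono_on (by linarith) (hcont.intervalIntegrable _ _)
      (by simp) fun t _ => ?_
    rw [← Finset.prod_const]
    exact Finset.prod_le_prod (fun p hp => (normLocalFactor_pos hδ k (hP p hp) t).le) fun p hp =>
      normLocalFactor_le hδ k (hP p hp) t
  have hlow : ((16 ^ k) ^ P.card)⁻¹ ≤ normalizedMean δ k T y := by
    rw [← hconst ((16 ^ k) ^ P.card)⁻¹, normalizedMean]
    gcongr
    refine intervalIntegral.integral_mono_on (by linarith) (by simp)
      (hcont.intervalIntegrable _ _) fun t _ => ?_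
    rw [← inv_pow, ← Finset.prod_const]
    exact Finset.prod_le_prod (fun _ _ => by positivity) fun p hp =>
      le_normLocalFactor hδ k (hP p hp) t
  have hpos : 0 < normalizedMean δ k T y := lt_of_lt_of_le (by positivity) hlow
  refine ⟨hpos, abs_le.mpr ⟨?_, (log_le_log hpos hup).trans hlog⟩⟩
  have h := log_le_log (by positivity) hlow
  rw [log_inv] at h
  linarith

lemma exists_sum_sqrt_div_le :
    ∃ x₀ > 1, ∀ x ≥ x₀,
      ∑ p ∈ (Finset.Ioc 1 ⌊x⌋₊).filter Nat.Prime, √(x / p) ≤ 7 * (x / log x) := by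
  have h := (isLittleO_log_rpow_atTop (show (0 : ℝ) < 1 / 4 by norm_num)).bound
    (show (0 : ℝ) < 0.35 by norm_num)
  obtain ⟨x₀, hx₀⟩ := eventually_atTop.mp h
  refine ⟨max x₀ 2, lt_max_of_lt_right (by norm_num), fun x hx => ?_⟩
  have hx2 : 2 ≤ x := (le_max_right _ _).trans hx
  have hx0 : 0 < x := by linarith
  have h1 := hx₀ x ((le_max_left _ _).trans hx)
  have hlx : 0 < log x := log_pos (by linarith)
  rw [norm_of_nonneg hlx.le, norm_of_nonneg (by positivity)] at h1
  have h2 : x ^ (3 / 4 : ℝ) * x ^ (1 / 4 : ℝ) = x := by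
    rw [← rpow_add hx0]; norm_num
  have h3 : x ^ (3 / 4 : ℝ) ≤ 0.35 * (x / log x) := by
    rw [← mul_div_assoc, le_div_iff₀ hlx]
    calc _ ≤ x ^ (3 / 4 : ℝ) * (0.35 * x ^ (1 / 4 : ℝ)) := by gcongr
      _ = 0.35 * (x ^ (3 / 4 : ℝ) * x ^ (1 / 4 : ℝ)) := by ring
      _ = _ := by rw [h2]
  linarith [sum_primes_sqrt_div_le (by linarith : 1 < x)]

lemma exists_abs_normalizedMean_sub_one_le_of_large :
    ∃ l₀ : ℝ, ∀ (l y : ℝ) (k : ℕ) (δ : ℤ), l₀ ≤ l → (δ = 1 ∨ δ = -1) → 2 ≤ k →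
      exp 2 * exp l ≤ y → y ≤ exp l * l ^ 4 → k * log (y / exp l) ≤ exp (-10) * exp l →
      |normalizedMean δ k (exp (exp l)) y - 1| ≤ exp (-(exp l / (2 * l ^ 4))) ∧
        |normalizedMean δ k (exp (exp l)) y - 1| ≤ 1 / 2 := by
  obtain ⟨x₀, hx₀, hsum⟩ := exists_sum_sqrt_div_le
  -- The number 65000 makes the polynomial-versus-exponential comparisons hold, and 2 log x₀ ensures
  -- that k > e^{l/2} lies in the range of the prime sum estimate.
  refine ⟨max 65000 (2 * log x₀), fun l y k δ hl hδ hk hy1 hy2 hkL => ?_⟩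
  have hl1 : 65000 ≤ l := (le_max_left _ _).trans hl
  have hl2 : x₀ ≤ exp (l / 2) := by
    rw [← exp_log (by linarith : 0 < x₀)]
    exact exp_le_exp.mpr (by linarith [(le_max_right 65000 (2 * log x₀)).trans hl])
  set L := exp l with hL
  have hL0 : 0 < L := exp_pos l
  have hl0 : 0 < l := by linarith
  have hL6 : l ^ 6 / 720 ≤ L := by
    simpa [Nat.factorial] using pow_div_factorial_le_exp l hl0.le 6
  have hL5 : 2 * l ^ 4 * (l + 5) ≤ L := by
    refine le_trans ?_ hL6
    have : 1440 * (l + 5) ≤ l ^ 2 := by nlinarith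
    have h4 : 0 ≤ l ^ 4 := by positivity
    nlinarith [mul_le_mul_of_nonneg_left this h4]
  have hl4 : l ^ 4 ≤ L := by
    refine le_trans ?_ hL5
    have h4 : 0 ≤ l ^ 4 := by positivity
    nlinarith
  have hη : l + 5 ≤ L / (2 * l ^ 4) := by
    rw [le_div_iff₀ (by positivity)]; linarith
  have hy0 : 0 < y := lt_of_lt_of_le (by positivity) hy1
  have hLy : 2 ≤ log (y / L) := by
    rw [le_log_iff_exp_le (by positivity), le_div_iff₀ hL0]
    exact hy1
  have hyl : log y ≤ 2 * l := by
    rw [log_le_iff_le_exp hy0]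
    refine hy2.trans ?_
    calc L * l ^ 4 ≤ L * L := by gcongr
      _ = exp (2 * l) := by rw [← exp_add]; ring_nf
  have hly : l ≤ log y := by
    have : log (y / L) = log y - l := by rw [log_div hy0.ne' hL0.ne', hL, log_exp]
    linarith
  -- The block estimate has exp(-L/l⁴) = ε²; the spare ε absorbs the factor 8(l + 1). This explains
  -- the 2 in the final exponent.
  set ε := exp (-(L / (2 * l ^ 4))) with hε
  have hε0 : 0 < ε := exp_pos _
  have hεsq : exp (-(L / l ^ 4)) = ε * ε := by
    rw [hε, ← exp_add]
    congr 1
    field_simp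
    norm_num
  have hεl : 32 * (l + 1) * ε ≤ 1 := by
    have h1 : exp (l + 5) * ε ≤ 1 := by
      rw [hε, ← exp_add]
      exact exp_le_one_iff.mpr (by linarith)
    have h2 : 32 * (l + 1) ≤ exp (l + 5) := by
      rw [exp_add, mul_comm]
      have h3 : (2 : ℝ) ^ 5 ≤ exp 5 := by
        have := pow_le_pow_left₀ (by norm_num) (by linarith [exp_one_gt_d9] : (2 : ℝ) ≤ exp 1) 5
        rwa [← exp_nat_mul, mul_one, Nat.cast_ofNat] at this
      exact mul_le_mul (add_one_le_exp l) (le_trans (by norm_num) h3) (by norm_num) (exp_pos l).le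
    nlinarith
  have hη1 : (l + 1) * exp (-(L / l ^ 4)) ≤ 1 := by
    rw [hεsq]
    nlinarith
  have hbound : 8 * ((l + 1) * exp (-(L / l ^ 4))) + 3 * (exp (l + 2) * exp (-(L / 3))) ≤ ε := by
    have h1 : exp (l + 2) * exp (-(L / 3)) ≤ ε * exp (-2) := by
      rw [hε, ← exp_add, ← exp_add]
      refine exp_le_exp.mpr ?_
      have h2 : L / (2 * l ^ 4) ≤ L / 6 := by
        refine div_le_div_of_nonneg_left hL0.le (by norm_num) ?_
        have : (1 : ℝ) ≤ l ^ 3 := one_le_pow₀ (by linarith)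
        nlinarith
      have h3 : 6 * (l + 4) ≤ L := by
        refine le_trans ?_ hL5
        have : (1 : ℝ) ≤ l ^ 3 := one_le_pow₀ (by linarith)
        nlinarith [mul_le_mul_of_nonneg_right this hl0.le]
      linarith
    have h4 : exp (-2) ≤ 1 / 6 := by
      rw [exp_neg, ← one_div]
      refine one_div_le_one_div_of_le (by norm_num) ?_
      have := pow_le_pow_left₀ (by norm_num) (by linarith [exp_one_gt_d9] : (2.7 : ℝ) ≤ exp 1) 2
      rw [← exp_nat_mul, mul_one, Nat.cast_ofNat] at this
      exact le_trans (by norm_num) this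
    rw [hεsq]
    nlinarith
  have hmain : |normalizedMean δ k (exp L) y - 1| ≤ ε := by
    refine le_trans ?_ hbound
    rcases le_or_gt (k : ℝ) (exp (l / 2)) with h | h
    · refine abs_mean_sub_one_le_of_small hδ (by linarith) hly hy0 hyl h ?_ hη1
      have h3 : (l / 2) ^ 3 / 6 ≤ exp (l / 2) := by
        simpa [Nat.factorial] using pow_div_factorial_le_exp (l / 2) (by linarith) 3
      refine le_trans ?_ h3
      nlinarith [mul_nonneg hl0.le hl0.le]
    · refine abs_mean_sub_one_le_of_large hδ (by linarith) hLy hy0 hyl ?_ hkL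
        (hsum k (hl2.trans h.le)) hη1
      rw [le_log_iff_exp_le (by positivity)]
      exact h.le
  exact ⟨hmain, hmain.trans (by nlinarith)⟩

/-- For l below l₀ both k and y are bounded, so the crude bound applies and exp(-L/(2l⁴)) is bounded
below; everything is absorbed into D. -/
lemma exists_abs_normalizedMean_sub_one_le :
    ∃ D > 0, ∀ (l y : ℝ) (k : ℕ) (δ : ℤ), (δ = 1 ∨ δ = -1) → 2 ≤ k → 1 ≤ l →
      exp 2 * exp l ≤ y → y ≤ exp l * l ^ 4 → k * log (y / exp l) ≤ exp (-10) * exp l →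
      0 < normalizedMean δ k (exp (exp l)) y ∧
      |normalizedMean δ k (exp (exp l)) y - 1| ≤ D * exp (-(exp l / (2 * l ^ 4))) ∧
      |log (normalizedMean δ k (exp (exp l)) y)| ≤ D := by
  obtain ⟨l₀, h₀⟩ := exists_abs_normalizedMean_sub_one_le_of_large
  set R := 3 * exp l₀ * (exp l₀ * l₀ ^ 4 + 1) with hR
  have hR0 : 0 ≤ R := by positivity
  refine ⟨1 + R + (exp R + 1) * exp (exp l₀), by positivity,
    fun l y k δ hδ hk hl hy1 hy2 hkL => ?_⟩
  have hy0 : 0 < y := lt_of_lt_of_le (by positivity) hy1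
  obtain ⟨hpos, hlog⟩ := abs_log_normalizedMean_le hδ k (exp_pos (exp l)) hy0.le
  set μ := normalizedMean δ k (exp (exp l)) y
  refine ⟨hpos, ?_⟩
  have hl0 : 0 < l := by linarith
  have hX : 0 ≤ (exp R + 1) * exp (exp l₀) := by positivity
  rcases le_total l₀ l with h | h
  · obtain ⟨h1, h2⟩ := h₀ l y k δ h hδ hk hy1 hy2 hkL
    refine ⟨h1.trans (le_mul_of_one_le_left (exp_pos _).le (by linarith)), ?_⟩
    rw [abs_le] at h2
    have h3 := log_le_sub_one_of_pos hpos
    have h4 := one_sub_inv_le_log_of_pos hpos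
    have h5 : μ⁻¹ ≤ 2 := by
      rw [inv_le_comm₀ hpos (by norm_num)]
      linarith
    rw [abs_le]
    constructor <;> linarith
  · have hkl : (k : ℝ) ≤ exp l := by
      have h1 : 2 ≤ log (y / exp l) := by
        rw [le_log_iff_exp_le (by positivity), le_div_iff₀ (exp_pos l)]
        exact hy1
      have h2 : exp (-10) ≤ 1 := exp_le_one_iff.mpr (by norm_num)
      have h3 : (0 : ℝ) ≤ k := Nat.cast_nonneg k
      nlinarith [exp_pos l]
    have hyl : y ≤ exp l₀ * l₀ ^ 4 := hy2.trans (by gcongr)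
    have hlogR : |log μ| ≤ R := by
      refine hlog.trans ?_
      rw [hR]
      gcongr
      exact hkl.trans (exp_le_exp.mpr h)
    refine ⟨?_, hlogR.trans (by linarith)⟩
    have h1 : μ ≤ exp R := by
      rw [← exp_log hpos]
      exact exp_le_exp.mpr ((le_abs_self _).trans hlogR)
    have h2 : |μ - 1| ≤ exp R + 1 := by
      rw [abs_le]
      constructor <;> linarith
    have h3 : 1 ≤ exp (exp l₀) * exp (-(exp l / (2 * l ^ 4))) := by
      rw [← exp_add]
      refine one_le_exp ?_
      have h4 : exp l / (2 * l ^ 4) ≤ exp l := by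
        refine div_le_self (exp_pos l).le ?_
        have : 1 ≤ l ^ 4 := one_le_pow₀ hl
        linarith
      linarith [exp_le_exp.mpr h]
    calc |μ - 1| ≤ (exp R + 1) * (exp (exp l₀) * exp (-(exp l / (2 * l ^ 4)))) :=
          h2.trans (le_mul_of_one_le_right (by positivity) h3)
      _ = (exp R + 1) * exp (exp l₀) * exp (-(exp l / (2 * l ^ 4))) := by ring
      _ ≤ _ := by gcongr; linarith

end MeanValueUniform

/-! ### Assembly of the theorem. -/

theorem theorem4p1 :
    -- both integrals defining the constant `C` converge
    MeasureTheory.IntegrableOn (fun t : ℝ => Real.log (besselIZero t) / t ^ 2) (Set.Ioc 0 2) ∧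
    MeasureTheory.IntegrableOn (fun t : ℝ => (Real.log (besselIZero t) - t) / t ^ 2) (Set.Ioi 2) ∧
    -- `A` is the absolute constant implied by all the `O`-terms
    ∃ A : ℝ, 0 < A ∧
      ∀ (T y : ℝ) (k : ℕ) (δ : ℤ), 1 < T →
        Real.exp 2 * Real.log T ≤ y →
        y ≤ Real.log T * Real.log (Real.log T) ^ 4 →
        (δ = 1 ∨ δ = -1) →
        2 ≤ k →
        (k : ℝ) ≤ Real.log T / (Real.exp 10 * Real.log (y / Real.log T)) →
        Summable (fun n : Nat.smoothNumbers (⌊y⌋₊ + 1) =>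
          genDivisor ((δ : ℝ) * k) n ^ 2 / ((n : ℕ) : ℝ) ^ 2) ∧
        ∃ E₁ E₂ E₃ : ℝ,
          |E₁| ≤ A * Real.exp (-(Real.log T / (2 * Real.log (Real.log T) ^ 4))) ∧
          |E₂| ≤ A * ((k : ℝ) / y + 1 / Real.log k) ∧
          |E₃| ≤ A * ((k : ℝ) / y + 1 / Real.log k) ∧
          truncatedZetaMoment T y (2 * (δ * k)) =
            smoothDivisorSum ((δ : ℝ) * k) y * (1 + E₁) ∧
          smoothDivisorSum ((δ : ℝ) * k) y =
            (∏ p ∈ Nat.primesBelow (k + 1), (1 - (δ : ℝ) / p) ^ (-(2 * (k : ℤ) * δ))) *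
              Real.exp (2 * k / Real.log k * (momentConstant + E₂)) ∧
          truncatedZetaMoment T y (2 * (δ * k)) =
            (∏ p ∈ Nat.primesBelow (k + 1), (1 - (δ : ℝ) / p) ^ (-(2 * (k : ℤ) * δ))) *
              Real.exp (2 * k / Real.log k * (momentConstant + E₃)) := by
  obtain ⟨A₀, hA₀, hsum⟩ := exists_abs_log_smoothDivisorSum_sub_le
  obtain ⟨D, hD, hmean⟩ := exists_abs_normalizedMean_sub_one_le
  refine ⟨integrableOn_log_besselIZero, integrableOn_log_besselIZero_sub, A₀ / 2 + 2 * D,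
    by positivity, fun T y k δ hT hy1 hy2 hδ hk hkL =>
      ⟨(summable_and_smoothDivisorSum_eq_prod hδ k y).1, ?_⟩⟩
  have hk2 : (2 : ℝ) ≤ k := by exact_mod_cast hk
  have hk0 : (0 : ℝ) < k := by linarith
  have hL0 : 0 < Real.log T := Real.log_pos hT
  obtain ⟨l, hl⟩ : ∃ l, l = Real.log (Real.log T) := ⟨_, rfl⟩
  have hL : Real.exp l = Real.log T := by rw [hl, Real.exp_log hL0]
  have hTe : Real.exp (Real.exp l) = T := by rw [hL, Real.exp_log (by linarith)]
  rw [← hl, ← hL] at hy2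
  rw [← hL] at hy1 hkL
  rw [← hl, ← hL]
  have hy0 : 0 < y := lt_of_lt_of_le (by positivity) hy1
  have hLy : 2 ≤ Real.log (y / Real.exp l) := by
    rw [Real.le_log_iff_exp_le (by positivity), le_div_iff₀ (Real.exp_pos l)]
    exact hy1
  have hkl : k * Real.log (y / Real.exp l) ≤ Real.exp (-10) * Real.exp l := by
    rw [le_div_iff₀ (by positivity)] at hkL
    rw [Real.exp_neg, inv_mul_eq_div, le_div_iff₀ (Real.exp_pos _)]
    linarith
  have h10 : Real.exp (-10) ≤ 1 := Real.exp_le_one_iff.mpr (by norm_num)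
  have hkL1 : (k : ℝ) ≤ Real.exp l := by nlinarith [Real.exp_pos l]
  -- Since k ≥ 2 and log(y/L) ≥ 2, the hypothesis on k forces e^{l-10} ≥ 4.
  have hl1 : 1 ≤ l := by
    have h : Real.exp (-10) * Real.exp l ≥ 1 := by nlinarith
    rw [← Real.exp_add, ge_iff_le, Real.one_le_exp_iff] at h
    linarith
  have hky : (k : ℝ) ≤ y := by
    have : (1 : ℝ) ≤ Real.exp 2 := Real.one_le_exp (by norm_num)
    nlinarith [Real.exp_pos l]
  have hlk : 0 < Real.log k := Real.log_pos (by linarith)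
  have hS0 := smoothDivisorSum_pos hδ k y
  have hP0 := maxProduct_pos hδ k
  set S := smoothDivisorSum ((δ : ℝ) * k) y
  set C := momentConstant
  change ∃ E₁ E₂ E₃ : ℝ, _ ∧ _ ∧ _ ∧ _ ∧
    S = maxProduct δ k * Real.exp (2 * k / Real.log k * (C + E₂)) ∧
    _ = maxProduct δ k * Real.exp (2 * k / Real.log k * (C + E₃))
  obtain ⟨hμ0, hμ1, hμ2⟩ := hmean l y k δ hδ hk hl1 hy1 hy2 hkl
  have hmom := truncatedZetaMoment_eq hδ k T y
  rw [← normalizedMean, ← hTe] at hmom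
  rw [hTe] at hmom hμ0 hμ1 hμ2
  set μ := normalizedMean δ k T y
  -- The inverse of the factor 2k / log k. As r = O(1 / log k), a bounded log μ changes the exponent
  -- only within the allowed error.
  set r := Real.log k / (2 * k) with hr
  have hr0 : 0 < r := by positivity
  have hrk : 2 * k / Real.log k * r = 1 := by rw [hr]; field_simp
  have hrlog : r ≤ 2 * (1 / Real.log k) := by
    have h1 : Real.log k ≤ 2 * √k := by
      have h2 := Real.log_le_sub_one_of_pos (Real.sqrt_pos.mpr hk0)
      rw [Real.log_sqrt hk0.le] at h2
      linarith
    have h3 : Real.log k ^ 2 ≤ 4 * k := by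
      calc Real.log k ^ 2 ≤ (2 * √k) ^ 2 := by gcongr
        _ = 4 * (k : ℝ) := by rw [mul_pow, Real.sq_sqrt hk0.le]; norm_num
    rw [hr, mul_one_div, div_le_div_iff₀ (by positivity) hlk]
    nlinarith
  have hky0 : 0 ≤ (k : ℝ) / y := by positivity
  have hE₂ : |(Real.log S - Real.log (maxProduct δ k)) * r - C| ≤
      A₀ / 2 * (k / y + 1 / Real.log k) := by
    have h := hsum k y δ hδ hk hky
    have e : (Real.log S - Real.log (maxProduct δ k)) * r - C =
        (Real.log S - Real.log (maxProduct δ k) - 2 * k / Real.log k * C) * r := by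
      linear_combination C * hrk
    rw [e, abs_mul, abs_of_pos hr0]
    calc _ ≤ A₀ * (k / Real.log k * (k / y + 1 / Real.log k)) * r := by gcongr
      _ = A₀ / 2 * (k / y + 1 / Real.log k) * (2 * k / Real.log k * r) := by ring
      _ = _ := by rw [hrk, mul_one]
  have hE₂' : maxProduct δ k * Real.exp (2 * k / Real.log k *
      (C + ((Real.log S - Real.log (maxProduct δ k)) * r - C))) = S := by
    have e : 2 * k / Real.log k * (C + ((Real.log S - Real.log (maxProduct δ k)) * r - C)) =
        Real.log S - Real.log (maxProduct δ k) := by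
      linear_combination (Real.log S - Real.log (maxProduct δ k)) * hrk
    rw [e, Real.exp_sub, Real.exp_log hS0, Real.exp_log hP0, mul_div_cancel₀ _ hP0.ne']
  have hX : 0 ≤ k / y + 1 / Real.log k := by positivity
  -- The second and third errors are defined by solving the two exponential formulas; they differ by
  -- r log μ.
  refine ⟨μ - 1, (Real.log S - Real.log (maxProduct δ k)) * r - C,
    (Real.log S - Real.log (maxProduct δ k)) * r - C + Real.log μ * r, ?_, ?_, ?_, ?_, hE₂'.symm, ?_⟩
  · refine hμ1.trans ?_
    gcongr
    linarith
  · refine hE₂.trans ?_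
    gcongr
    linarith
  · refine (abs_add_le _ _).trans ?_
    have h : |Real.log μ * r| ≤ 2 * D * (k / y + 1 / Real.log k) := by
      rw [abs_mul, abs_of_pos hr0]
      calc _ ≤ D * (2 * (1 / Real.log k)) := by gcongr
        _ = 2 * D * (1 / Real.log k) := by ring
        _ ≤ _ := by gcongr; linarith
    linarith
  · rw [hmom]; ring
  · rw [hmom, ← add_assoc, mul_add, Real.exp_add, ← mul_assoc, hE₂',
      show 2 * k / Real.log k * (Real.log μ * r) = Real.log μ by
        linear_combination Real.log μ * hrk, Real.exp_log hμ0]
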